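/- **Theorem (collapse of the NLS ground states).** Let $s>0$, $\zeta\ge 0$, $\mathfrak b:=3\pi^2/2$, $Q_0(x):=(\cosh \pi x)^{-1/2}$ and $\mathcal Q_s:=s\int_{\mathbb R}|x|^s|Q_0(x)|^2\,dx$. For $a\in\mathbb R$ and $b>0$ let $$\mathcal E_{a,b}(u):=\int_{\mathbb R}\Big(|u'(x)|^2+|x|^s|u(x)|^2+\tfrac a2|u(x)|^4-\tfrac b6|u(x)|^6\Big)dx,\qquad E_{a,b}:=\inf\{\mathcal E_{a,b}(u): u\in H^1(\mathbb R;\mathbb C),\ \|u\|_{L^2}=1\}$$ (with $\mathcal E_{a,b}(u)=+\infty$ if $\int|x|^s|u|^2=\infty$). Let $(a_n)\subset\mathbb R$ and $(b_n)\subset(0,\mathfrak b]$ satisfy $a_n\to0$, $b_n\to\mathfrak b$, $\max\{0,a_n\}+(\mathfrak b-b_n)>0$ for all $n$, and $$\lim_{n\to\infty}a_n(\mathfrak b-b_n)^{-\frac{s+1}{s+2}}=\pi\,\frac{6-\zeta}{6}\,\zeta^{-\frac{s+1}{s+2}}\,\mathcal Q_s^{\frac1{s+2}}\in(-\infty,+\infty],$$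 where $0^{-\frac{s+1}{s+2}}=+\infty$. Let $$\ell_n=\Big(\frac{6a_n}{(6-\zeta)\pi\mathcal Q_s}\Big)^{\frac1{s+1}}\ \text{ if }\zeta\ne6,\qquad \ell_n=\Big(\frac{\mathfrak b-b_n}{\zeta\mathcal Q_s}\Big)^{\frac1{s+2}}\ \text{ if }\zeta\neq0$$ (either formula may be used if $\zeta\notin\{0,6\}$; the formulas make sense and are positive for $n$ large). Let $(u_n)$ be a sequence of ground states, or more generally of approximate ground states, that is, $u_n\in H^1(\mathbb R;\mathbb C)$, $\|u_n\|_{L^2}=1$ and $$E_{a_n,b_n}\le\mathcal E_{a_n,b_n}(u_n)\le E_{a_n,b_n}+o(\ell_n^s)\qquad(n\to\infty).$$ Then there are $\theta_n\in\mathbb R$ such that $$e^{i\theta_n}\sqrt{\ell_n}\,u_n(\ell_n\,\cdot)\longrightarrow Q_0\quad\text{strongly in }H^1(\mathbb R),$$ and if $u_n\ge0$ almost everywhere for all $n$, then $\sqrt{\ell_n}\,u_n(\ell_n\,\cdot)\to Q_0$ strongly in $H^1(\mathbb R)$. Furthermore, $$E_{a_n,b_n}=\Big(\frac{s+1}{s}-\frac{\zeta}{12}+o(1)\Big)\mathcal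 Q_s\,\ell_n^s .$$ -/

import Mathlib

open MeasureTheory Filter Topology Asymptotics
open scoped ContDiff ENNReal

namespace NLSCollapse

noncomputable section

/-- `g` is a weak (distributional) derivative of `u : ℝ → ℂ`. -/
def IsWeakDeriv (u g : ℝ → ℂ) : Prop :=
  LocallyIntegrable u volume ∧ LocallyIntegrable g volume ∧
    ∀ φ : ℝ → ℝ, ContDiff ℝ ∞ φ → HasCompactSupport φ →
      ∫ x, deriv φ x • u x = -∫ x, φ x • g x

/-- Weak derivatives are unique almost everywhere. -/
theorem IsWeakDeriv.ae_eq {u g h : ℝ → ℂ} (hg : IsWeakDeriv u g) (hh : IsWeakDeriv u h) :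
    g =ᵐ[volume] h := by
  refine ae_eq_of_integral_contDiff_smul_eq hg.2.1 hh.2.1 (fun φ h1 h2 => ?_)
  have h3 := hg.2.2 φ h1 h2
  have h4 := hh.2.2 φ h1 h2
  exact neg_injective (h3.symm.trans h4)

/-- The complex Sobolev space `H¹(ℝ)`: `u` and a weak derivative of `u` are square integrable. -/
def MemH1 (u : ℝ → ℂ) : Prop :=
  MemLp u 2 volume ∧ ∃ g : ℝ → ℂ, MemLp g 2 volume ∧ IsWeakDeriv u g

open Classical in
/-- The square-integrable weak derivative of `u` (defined up to a null set; only used on `H¹(ℝ)`). -/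
def weakDeriv (u : ℝ → ℂ) : ℝ → ℂ :=
  if h : ∃ g : ℝ → ℂ, MemLp g 2 volume ∧ IsWeakDeriv u g then h.choose else 0

open Classical in
/-- The norm `(‖f‖₂² + ‖f'‖₂²)^{1/2}` of `H¹(ℝ)`, with the value `∞` outside `H¹(ℝ)`. -/
def h1Norm (f : ℝ → ℂ) : ℝ≥0∞ :=
  if MemH1 f then
    (eLpNorm f 2 volume ^ 2 + eLpNorm (weakDeriv f) 2 volume ^ 2) ^ (1 / 2 : ℝ)
  else ⊤

/-- The critical coupling `𝔟 = 3π²/2`. -/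
def bCrit : ℝ := 3 * Real.pi ^ 2 / 2

/-- The profile `Q₀(x) = (cosh πx)^{-1/2}`. -/
def Q0 (x : ℝ) : ℝ := 1 / √(Real.cosh (Real.pi * x))

/-- `𝒬_s = s ∫ |x|^s |Q₀(x)|² dx`. -/
def Qs (s : ℝ) : ℝ := s * ∫ x : ℝ, |x| ^ s * Q0 x ^ 2

/-- The NLS energy functional
`∫ (|u'|² + |x|^s |u|² + (a/2) |u|⁴ - (b/6) |u|⁶) dx` on `H¹(ℝ)`. There `|u'|²`, `|u|⁴` and
`|u|⁶` are integrable, while the potential energy may be infinite; the energy is then `+∞`. -/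
def nlsEnergy (s a b : ℝ) (u : ℝ → ℂ) : EReal :=
  (((∫ x, ‖weakDeriv u x‖ ^ 2) + a / 2 * (∫ x, ‖u x‖ ^ 4) - b / 6 * (∫ x, ‖u x‖ ^ 6) : ℝ) : EReal)
    + ((∫⁻ x, ENNReal.ofReal (|x| ^ s * ‖u x‖ ^ 2) : ℝ≥0∞) : EReal)

/-- The minimizing domain: `u ∈ H¹(ℝ)` with `‖u‖₂ = 1`. -/
def nlsDomain : Set (ℝ → ℂ) := {u | MemH1 u ∧ eLpNorm u 2 volume = 1}

/-- The NLS ground state energy. -/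
def nlsGroundEnergy (s a b : ℝ) : EReal := sInf (nlsEnergy s a b '' nlsDomain)

/-- `u` is a sequence of approximate ground states for the parameters `(a n, b n)`, up to an error
that is negligible compared with `r n`. Ground states are the case `δ = 0`. The lower bound of
the energy of `u n` by the ground state energy is automatic. -/
def IsApproxGroundStates (s : ℝ) (a b r : ℕ → ℝ) (u : ℕ → ℝ → ℂ) : Prop :=
  (∀ n, u n ∈ nlsDomain) ∧
    ∃ δ : ℕ → ℝ, δ =o[atTop] r ∧
      ∀ᶠ n in atTop, nlsEnergy s (a n) (b n) (u n) ≤ nlsGroundEnergy s (a n) (b n) + (δ n : EReal)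

/-- The mass-preserving rescaling `√ℓ u(ℓ ·)`. -/
def rescale (ℓ : ℝ) (u : ℝ → ℂ) : ℝ → ℂ := fun x => (√ℓ : ℂ) * u (ℓ * x)

/-- The extended real number `c * t ^ (-(s+1)/(s+2))` for `t ≥ 0`, where `0 ^ (-(s+1)/(s+2)) = +∞`
(and `c * ∞ = ∞` if `c > 0`). -/
def ratio (s c t : ℝ) : EReal :=
  (c : EReal) * ((ENNReal.ofReal t ^ (-((s + 1) / (s + 2))) : ℝ≥0∞) : EReal)

/-- The collapse length: either formula may be used when both make sense. -/
def IsCollapseLength (s ζ : ℝ) (a b ℓ : ℕ → ℝ) : Prop :=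
  (ζ ≠ 6 ∧ ∀ n, ℓ n = (6 * a n / ((6 - ζ) * Real.pi * Qs s)) ^ (1 / (s + 1))) ∨
  (ζ ≠ 0 ∧ ∀ n, ℓ n = ((bCrit - b n) / (ζ * Qs s)) ^ (1 / (s + 2)))

end

end NLSCollapse

/-! Since `𝔟/6 = π²/4`, the kinetic term and the critical sextic term combine into the deficit `D(v)
= ∫|v'|² - (π²/4)∫|v|⁶` of the sharp Gagliardo-Nirenberg inequality at unit mass. For `v = √ℓ u(ℓ·)`
the energy divided by `ℓ^s` is `μ D(v) + (β/6)∫|v|⁶ + ∫|x|^s|v|² + (α/2)∫|v|⁴`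
(`realEnergy_eq_scaledEnergy`), where `μ = ℓ^{-(s+2)}`, `β = (𝔟-b) ℓ^{-(s+2)}` and `α = a
ℓ^{-(s+1)}`. The collapse length is chosen so that `μ → ∞`, `β → ζ𝒬_s` and `α → π𝒬_s(6-ζ)/6`
(`collapseRegime`). Bounded rescaled energy then forces `D → 0`, and the other three terms select
one optimizer.

The inequality and its stability are proved directly, without rearrangement or weak compactness. Let
`F` be the cumulative mass of `v` and `r = v' - (π/2) cot(πF)|v|² v`. Expanding `|r|²` gives `|v'|²
- (π²/4)|v|⁶` minus the derivative of `(π/4)|v|⁴ cot(πF)`, and the boundary terms are absorbed by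
the kinetic energy of the two tails; hence `∫|r|² ≤ D(v)` on every interval on which `0 < F < 1` and
whose left end is not right of the median (`integral_gnRemainder_le`). As `r/√sin(πF)` is the
derivative of `v/√sin(πF)`, a small deficit makes `v` close to `c √sin(πF)`, where `c` is its value
at the median (`norm_sub_le`). Thus `F' = |v|²` nearly solves `F' = |c|² sin(πF)`, and Grönwall's
inequality yields pointwise convergence to an explicit optimizer as soon as the median and the value
there converge (`tendsto_gnProfile`).

For a collapsing sequence the potential keeps the medians bounded and prevents loss of mass, so a
subsequence converges to an optimizer with parameters `c ≠ 0` and `y`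
(`CollapsingSeq.exists_subseq`). The limit has unit mass, which upgrades the convergence to `L²` and
to the `L⁴` and `L⁶` norms, while Fatou's lemma handles the potential; so the limiting energy of the
optimizer is at most the limit of the energies. That limiting energy is explicit in `|c|²` and `y`,
with minimum `((s+1)/s - ζ/12)𝒬_s` attained only at `|c| = 1`, `y = 0` (`limitEnergy_ge`). The trial
state `Q₀` gives the matching upper bound. Normalizing the phase at the origin fixes `c = 1`, and
the subsequence principle gives convergence of the whole sequence. Derivatives converge in `L²`
because their norms converge (deficit and `L⁶` norm do) and their pairing with `Q₀'` converges by
parts. -/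

namespace NLSCollapse

/-! ### Absolutely continuous functions: fundamental theorem and product rule -/

/-- `f` is absolutely continuous on the interval with endpoints `a` and `b`, with derivative `f'`
almost everywhere. -/
structure HasACDeriv {E : Type*} [NormedAddCommGroup E] [NormedSpace ℝ E]
    (f f' : ℝ → E) (a b : ℝ) : Prop where
  ac : AbsolutelyContinuousOnInterval f a b
  ae_deriv : ∀ᵐ x, x ∈ Set.uIcc a b → HasDerivAt f (f' x) x
  integrable : IntervalIntegrable f' volume a b

section HasACDeriv

variable {E : Type*} [NormedAddCommGroup E] [NormedSpace ℝ E]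

/-- Increments of the primitive are dominated by those of the primitive of `‖f‖`, which reduces the
vector-valued case to the real one. -/
theorem absolutelyContinuousOnInterval_integral {f : ℝ → E} {a b : ℝ}
    (h : IntervalIntegrable f volume a b) :
    AbsolutelyContinuousOnInterval (fun x ↦ ∫ v in a..x, f v) a b := by
  have h1 := h.norm.absolutelyContinuousOnInterval_intervalIntegral
    (c := a) (Set.left_mem_uIcc)
  unfold AbsolutelyContinuousOnInterval at h1 ⊢
  refine tendsto_of_tendsto_of_tendsto_of_le_of_le' tendsto_const_nhds h1
    (Eventually.of_forall fun I => Finset.sum_nonneg fun i _ => dist_nonneg) ?_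
  refine eventually_inf_principal.2 (Eventually.of_forall fun I hI => ?_)
  refine Finset.sum_le_sum fun i hi => ?_
  have hI' := hI.1 i hi
  have hx : IntervalIntegrable f volume a (I.2 i).1 :=
    h.mono_set (Set.uIcc_subset_uIcc Set.left_mem_uIcc hI'.1)
  have hy : IntervalIntegrable f volume a (I.2 i).2 :=
    h.mono_set (Set.uIcc_subset_uIcc Set.left_mem_uIcc hI'.2)
  rw [dist_eq_norm, dist_eq_norm, intervalIntegral.integral_interval_sub_left hx hy,
    intervalIntegral.integral_interval_sub_left hx.norm hy.norm, Real.norm_eq_abs]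
  exact intervalIntegral.norm_integral_le_abs_integral_norm

namespace HasACDeriv

variable {f f' : ℝ → E} {a b : ℝ}

/-- Subtracting the primitive of `f'` leaves an absolutely continuous function with derivative zero
almost everywhere, hence a constant. -/
theorem integral_eq_sub [CompleteSpace E] (h : HasACDeriv f f' a b) :
    ∫ x in a..b, f' x = f b - f a := by
  have hac := h.ac.sub (absolutelyContinuousOnInterval_integral h.integrable)
  obtain ⟨C, hC⟩ := hac.const_of_ae_hasDerivAt_zero (by
    filter_upwards [h.ae_deriv, h.integrable.ae_hasDerivAt_integral] with x h1 h2 hx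
    simpa using (h1 hx).sub (h2 hx a Set.left_mem_uIcc))
  have ha := hC a Set.left_mem_uIcc
  have hb := hC b Set.right_mem_uIcc
  simp only [Pi.sub_apply, intervalIntegral.integral_same, sub_zero] at ha hb
  rw [ha, ← hb]; abel

theorem of_integral [CompleteSpace E] (hf' : LocallyIntegrable f' volume)
    (h : ∀ x y, f y - f x = ∫ t in x..y, f' t) (a b : ℝ) : HasACDeriv f f' a b := by
  have hi : IntervalIntegrable f' volume a b := (hf'.integrableOn_isCompact isCompact_uIcc).intervalIntegrable
  have hf : f = (fun _ => f a) + fun x => ∫ t in a..x, f' t := by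
    funext x; simp [← h a x]
  refine ⟨?_, ?_, hi⟩
  · rw [hf]
    refine AbsolutelyContinuousOnInterval.add ?_ (absolutelyContinuousOnInterval_integral hi)
    exact ((LipschitzWith.const (f a)).lipschitzOnWith (s := Set.uIcc a b)).absolutelyContinuousOnInterval
  · filter_upwards [LocallyIntegrable.ae_hasDerivAt_integral hf'] with x hx _
    rw [hf]
    simpa using (hasDerivAt_const x (f a)).add (hx a)

theorem of_hasDerivAt (h : ∀ x ∈ Set.uIcc a b, HasDerivAt f (f' x) x)
    (hc : ContinuousOn f' (Set.uIcc a b)) : HasACDeriv f f' a b := by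
  refine ⟨?_, Eventually.of_forall h, hc.intervalIntegrable⟩
  obtain ⟨C, hC⟩ := isCompact_uIcc.exists_bound_of_continuousOn hc
  have hlip : LipschitzOnWith (Real.toNNReal C) f (Set.uIcc a b) :=
    (convex_uIcc a b).lipschitzOnWith_of_nnnorm_hasDerivWithin_le
      (fun x hx => (h x hx).hasDerivWithinAt)
      (fun x hx => by
        rw [← NNReal.coe_le_coe, coe_nnnorm]; exact (hC x hx).trans (Real.le_coe_toNNReal C))
  exact hlip.absolutelyContinuousOnInterval

theorem congr_deriv {g' : ℝ → E} (h : HasACDeriv f f' a b) (hfg : ∀ x, f' x = g' x) :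
    HasACDeriv f g' a b :=
  (funext hfg : f' = g') ▸ h

theorem mul {𝕜 : Type*} [RCLike 𝕜] {f f' g g' : ℝ → 𝕜}
    (hf : HasACDeriv f f' a b) (hg : HasACDeriv g g' a b) :
    HasACDeriv (fun x => f x * g x) (fun x => f' x * g x + f x * g' x) a b := by
  refine ⟨hf.ac.fun_smul hg.ac, ?_, ?_⟩
  · filter_upwards [hf.ae_deriv, hg.ae_deriv] with x h1 h2 hx
    exact (h1 hx).mul (h2 hx)
  · exact (hf.integrable.mul_continuousOn hg.ac.continuousOn).add
      (hg.integrable.continuousOn_mul hf.ac.continuousOn)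

theorem clm_comp {F : Type*} [NormedAddCommGroup F] [NormedSpace ℝ F] (L : E →L[ℝ] F)
    (hf : HasACDeriv f f' a b) : HasACDeriv (fun x => L (f x)) (fun x => L (f' x)) a b := by
  refine ⟨?_, ?_, ?_⟩
  · have h1 : Tendsto (fun I : ℕ × (ℕ → ℝ × ℝ) => ‖L‖ *
        ∑ i ∈ Finset.range I.1, dist (f (I.2 i).1) (f (I.2 i).2)) _ _ :=
      Tendsto.const_mul ‖L‖ hf.ac
    rw [mul_zero] at h1
    refine squeeze_zero (fun I => Finset.sum_nonneg fun i _ => dist_nonneg) (fun I => ?_) h1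
    rw [Finset.mul_sum]
    refine Finset.sum_le_sum fun i _ => ?_
    rw [dist_eq_norm, dist_eq_norm, ← map_sub]
    exact L.le_opNorm _
  · filter_upwards [hf.ae_deriv] with x h1 hx
    exact L.hasFDerivAt.comp_hasDerivAt x (h1 hx)
  · exact ⟨L.integrable_comp hf.integrable.1, L.integrable_comp hf.integrable.2⟩

end HasACDeriv

end HasACDeriv

/-! ### Continuous representatives of `H¹` functions -/

/-- `v` is the continuous representative of an `H¹` function with weak derivative `g`. -/
structure H1Rep (v g : ℝ → ℂ) : Prop where
  memLp : MemLp v 2 volume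
  memLp' : MemLp g 2 volume
  sub_eq : ∀ x y, v y - v x = ∫ t in x..y, g t

theorem locallyIntegrable_of_memLp_two {g : ℝ → ℂ} (hg : MemLp g 2 volume) :
    LocallyIntegrable g volume :=
  hg.locallyIntegrable (by norm_num)

theorem hasACDeriv_of_contDiff {φ : ℝ → ℝ} (hφ : ContDiff ℝ ∞ φ) (a b : ℝ) :
    HasACDeriv (fun x => (φ x : ℂ)) (fun x => ((deriv φ x : ℝ) : ℂ)) a b := by
  refine HasACDeriv.of_hasDerivAt (fun x _ => ?_) ?_
  · exact ((hφ.differentiable (by simp)).differentiableAt.hasDerivAt).ofReal_comp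
  · exact (Complex.continuous_ofReal.comp (hφ.continuous_deriv (by simp))).continuousOn

theorem exists_interval_of_hasCompactSupport {φ : ℝ → ℝ} (h : HasCompactSupport φ) :
    ∃ R : ℝ, 0 < R ∧ ∀ x, x ∉ Set.Ioo (-R) R → φ x = 0 := by
  obtain ⟨R, hR, h1⟩ := h.isCompact.isBounded.subset_ball_lt 0 (0 : ℝ)
  refine ⟨R, hR, fun x hx => image_eq_zero_of_notMem_tsupport fun h2 => hx ?_⟩
  simpa [abs_lt] using h1 h2

theorem integral_eq_intervalIntegral {E : Type*} [NormedAddCommGroup E] [NormedSpace ℝ E]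
    {f : ℝ → E} {R : ℝ} (hR : 0 < R)
    (h : ∀ x, x ∉ Set.Ioo (-R) R → f x = 0) : ∫ x, f x = ∫ x in (-R)..R, f x := by
  rw [intervalIntegral.integral_of_le (by linarith)]
  refine (setIntegral_eq_integral_of_forall_compl_eq_zero fun x hx => h x fun h' => hx ?_).symm
  exact Set.Ioo_subset_Ioc_self h'

theorem integral_deriv_smul_eq_of_sub_eq {v g : ℝ → ℂ} (hg : LocallyIntegrable g volume)
    (h : ∀ x y, v y - v x = ∫ t in x..y, g t) {φ : ℝ → ℝ} (hφ : ContDiff ℝ ∞ φ)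
    (hc : HasCompactSupport φ) : ∫ x, deriv φ x • v x = -∫ x, φ x • g x := by
  obtain ⟨R, hR, h1⟩ := exists_interval_of_hasCompactSupport hc
  obtain ⟨R', hR', h1'⟩ := exists_interval_of_hasCompactSupport hc.deriv
  have hM : 0 < max R R' := lt_max_of_lt_left hR
  have k1 : ∀ x, x ∉ Set.Ioo (-max R R') (max R R') → φ x = 0 := fun x hx => h1 x fun hx' =>
    hx ⟨by linarith [le_max_left R R', hx'.1], by linarith [le_max_left R R', hx'.2]⟩
  have k2 : ∀ x, x ∉ Set.Ioo (-max R R') (max R R') → deriv φ x = 0 := fun x hx => h1' x fun hx' =>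
    hx ⟨by linarith [le_max_right R R', hx'.1], by linarith [le_max_right R R', hx'.2]⟩
  rw [integral_eq_intervalIntegral hM (fun x hx => by rw [k2 x hx, zero_smul]),
    integral_eq_intervalIntegral hM (fun x hx => by rw [k1 x hx, zero_smul])]
  have hv := HasACDeriv.of_integral hg h (-max R R') (max R R')
  have hp := hasACDeriv_of_contDiff hφ (-max R R') (max R R')
  have h2 := (hp.mul hv).integral_eq_sub
  rw [intervalIntegral.integral_add (hp.integrable.mul_continuousOn hv.ac.continuousOn)
    (hv.integrable.continuousOn_mul hp.ac.continuousOn), k1 (-max R R') (by simp),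
    k1 (max R R') (by simp)] at h2
  simp only [Complex.ofReal_zero, zero_mul, sub_zero] at h2
  simp only [Complex.real_smul]
  exact eq_neg_of_add_eq_zero_left h2

/-- The primitive started left of the support is zero there; the vanishing integral makes it zero to
the right as well. -/
theorem exists_antideriv_of_integral_eq_zero {η : ℝ → ℝ} (hη : ContDiff ℝ ∞ η)
    (hc : HasCompactSupport η) (h0 : ∫ x, η x = 0) :
    ∃ χ : ℝ → ℝ, ContDiff ℝ ∞ χ ∧ HasCompactSupport χ ∧ deriv χ = η := by
  obtain ⟨R, hR, h1⟩ := exists_interval_of_hasCompactSupport hc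
  have hd : ∀ x, HasDerivAt (fun x => ∫ t in (-R)..x, η t) (η x) x := fun x =>
    intervalIntegral.integral_hasDerivAt_right (hη.continuous.intervalIntegrable _ _)
      (hη.continuous.stronglyMeasurableAtFilter _ _) hη.continuous.continuousAt
  have hd' : deriv (fun x => ∫ t in (-R)..x, η t) = η := funext fun x => (hd x).deriv
  refine ⟨fun x => ∫ t in (-R)..x, η t, ?_, ?_, hd'⟩
  · rw [contDiff_infty_iff_deriv, hd']
    exact ⟨fun x => (hd x).differentiableAt, hη⟩
  · refine HasCompactSupport.intro (isCompact_Icc (a := -R) (b := R)) fun x hx => ?_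
    rcases lt_or_ge x (-R) with h | h
    · refine (intervalIntegral.integral_congr (g := fun _ => 0) fun t ht => ?_).trans (by simp)
      rw [Set.uIcc_of_ge h.le] at ht
      exact h1 t fun h' => by linarith [h'.1, ht.2]
    · have hx' : R < x := by
        by_contra hh; exact hx ⟨h, not_lt.1 hh⟩
      rw [integral_eq_intervalIntegral hR h1] at h0
      have h3 : ∫ t in R..x, η t = 0 := by
        refine (intervalIntegral.integral_congr (g := fun _ => 0) fun t ht => ?_).trans (by simp)
        rw [Set.uIcc_of_le hx'.le] at ht
        exact h1 t fun h' => by linarith [h'.2, ht.1]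
      have h4 := intervalIntegral.integral_add_adjacent_intervals
        (hη.continuous.intervalIntegrable (μ := volume) (-R) R)
        (hη.continuous.intervalIntegrable (μ := volume) R x)
      rw [h0, h3, add_zero] at h4
      exact h4.symm

theorem integrable_smul_of_locallyIntegrable {d : ℝ → ℂ} (hd : LocallyIntegrable d volume)
    {φ : ℝ → ℝ} (hφ : Continuous φ) (hc : HasCompactSupport φ) :
    Integrable (fun x => φ x • d x) volume :=
  hd.integrable_smul_left_of_hasCompactSupport hφ hc

/-- The du Bois-Reymond lemma. -/
theorem ae_eq_const_of_integral_deriv_smul_eq_zero {d : ℝ → ℂ} (hd : LocallyIntegrable d volume)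
    (h : ∀ φ : ℝ → ℝ, ContDiff ℝ ∞ φ → HasCompactSupport φ → ∫ x, deriv φ x • d x = 0) :
    ∃ c : ℂ, d =ᵐ[volume] fun _ => c := by
  let B : ContDiffBump (0 : ℝ) := ⟨1, 2, one_pos, one_lt_two⟩
  set ψ : ℝ → ℝ := B.normed volume with hψ
  have ψ1 : ContDiff ℝ ∞ ψ := B.contDiff_normed
  have ψ2 : HasCompactSupport ψ := B.hasCompactSupport_normed
  have ψ3 : ∫ x, ψ x = 1 := B.integral_normed
  refine ⟨∫ x, ψ x • d x, ae_eq_of_integral_contDiff_smul_eq hd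
    (locallyIntegrable_const _) fun φ φ1 φ2 => ?_⟩
  have hint : ∀ {f : ℝ → ℝ}, ContDiff ℝ ∞ f → HasCompactSupport f → Integrable f volume :=
    fun h1 h2 => h1.continuous.integrable_of_hasCompactSupport h2
  -- Removing the mean of `φ` by a multiple of the unit bump `ψ` leaves the derivative of a test
  -- function, so `d` tests against `φ` like the constant `∫ ψ d`.
  obtain ⟨χ, χ1, χ2, χ3⟩ := exists_antideriv_of_integral_eq_zero
    (η := fun x => φ x - (∫ y, φ y) * ψ x) (φ1.sub (contDiff_const.mul ψ1))
    (φ2.sub ψ2.mul_left) (by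
      rw [integral_sub (hint φ1 φ2) ((hint ψ1 ψ2).const_mul _), integral_const_mul, ψ3]; simp)
  have h1 := h χ χ1 χ2
  simp only [χ3, sub_smul, mul_smul] at h1
  rw [integral_sub (integrable_smul_of_locallyIntegrable hd φ1.continuous φ2)
    (show Integrable (fun x => (∫ y, φ y) • ψ x • d x) volume from
      (integrable_smul_of_locallyIntegrable hd ψ1.continuous ψ2).smul (∫ y, φ y)),
    integral_smul, sub_eq_zero] at h1
  rw [h1, integral_smul_const]

theorem H1Rep.continuous {v g : ℝ → ℂ} (h : H1Rep v g) : Continuous v := by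
  have h1 : v = fun x => v 0 + ∫ t in (0 : ℝ)..x, g t := by
    funext x; rw [← h.sub_eq 0 x]; ring
  rw [h1]
  exact continuous_const.add (intervalIntegral.continuous_primitive
    (fun a b => ((locallyIntegrable_of_memLp_two h.memLp').integrableOn_isCompact
      isCompact_uIcc).intervalIntegrable) 0)

theorem H1Rep.isWeakDeriv {v g : ℝ → ℂ} (h : H1Rep v g) : IsWeakDeriv v g :=
  ⟨locallyIntegrable_of_memLp_two h.memLp, locallyIntegrable_of_memLp_two h.memLp',
    fun _ h1 h2 => integral_deriv_smul_eq_of_sub_eq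
      (locallyIntegrable_of_memLp_two h.memLp') h.sub_eq h1 h2⟩

/-- The difference of `u` and a primitive of `g` has weak derivative zero, so it is constant by du
Bois-Reymond. -/
theorem IsWeakDeriv.exists_h1Rep {u g : ℝ → ℂ} (h : IsWeakDeriv u g) (hu : MemLp u 2 volume)
    (hg : MemLp g 2 volume) : ∃ v, u =ᵐ[volume] v ∧ H1Rep v g := by
  have hi : ∀ a b : ℝ, IntervalIntegrable g volume a b := fun a b =>
    ((locallyIntegrable_of_memLp_two hg).integrableOn_isCompact isCompact_uIcc).intervalIntegrable
  set G : ℝ → ℂ := fun x => ∫ t in (0 : ℝ)..x, g t with hG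
  have hGc : Continuous G := intervalIntegral.continuous_primitive hi 0
  have hGs : ∀ x y, G y - G x = ∫ t in x..y, g t := fun x y =>
    intervalIntegral.integral_interval_sub_left (hi _ _) (hi _ _)
  obtain ⟨c, hc⟩ := ae_eq_const_of_integral_deriv_smul_eq_zero (d := fun x => u x - G x)
    (h.1.sub hGc.locallyIntegrable) (fun φ h1 h2 => by
      have h3 : Continuous (deriv φ) := h1.continuous_deriv (by simp)
      simp only [smul_sub]
      rw [integral_sub (integrable_smul_of_locallyIntegrable h.1 h3 h2.deriv)
        (integrable_smul_of_locallyIntegrable hGc.locallyIntegrable h3 h2.deriv),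
        h.2.2 φ h1 h2, integral_deriv_smul_eq_of_sub_eq h.2.1 hGs h1 h2, sub_self])
  have he : u =ᵐ[volume] fun x => c + G x := by
    filter_upwards [hc] with x hx
    rw [← hx]; ring
  exact ⟨_, he, (memLp_congr_ae he).1 hu, hg, fun x y => by rw [← hGs]; ring⟩

theorem IsWeakDeriv.congr {u u' g g' : ℝ → ℂ} (h : IsWeakDeriv u g) (hu : u =ᵐ[volume] u')
    (hg : g =ᵐ[volume] g') : IsWeakDeriv u' g' := by
  refine ⟨h.1.congr hu, h.2.1.congr hg, fun φ h1 h2 => ?_⟩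
  have k1 : (fun x => deriv φ x • u x) =ᵐ[volume] fun x => deriv φ x • u' x :=
    hu.mono fun x hx => congrArg (deriv φ x • ·) hx
  have k2 : (fun x => φ x • g x) =ᵐ[volume] fun x => φ x • g' x :=
    hg.mono fun x hx => congrArg (φ x • ·) hx
  rw [← integral_congr_ae k1, h.2.2 φ h1 h2, integral_congr_ae k2]

theorem weakDeriv_spec {u : ℝ → ℂ} (h : ∃ g : ℝ → ℂ, MemLp g 2 volume ∧ IsWeakDeriv u g) :
    MemLp (weakDeriv u) 2 volume ∧ IsWeakDeriv u (weakDeriv u) := by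
  rw [weakDeriv, dif_pos h]; exact h.choose_spec

theorem MemH1.exists_h1Rep {u : ℝ → ℂ} (h : MemH1 u) :
    ∃ v, u =ᵐ[volume] v ∧ H1Rep v (weakDeriv u) :=
  (weakDeriv_spec h.2).2.exists_h1Rep h.1 (weakDeriv_spec h.2).1

theorem H1Rep.memH1_of_ae_eq {u v g : ℝ → ℂ} (h : H1Rep v g) (hu : u =ᵐ[volume] v) :
    MemH1 u ∧ weakDeriv u =ᵐ[volume] g := by
  have h1 : IsWeakDeriv u g := h.isWeakDeriv.congr hu.symm ae_eq_rfl
  have h2 : ∃ g : ℝ → ℂ, MemLp g 2 volume ∧ IsWeakDeriv u g := ⟨g, h.memLp', h1⟩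
  exact ⟨⟨(memLp_congr_ae hu).2 h.memLp, h2⟩, (weakDeriv_spec h2).2.ae_eq h1⟩

/-! ### Cumulative mass and the sharp Gagliardo-Nirenberg inequality with remainder -/

noncomputable section

/-- Half of the derivative of `‖v‖²`, for a function `v` with derivative `g`. -/
def halfDensityDeriv (v g : ℝ → ℂ) (x : ℝ) : ℝ := (v x).re * (g x).re + (v x).im * (g x).im

/-- The mass `∫_{-∞}^x ‖v‖²` to the left of `x`. -/
def massLeft (v : ℝ → ℂ) (x : ℝ) : ℝ := ∫ t in Set.Iic x, ‖v t‖ ^ 2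

/-- The deficit in the sharp Gagliardo-Nirenberg inequality for functions of unit mass. -/
def gnDeficit (v g : ℝ → ℂ) : ℝ := (∫ t, ‖g t‖ ^ 2) - Real.pi ^ 2 / 4 * ∫ t, ‖v t‖ ^ 6

theorem norm_sq_eq (z : ℂ) : ‖z‖ ^ 2 = z.re ^ 2 + z.im ^ 2 := by
  rw [Complex.sq_norm, Complex.normSq_apply]; ring

theorem abs_halfDensityDeriv_le (v g : ℝ → ℂ) (x : ℝ) :
    |halfDensityDeriv v g x| ≤ ‖v x‖ * ‖g x‖ := by
  apply abs_le_of_sq_le_sq _ (by positivity)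
  rw [mul_pow, norm_sq_eq, norm_sq_eq, halfDensityDeriv]
  nlinarith [sq_nonneg ((v x).re * (g x).im - (v x).im * (g x).re)]

/-- The Cauchy-Schwarz inequality for integrals of real functions. -/
theorem sq_integral_mul_le {α : Type*} [MeasurableSpace α] {μ : Measure α} {f g : α → ℝ}
    (hf : Integrable (fun x => f x ^ 2) μ) (hg : Integrable (fun x => g x ^ 2) μ)
    (hfg : Integrable (fun x => f x * g x) μ) :
    (∫ x, f x * g x ∂μ) ^ 2 ≤ (∫ x, f x ^ 2 ∂μ) * ∫ x, g x ^ 2 ∂μ := by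
  set A := ∫ x, f x ^ 2 ∂μ
  set B := ∫ x, f x * g x ∂μ
  set C := ∫ x, g x ^ 2 ∂μ
  have key : ∀ t : ℝ, 0 ≤ A * (t * t) + 2 * B * t + C := fun t => by
    have h0 : 0 ≤ ∫ x, (t * f x + g x) ^ 2 ∂μ := integral_nonneg fun x => sq_nonneg _
    have h1 : (fun x => (t * f x + g x) ^ 2) =
        fun x => (t ^ 2 * f x ^ 2 + 2 * t * (f x * g x)) + g x ^ 2 := by funext x; ring
    rw [h1, integral_add (show Integrable (fun x => t ^ 2 * f x ^ 2 + 2 * t * (f x * g x)) μ from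
        (hf.const_mul _).add (hfg.const_mul _)) hg,
      integral_add (hf.const_mul _) (hfg.const_mul _), integral_const_mul,
      integral_const_mul] at h0
    linarith
  have h2 := discrim_le_zero key
  rw [discrim] at h2
  nlinarith

theorem massLeft_nonneg (v : ℝ → ℂ) (x : ℝ) : 0 ≤ massLeft v x :=
  integral_nonneg fun t => by positivity

namespace H1Rep

variable {v g : ℝ → ℂ} (h : H1Rep v g)
include h

theorem integrable_sq : Integrable (fun x => ‖v x‖ ^ 2) volume :=
  (memLp_two_iff_integrable_sq_norm h.memLp.1).1 h.memLp

theorem integrable_deriv_sq : Integrable (fun x => ‖g x‖ ^ 2) volume :=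
  (memLp_two_iff_integrable_sq_norm h.memLp'.1).1 h.memLp'

theorem integrable_norm_mul_norm : Integrable (fun x => ‖v x‖ * ‖g x‖) volume :=
  h.memLp.norm.integrable_mul h.memLp'.norm

theorem integrable_halfDensityDeriv : Integrable (halfDensityDeriv v g) volume := by
  refine h.integrable_norm_mul_norm.mono' ?_ (Eventually.of_forall (abs_halfDensityDeriv_le v g))
  have h1 := h.memLp.1
  have h2 := h.memLp'.1
  exact ((Complex.continuous_re.comp_aestronglyMeasurable h1).mul
    (Complex.continuous_re.comp_aestronglyMeasurable h2)).add
    ((Complex.continuous_im.comp_aestronglyMeasurable h1).mul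
    (Complex.continuous_im.comp_aestronglyMeasurable h2))

theorem hasACDeriv (a b : ℝ) : HasACDeriv v g a b :=
  HasACDeriv.of_integral (locallyIntegrable_of_memLp_two h.memLp') h.sub_eq a b

theorem hasACDeriv_sq (a b : ℝ) :
    HasACDeriv (fun x => ‖v x‖ ^ 2) (fun x => 2 * halfDensityDeriv v g x) a b := by
  have h1 := h.hasACDeriv a b
  have h2 := ((h1.clm_comp Complex.conjCLE.toContinuousLinearMap).mul h1).clm_comp Complex.reCLM
  convert h2 using 1
  · funext x; simp [norm_sq_eq]; ring
  · funext x; simp [halfDensityDeriv]; ring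

theorem sq_sub_sq (a b : ℝ) :
    ‖v b‖ ^ 2 - ‖v a‖ ^ 2 = ∫ x in a..b, 2 * halfDensityDeriv v g x :=
  (h.hasACDeriv_sq a b).integral_eq_sub.symm

/-- An integrable derivative gives `‖v‖²` a limit at `-∞`, and integrability of `‖v‖²` leaves only
the limit zero. -/
theorem tendsto_sq_atBot : Tendsto (fun x => ‖v x‖ ^ 2) atBot (𝓝 0) := by
  have hi := h.integrable_halfDensityDeriv.const_mul 2
  have h1 := intervalIntegral_tendsto_integral_Iic (0 : ℝ) hi.integrableOn tendsto_id
  have h2 := (tendsto_const_nhds (x := ‖v 0‖ ^ 2)).sub h1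
  have h3 : Tendsto (fun x => ‖v x‖ ^ 2) atBot (𝓝 (‖v 0‖ ^ 2 -
      ∫ x in Set.Iic (0 : ℝ), 2 * halfDensityDeriv v g x)) := by
    refine h2.congr fun x => ?_
    rw [id, ← h.sq_sub_sq]; ring
  have h4 : IntegrableAtFilter (fun x => ‖v x‖ ^ 2) atBot volume :=
    h.integrable_sq.integrableAtFilter _
  have h5 := h4.eq_zero_of_tendsto (fun s hs => by
    obtain ⟨a, ha⟩ := mem_atBot_sets.1 hs
    exact top_le_iff.1 (le_trans (by simp) (measure_mono (show Set.Iic a ⊆ s from ha)))) h3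
  rwa [h5] at h3

theorem sq_eq_integral_Iic (x : ℝ) :
    ‖v x‖ ^ 2 = ∫ t in Set.Iic x, 2 * halfDensityDeriv v g t := by
  have hi := h.integrable_halfDensityDeriv.const_mul 2
  have h1 := intervalIntegral_tendsto_integral_Iic x hi.integrableOn tendsto_id
  have h2 : Tendsto (fun y => ‖v x‖ ^ 2 - ‖v y‖ ^ 2) atBot (𝓝 (‖v x‖ ^ 2 - 0)) :=
    tendsto_const_nhds.sub h.tendsto_sq_atBot
  rw [sub_zero] at h2
  refine tendsto_nhds_unique h2 (h1.congr fun y => ?_)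
  rw [id, ← h.sq_sub_sq]

/-- Cauchy-Schwarz for `‖v‖² = 2 ∫ Re(v̄ g)` on the half-line. Keeping the factor `massLeft v x`
matters: it cancels the pole of `cot (π F)` in the boundary terms below. -/
theorem pow_four_le (x : ℝ) :
    ‖v x‖ ^ 4 ≤ 4 * massLeft v x * ∫ t in Set.Iic x, ‖g t‖ ^ 2 := by
  have h1 : ‖v x‖ ^ 2 ≤ 2 * ∫ t in Set.Iic x, ‖v t‖ * ‖g t‖ := by
    rw [h.sq_eq_integral_Iic x, integral_const_mul]
    exact mul_le_mul_of_nonneg_left (setIntegral_mono h.integrable_halfDensityDeriv.integrableOn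
      h.integrable_norm_mul_norm.integrableOn
      fun t => (le_abs_self _).trans (abs_halfDensityDeriv_le v g t)) two_pos.le
  have h2 := sq_integral_mul_le (μ := volume.restrict (Set.Iic x)) h.integrable_sq.integrableOn
    h.integrable_deriv_sq.integrableOn h.integrable_norm_mul_norm.integrableOn
  have h3 : (‖v x‖ ^ 2) ^ 2 ≤ (2 * ∫ t in Set.Iic x, ‖v t‖ * ‖g t‖) ^ 2 := by gcongr
  rw [massLeft]
  nlinarith

theorem reflect : H1Rep (fun x => v (-x)) (fun x => -g (-x)) := by
  refine ⟨h.memLp.comp_measurePreserving (Measure.measurePreserving_neg volume),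
    (h.memLp'.comp_measurePreserving (Measure.measurePreserving_neg volume)).neg, fun x y => ?_⟩
  rw [h.sub_eq, intervalIntegral.integral_neg, intervalIntegral.integral_comp_neg (fun t => g t),
    intervalIntegral.integral_symm]

theorem massLeft_sub (x y : ℝ) : massLeft v y - massLeft v x = ∫ t in x..y, ‖v t‖ ^ 2 :=
  intervalIntegral.integral_Iic_sub_Iic h.integrable_sq.integrableOn h.integrable_sq.integrableOn

theorem hasDerivAt_massLeft (x : ℝ) : HasDerivAt (massLeft v) (‖v x‖ ^ 2) x := by
  have hc : Continuous fun x => ‖v x‖ ^ 2 := h.continuous.norm.pow 2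
  have h1 : massLeft v = fun y => massLeft v x + ∫ t in x..y, ‖v t‖ ^ 2 := by
    funext y; rw [← h.massLeft_sub x y]; ring
  rw [h1]
  simpa using (intervalIntegral.integral_hasDerivAt_right (hc.intervalIntegrable x x)
    (hc.stronglyMeasurableAtFilter _ _) hc.continuousAt).const_add (massLeft v x)

theorem continuous_massLeft : Continuous (massLeft v) :=
  continuous_iff_continuousAt.2 fun x => (h.hasDerivAt_massLeft x).continuousAt

theorem monotone_massLeft : Monotone (massLeft v) := fun x y hxy => by
  have h1 := h.massLeft_sub x y
  have h2 : 0 ≤ ∫ t in x..y, ‖v t‖ ^ 2 :=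
    intervalIntegral.integral_nonneg hxy fun t _ => by positivity
  linarith

theorem massLeft_reflect (hm : ∫ t, ‖v t‖ ^ 2 = 1) (x : ℝ) :
    massLeft (fun x => v (-x)) x = 1 - massLeft v (-x) := by
  have h1 := intervalIntegral.integral_Iic_add_Ioi (b := -x) (h.integrable_sq.integrableOn)
    (h.integrable_sq.integrableOn)
  have h2 : massLeft (fun x => v (-x)) x = ∫ t in Set.Ioi (-x), ‖v t‖ ^ 2 :=
    integral_comp_neg_Iic x (fun t => ‖v t‖ ^ 2)
  rw [h2, massLeft]; linarith

theorem massLeft_le_one (hm : ∫ t, ‖v t‖ ^ 2 = 1) (x : ℝ) : massLeft v x ≤ 1 := by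
  have h1 := h.massLeft_reflect hm (-x)
  have h2 := massLeft_nonneg (fun x => v (-x)) (-x)
  rw [h1, neg_neg] at h2
  linarith

theorem pow_four_le_right (hm : ∫ t, ‖v t‖ ^ 2 = 1) (x : ℝ) :
    ‖v x‖ ^ 4 ≤ 4 * (1 - massLeft v x) * ∫ t in Set.Ioi x, ‖g t‖ ^ 2 := by
  have h1 := h.reflect.pow_four_le (-x)
  rw [h.massLeft_reflect hm, integral_comp_neg_Iic (-x) (fun t => ‖-g t‖ ^ 2)] at h1
  simpa using h1

theorem pow_four_le_integral (hm : ∫ t, ‖v t‖ ^ 2 = 1) (x : ℝ) :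
    ‖v x‖ ^ 4 ≤ 4 * ∫ t, ‖g t‖ ^ 2 := by
  have h1 := h.pow_four_le x
  have h2 : ∫ t in Set.Iic x, ‖g t‖ ^ 2 ≤ ∫ t, ‖g t‖ ^ 2 :=
    setIntegral_le_integral h.integrable_deriv_sq (Eventually.of_forall fun t => by positivity)
  have h3 : 0 ≤ ∫ t in Set.Iic x, ‖g t‖ ^ 2 := integral_nonneg fun t => by positivity
  nlinarith [h.massLeft_le_one hm x, massLeft_nonneg v x]

theorem norm_sq_le (hm : ∫ t, ‖v t‖ ^ 2 = 1) (x : ℝ) :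
    ‖v x‖ ^ 2 ≤ 2 * √(∫ t, ‖g t‖ ^ 2) := by
  apply le_of_sq_le_sq _ (by positivity)
  rw [mul_pow, Real.sq_sqrt (integral_nonneg fun t => by positivity)]
  have := h.pow_four_le_integral hm x
  nlinarith

theorem integrable_pow (hm : ∫ t, ‖v t‖ ^ 2 = 1) (k : ℕ) :
    Integrable (fun x => ‖v x‖ ^ (k + 2)) volume := by
  set M := √(2 * √(∫ t, ‖g t‖ ^ 2))
  have hM : ∀ x, ‖v x‖ ≤ M := fun x => Real.le_sqrt_of_sq_le (h.norm_sq_le hm x)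
  refine (h.integrable_sq.const_mul (M ^ k)).mono' ?_ (Eventually.of_forall fun x => ?_)
  · exact (h.continuous.norm.pow _).aestronglyMeasurable
  · rw [Real.norm_of_nonneg (by positivity), pow_add]
    gcongr
    exact hM x

end H1Rep

/-- The remainder in the sharp Gagliardo-Nirenberg inequality: its vanishing is the first-order
equation of the optimizers. -/
def gnRemainder (v g : ℝ → ℂ) (x : ℝ) : ℂ :=
  g x - ((Real.pi / 2 * Real.cot (Real.pi * massLeft v x) * ‖v x‖ ^ 2 : ℝ) : ℂ) * v x

/-- The bracket is the derivative of `‖v‖⁴ cot(π F)` in the form produced by the product rule. The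
identity `1/sin² = 1 + cot²` turns its last term into the `cot²` term of the square plus the sextic
term with constant `π²/4`. -/
theorem norm_gnRemainder_sq (v g : ℝ → ℂ) (x : ℝ)
    (hs : Real.sin (Real.pi * massLeft v x) ≠ 0) :
    ‖gnRemainder v g x‖ ^ 2 = ‖g x‖ ^ 2 - Real.pi ^ 2 / 4 * ‖v x‖ ^ 6 - Real.pi / 4 *
      ((2 * halfDensityDeriv v g x * ‖v x‖ ^ 2 + ‖v x‖ ^ 2 * (2 * halfDensityDeriv v g x)) *
        Real.cot (Real.pi * massLeft v x) + ‖v x‖ ^ 2 * ‖v x‖ ^ 2 *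
        (-(Real.pi * ‖v x‖ ^ 2) / Real.sin (Real.pi * massLeft v x) ^ 2)) := by
  have h1 : 1 / Real.sin (Real.pi * massLeft v x) ^ 2 =
      1 + Real.cot (Real.pi * massLeft v x) ^ 2 := by
    rw [Real.cot_eq_cos_div_sin]
    field_simp
    linarith [Real.sin_sq_add_cos_sq (Real.pi * massLeft v x)]
  have h2 : ‖v x‖ ^ 6 = (‖v x‖ ^ 2) ^ 3 := by ring
  rw [div_eq_mul_one_div (-(Real.pi * ‖v x‖ ^ 2)), h1, h2]
  set C := Real.cot (Real.pi * massLeft v x)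
  have h3 : ‖gnRemainder v g x‖ ^ 2 = ((g x).re - Real.pi / 2 * C * ‖v x‖ ^ 2 * (v x).re) ^ 2 +
      ((g x).im - Real.pi / 2 * C * ‖v x‖ ^ 2 * (v x).im) ^ 2 := by
    rw [norm_sq_eq, gnRemainder]
    simp only [Complex.sub_re, Complex.sub_im, Complex.re_ofReal_mul, Complex.im_ofReal_mul]
    rfl
  rw [h3, norm_sq_eq (g x), norm_sq_eq (v x), halfDensityDeriv]
  ring

theorem hasDerivAt_cot {x : ℝ} (hx : Real.sin x ≠ 0) :
    HasDerivAt Real.cot (-1 / Real.sin x ^ 2) x := by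
  have h1 := (Real.hasDerivAt_cos x).div (Real.hasDerivAt_sin x) hx
  have h2 : Real.cot = fun y => Real.cos y / Real.sin y := funext Real.cot_eq_cos_div_sin
  have h3 : -Real.sin x * Real.sin x - Real.cos x * Real.cos x = -1 := by
    linarith [Real.sin_sq_add_cos_sq x]
  rw [h3] at h1
  rw [h2]
  exact h1

theorem mul_cot_le_one {y : ℝ} (h0 : 0 < y) (h1 : y ≤ Real.pi / 2) : y * Real.cot y ≤ 1 := by
  have hs : 0 < Real.sin y := Real.sin_pos_of_pos_of_lt_pi h0 (by linarith [Real.pi_pos])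
  rcases h1.lt_or_eq with h | h
  · have h2 := Real.lt_tan h0 h
    have hc : 0 < Real.cos y := Real.cos_pos_of_mem_Ioo ⟨by linarith, h⟩
    rw [Real.tan_eq_sin_div_cos, lt_div_iff₀ hc] at h2
    rw [Real.cot_eq_cos_div_sin, ← mul_div_assoc, div_le_one hs]
    exact h2.le
  · rw [Real.cot_eq_cos_div_sin, h, Real.cos_pi_div_two]; simp

theorem sin_pi_mul_pos {F : ℝ} (h0 : 0 < F) (h1 : F < 1) : 0 < Real.sin (Real.pi * F) :=
  Real.sin_pos_of_pos_of_lt_pi (by positivity) (by nlinarith [Real.pi_pos])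

theorem cot_pi_sub (y : ℝ) : Real.cot (Real.pi - y) = -Real.cot y := by
  rw [Real.cot_eq_cos_div_sin, Real.cot_eq_cos_div_sin, Real.sin_pi_sub, Real.cos_pi_sub]; ring

namespace H1Rep

variable {v g : ℝ → ℂ} (h : H1Rep v g)
include h

theorem massLeft_mem_Ioo {a b x : ℝ} (ha : 0 < massLeft v a)
    (hb : massLeft v b < 1) (hx : x ∈ Set.Icc a b) : massLeft v x ∈ Set.Ioo (0 : ℝ) 1 :=
  ⟨ha.trans_le (h.monotone_massLeft hx.1), (h.monotone_massLeft hx.2).trans_lt hb⟩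

/-- By `pow_four_le` the boundary term is at most `πF cot(πF)` times the kinetic energy left of `a`,
and `y cot y ≤ 1` on `(0, π/2]`. The constant is exactly 1, so the tail pays for the boundary term
with no loss in the sharp constant. -/
theorem boundary_term_le {a : ℝ} (ha : 0 < massLeft v a) (ha' : massLeft v a ≤ 1 / 2) :
    Real.pi / 4 * (‖v a‖ ^ 2 * ‖v a‖ ^ 2 * Real.cot (Real.pi * massLeft v a)) ≤
      ∫ t in Set.Iic a, ‖g t‖ ^ 2 := by
  have h1 := h.pow_four_le a
  have h2 := mul_cot_le_one (y := Real.pi * massLeft v a) (by positivity)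
    (by nlinarith [Real.pi_pos])
  have h3 : 0 ≤ ∫ t in Set.Iic a, ‖g t‖ ^ 2 := integral_nonneg fun t => by positivity
  have h4 : 0 ≤ Real.cot (Real.pi * massLeft v a) := by
    rw [Real.cot_eq_cos_div_sin]
    refine div_nonneg (Real.cos_nonneg_of_mem_Icc ⟨?_, ?_⟩)
      (sin_pi_mul_pos ha (by linarith)).le <;> nlinarith [Real.pi_pos]
  have h5 : ‖v a‖ ^ 2 * ‖v a‖ ^ 2 = ‖v a‖ ^ 4 := by ring
  rw [h5]
  calc Real.pi / 4 * (‖v a‖ ^ 4 * Real.cot (Real.pi * massLeft v a))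
      ≤ Real.pi / 4 * ((4 * massLeft v a * ∫ t in Set.Iic a, ‖g t‖ ^ 2) *
        Real.cot (Real.pi * massLeft v a)) := by gcongr
    _ = (Real.pi * massLeft v a * Real.cot (Real.pi * massLeft v a)) *
        ∫ t in Set.Iic a, ‖g t‖ ^ 2 := by ring
    _ ≤ 1 * ∫ t in Set.Iic a, ‖g t‖ ^ 2 := by gcongr
    _ = _ := one_mul _

theorem boundary_term_le_right (hm : ∫ t, ‖v t‖ ^ 2 = 1) {b : ℝ} (hb : massLeft v b < 1)
    (hb' : 1 / 2 ≤ massLeft v b) :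
    -(Real.pi / 4 * (‖v b‖ ^ 2 * ‖v b‖ ^ 2 * Real.cot (Real.pi * massLeft v b))) ≤
      ∫ t in Set.Ioi b, ‖g t‖ ^ 2 := by
  have h1 := h.massLeft_reflect hm (-b)
  rw [neg_neg] at h1
  have h2 := h.reflect.boundary_term_le (a := -b) (by rw [h1]; linarith) (by rw [h1]; linarith)
  rw [h1, integral_comp_neg_Iic (-b) (fun t => ‖-g t‖ ^ 2), mul_sub, mul_one, cot_pi_sub] at h2
  simpa using h2

theorem intervalIntegrable_gnRemainder_sq {a b : ℝ} (hab : a ≤ b)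
    (ha : 0 < massLeft v a) (hb : massLeft v b < 1) :
    IntervalIntegrable (fun x => ‖gnRemainder v g x‖ ^ 2) volume a b ∧
    ∫ x in a..b, ‖gnRemainder v g x‖ ^ 2 = (∫ x in a..b, ‖g x‖ ^ 2) -
      Real.pi ^ 2 / 4 * (∫ x in a..b, ‖v x‖ ^ 6) - Real.pi / 4 *
      (‖v b‖ ^ 2 * ‖v b‖ ^ 2 * Real.cot (Real.pi * massLeft v b) -
        ‖v a‖ ^ 2 * ‖v a‖ ^ 2 * Real.cot (Real.pi * massLeft v a)) := by
  have hs : ∀ x ∈ Set.uIcc a b, 0 < Real.sin (Real.pi * massLeft v x) := fun x hx => by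
    rw [Set.uIcc_of_le hab] at hx
    have hx' := h.massLeft_mem_Ioo ha hb hx
    exact sin_pi_mul_pos hx'.1 hx'.2
  have hC : HasACDeriv (fun x => Real.cot (Real.pi * massLeft v x))
      (fun x => -(Real.pi * ‖v x‖ ^ 2) / Real.sin (Real.pi * massLeft v x) ^ 2) a b := by
    refine HasACDeriv.of_hasDerivAt (fun x hx => ?_) ?_
    · have h1 := (hasDerivAt_cot (hs x hx).ne').comp x
        ((h.hasDerivAt_massLeft x).const_mul Real.pi)
      exact h1.congr_deriv (by ring)
    · refine ContinuousOn.div ?_ ?_ fun x hx => (pow_pos (hs x hx) 2).ne'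
      · exact ((h.continuous.norm.pow 2).const_mul _).neg.continuousOn
      · exact ((Real.continuous_sin.comp (h.continuous_massLeft.const_mul _)).pow 2).continuousOn
  have hq := (((h.hasACDeriv_sq a b).mul (h.hasACDeriv_sq a b)).mul hC)
  have h6 : Continuous fun x => ‖v x‖ ^ 6 := h.continuous.norm.pow 6
  have i1 : IntervalIntegrable (fun x => ‖g x‖ ^ 2) volume a b :=
    h.integrable_deriv_sq.intervalIntegrable
  have i2 : IntervalIntegrable (fun x => Real.pi ^ 2 / 4 * ‖v x‖ ^ 6) volume a b :=
    (h6.const_mul _).intervalIntegrable a b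
  have i3 := (i1.sub i2).sub (hq.integrable.const_mul (Real.pi / 4))
  have he : Set.EqOn (fun x => ‖gnRemainder v g x‖ ^ 2) _ (Set.uIcc a b) := fun x hx =>
    norm_gnRemainder_sq v g x (hs x hx).ne'
  constructor
  · exact i3.congr fun x hx => (he (Set.uIoc_subset_uIcc hx)).symm
  · rw [intervalIntegral.integral_congr he, intervalIntegral.integral_sub (i1.sub i2)
      (hq.integrable.const_mul _), intervalIntegral.integral_sub i1 i2,
      intervalIntegral.integral_const_mul, intervalIntegral.integral_const_mul,
      hq.integral_eq_sub]

/-- The identity on `[a, b]` leaves two boundary terms, each bounded by the kinetic energy of the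
adjacent half-line; the three pieces add up to the full kinetic energy. -/
theorem integral_gnRemainder_add_le (hm : ∫ t, ‖v t‖ ^ 2 = 1) {a b : ℝ} (hab : a ≤ b)
    (ha : 0 < massLeft v a) (ha' : massLeft v a ≤ 1 / 2)
    (hb : massLeft v b < 1) (hb' : 1 / 2 ≤ massLeft v b) :
    (∫ x in a..b, ‖gnRemainder v g x‖ ^ 2) + Real.pi ^ 2 / 4 * (∫ x in a..b, ‖v x‖ ^ 6) ≤
      ∫ x, ‖g x‖ ^ 2 := by
  have h1 := (h.intervalIntegrable_gnRemainder_sq hab ha hb).2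
  have h2 := h.boundary_term_le ha ha'
  have h3 := h.boundary_term_le_right hm hb hb'
  have h4 := intervalIntegral.integral_Iic_sub_Iic (a := a) (b := b)
    h.integrable_deriv_sq.integrableOn h.integrable_deriv_sq.integrableOn
  have h5 := intervalIntegral.integral_Iic_add_Ioi (b := b)
    h.integrable_deriv_sq.integrableOn h.integrable_deriv_sq.integrableOn
  linarith

theorem tendsto_massLeft_atBot : Tendsto (massLeft v) atBot (𝓝 0) := by
  have h1 := intervalIntegral_tendsto_integral_Iic (0 : ℝ) h.integrable_sq.integrableOn tendsto_id
  have h2 := (tendsto_const_nhds (x := massLeft v 0)).sub h1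
  rw [massLeft, sub_self] at h2
  refine h2.congr fun x => ?_
  rw [id, ← h.massLeft_sub, massLeft]; ring

theorem exists_massLeft_eq (hm : ∫ t, ‖v t‖ ^ 2 = 1) {m : ℝ} (h0 : 0 < m) (h1 : m < 1) :
    ∃ x, massLeft v x = m := by
  obtain ⟨a, ha⟩ := (h.tendsto_massLeft_atBot.eventually_lt_const h0).exists
  obtain ⟨b, hb⟩ := (h.reflect.tendsto_massLeft_atBot.eventually_lt_const
    (sub_pos.2 h1)).exists
  rw [h.massLeft_reflect hm] at hb
  exact mem_range_of_exists_le_of_exists_ge h.continuous_massLeft ⟨a, ha.le⟩ ⟨-b, by linarith⟩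

/-- The sharp Gagliardo-Nirenberg inequality, with a remainder. -/
theorem integral_gnRemainder_le (hm : ∫ t, ‖v t‖ ^ 2 = 1) {a b : ℝ} (hab : a ≤ b)
    (ha : 0 < massLeft v a) (ha' : massLeft v a ≤ 1 / 2)
    (hb : massLeft v b < 1) :
    ∫ x in a..b, ‖gnRemainder v g x‖ ^ 2 ≤ gnDeficit v g := by
  set S := ∫ x, ‖g x‖ ^ 2
  have hS : 0 ≤ S := integral_nonneg fun t => by positivity
  have hI6 : Integrable (fun x => ‖v x‖ ^ 6) volume := h.integrable_pow hm 4
  rw [gnDeficit]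
  refine le_of_forall_pos_le_add fun ε hε => ?_
  set K := Real.pi ^ 2 / 4 * (8 * S) + 1 with hK
  have hK0 : 0 < K := by positivity
  -- The interval is enlarged until each tail has mass `δ / 2`. Since `‖v‖⁴ ≤ 4S`, the sextic
  -- integral lost in the tails is at most `4Sδ`, which costs no more than `K δ ≤ ε`; the other two
  -- bounds on `δ` ensure that the new interval contains `[a, b]`.
  set δ := min (ε / K) (min (massLeft v a) (1 - massLeft v b)) with hδ
  have hδ0 : 0 < δ := lt_min (by positivity) (lt_min ha (by linarith))
  have hδ1 : δ ≤ massLeft v a := (min_le_right _ _).trans (min_le_left _ _)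
  have hδ2 : δ ≤ 1 - massLeft v b := (min_le_right _ _).trans (min_le_right _ _)
  have hδ3 : K * δ ≤ ε := by
    have := min_le_left (ε / K) (min (massLeft v a) (1 - massLeft v b))
    rw [← hδ, le_div_iff₀ hK0] at this
    linarith
  obtain ⟨a', ha1⟩ := h.exists_massLeft_eq hm (m := δ / 2) (by linarith) (by linarith)
  obtain ⟨b', hb1⟩ := h.exists_massLeft_eq hm (m := 1 - δ / 2) (by linarith) (by linarith)
  have haa : a' ≤ a := by
    by_contra! hh
    have := h.monotone_massLeft hh.le
    linarith
  have hbb : b ≤ b' := by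
    by_contra! hh
    have := h.monotone_massLeft hh.le
    linarith
  have h1 := h.integral_gnRemainder_add_le hm (haa.trans (hab.trans hbb)) (by linarith)
    (by linarith) (b := b') (by linarith) (by linarith)
  have hi := (h.intervalIntegrable_gnRemainder_sq (haa.trans (hab.trans hbb)) (by linarith)
    (b := b') (by linarith)).1
  have h2 : ∫ x in a..b, ‖gnRemainder v g x‖ ^ 2 ≤ ∫ x in a'..b', ‖gnRemainder v g x‖ ^ 2 :=
    intervalIntegral.integral_mono_interval haa hab hbb
      (Eventually.of_forall fun x => by positivity) hi
  have h6 : ∀ x, ‖v x‖ ^ 6 ≤ 4 * S * ‖v x‖ ^ 2 := fun x => by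
    have := h.pow_four_le_integral hm x
    calc ‖v x‖ ^ 6 = ‖v x‖ ^ 4 * ‖v x‖ ^ 2 := by ring
      _ ≤ _ := by gcongr
  have h3 : ∫ x in Set.Iic a', ‖v x‖ ^ 6 ≤ 4 * S * (δ / 2) := by
    rw [← ha1, massLeft, ← integral_const_mul]
    exact setIntegral_mono hI6.integrableOn (h.integrable_sq.const_mul _).integrableOn h6
  have h4 : ∫ x in Set.Ioi b', ‖v x‖ ^ 6 ≤ 4 * S * (δ / 2) := by
    have h5 := intervalIntegral.integral_Iic_add_Ioi (b := b')
      h.integrable_sq.integrableOn h.integrable_sq.integrableOn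
    rw [hm] at h5
    have h7 : ∫ x in Set.Ioi b', ‖v x‖ ^ 2 = δ / 2 := by
      rw [massLeft] at hb1; linarith
    rw [← h7, ← integral_const_mul]
    exact setIntegral_mono hI6.integrableOn (h.integrable_sq.const_mul _).integrableOn h6
  have h8 := intervalIntegral.integral_Iic_sub_Iic (a := a') (b := b')
    hI6.integrableOn hI6.integrableOn
  have h9 := intervalIntegral.integral_Iic_add_Ioi (b := b')
    hI6.integrableOn hI6.integrableOn
  have h10 : Real.pi ^ 2 / 4 * (∫ x, ‖v x‖ ^ 6) ≤
      Real.pi ^ 2 / 4 * (∫ x in a'..b', ‖v x‖ ^ 6) + Real.pi ^ 2 / 4 * (4 * S * δ) := by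
    rw [← mul_add]
    gcongr
    linarith
  have h11 : Real.pi ^ 2 / 4 * (4 * S * δ) ≤ K * δ := by
    rw [hK]; nlinarith [mul_nonneg (mul_nonneg (sq_nonneg Real.pi) hS) hδ0.le]
  linarith

theorem gnDeficit_nonneg (hm : ∫ t, ‖v t‖ ^ 2 = 1) : 0 ≤ gnDeficit v g := by
  obtain ⟨x, hx⟩ := h.exists_massLeft_eq hm (m := 1 / 2) (by norm_num) (by norm_num)
  simpa using h.integral_gnRemainder_le hm (le_refl x) (by linarith) (by linarith)
    (by linarith)

end H1Rep

/-! ### Stability: functions with small deficit -/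

theorem sq_intervalIntegral_norm_le {E : Type*} [NormedAddCommGroup E] {f : ℝ → E} {a b : ℝ}
    (hab : a ≤ b) (h1 : IntervalIntegrable (fun x => ‖f x‖) volume a b)
    (h2 : IntervalIntegrable (fun x => ‖f x‖ ^ 2) volume a b) :
    (∫ x in a..b, ‖f x‖) ^ 2 ≤ (b - a) * ∫ x in a..b, ‖f x‖ ^ 2 := by
  rw [intervalIntegrable_iff_integrableOn_Ioc_of_le hab] at h1 h2
  have h3 := sq_integral_mul_le (μ := volume.restrict (Set.Ioc a b)) (f := fun _ => (1 : ℝ))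
    (g := fun x => ‖f x‖) (by simp) h2 (by simp only [one_mul]; exact h1)
  rw [intervalIntegral.integral_of_le hab, intervalIntegral.integral_of_le hab]
  simpa [hab, Real.volume_real_Ioc_of_le] using h3

theorem gnDeficit_reflect (v g : ℝ → ℂ) : gnDeficit (fun x => v (-x)) (fun x => -g (-x)) = gnDeficit v g := by
  rw [gnDeficit, gnDeficit, integral_neg_eq_self (fun t => ‖v t‖ ^ 6) volume]
  simp only [norm_neg]
  rw [integral_neg_eq_self (fun t => ‖g t‖ ^ 2) volume]

namespace H1Rep

variable {v g : ℝ → ℂ} (h : H1Rep v g)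
include h

theorem eq_zero_of_massLeft_eq_one (hm : ∫ t, ‖v t‖ ^ 2 = 1) {x : ℝ} (hx : massLeft v x = 1) :
    v x = 0 := by
  have h1 := h.pow_four_le_right hm x
  rw [hx, sub_self, mul_zero, zero_mul] at h1
  simpa using le_antisymm h1 (by positivity)

/-- `(sin πF)^{-1/2}` is the integrating factor of `v' = (π/2) cot(πF)|v|² v + r`, since its
logarithmic derivative is `-(π/2) cot(πF)|v|²`. -/
theorem hasACDeriv_div_sqrt_sin {a b : ℝ} (hab : a ≤ b)
    (ha : 0 < massLeft v a) (hb : massLeft v b < 1) :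
    HasACDeriv (fun x => (((√(Real.sin (Real.pi * massLeft v x)))⁻¹ : ℝ) : ℂ) * v x)
      (fun x => (((√(Real.sin (Real.pi * massLeft v x)))⁻¹ : ℝ) : ℂ) * gnRemainder v g x) a b := by
  have hs : ∀ x ∈ Set.uIcc a b, 0 < Real.sin (Real.pi * massLeft v x) := fun x hx => by
    rw [Set.uIcc_of_le hab] at hx
    have hx' := h.massLeft_mem_Ioo ha hb hx
    exact sin_pi_mul_pos hx'.1 hx'.2
  have hcs : Continuous fun x => Real.sin (Real.pi * massLeft v x) :=
    Real.continuous_sin.comp (h.continuous_massLeft.const_mul _)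
  have hcc : Continuous fun x => Real.cos (Real.pi * massLeft v x) :=
    Real.continuous_cos.comp (h.continuous_massLeft.const_mul _)
  have hφ : HasACDeriv (fun x => (((√(Real.sin (Real.pi * massLeft v x)))⁻¹ : ℝ) : ℂ))
      (fun x => ((-(Real.pi / 2 * (Real.cos (Real.pi * massLeft v x) /
        Real.sin (Real.pi * massLeft v x)) * ‖v x‖ ^ 2) *
        (√(Real.sin (Real.pi * massLeft v x)))⁻¹ : ℝ) : ℂ)) a b := by
    refine HasACDeriv.of_hasDerivAt (fun x hx => HasDerivAt.ofReal_comp ?_) ?_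
    · have h1 := ((((Real.hasDerivAt_sin _).comp x
        ((h.hasDerivAt_massLeft x).const_mul Real.pi)).sqrt (hs x hx).ne').inv
        (Real.sqrt_pos.2 (hs x hx)).ne')
      refine h1.congr_deriv ?_
      have h2 := Real.sqrt_pos.2 (hs x hx)
      have h3 := Real.sq_sqrt (hs x hx).le
      simp only [Function.comp_apply]
      rw [h3]
      field_simp
    · refine Complex.continuous_ofReal.comp_continuousOn (ContinuousOn.mul ?_ ?_)
      · exact (((hcc.continuousOn.div hcs.continuousOn fun x hx => (hs x hx).ne').const_smul
          (Real.pi / 2)).mul (h.continuous.norm.pow 2).continuousOn).neg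
      · exact hcs.sqrt.continuousOn.inv₀ fun x hx => (Real.sqrt_pos.2 (hs x hx)).ne'
  refine (hφ.mul (h.hasACDeriv a b)).congr_deriv fun x => ?_
  rw [gnRemainder, Real.cot_eq_cos_div_sin]
  push_cast
  ring

/-- At the median `sin(πF) = 1`, so integrating the derivative of `v/√sin(πF)` from `x₀` compares it
with `v x₀`. Multiplying back by `√sin(πF)` at `x` cancels the large weight, and Cauchy-Schwarz
brings in the deficit. -/
theorem norm_sub_le_of_le (hm : ∫ t, ‖v t‖ ^ 2 = 1) {x₀ x : ℝ} (hx₀ : massLeft v x₀ = 1 / 2)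
    (hx : x₀ ≤ x) :
    ‖v x - v x₀ * ((√(Real.sin (Real.pi * massLeft v x)) : ℝ) : ℂ)‖ ≤
      √(gnDeficit v g * (x - x₀)) := by
  rcases (h.massLeft_le_one hm x).eq_or_lt with h1 | h1
  · rw [h.eq_zero_of_massLeft_eq_one hm h1, h1, mul_one, Real.sin_pi]
    simp
  have ha : 0 < massLeft v x₀ := by rw [hx₀]; norm_num
  have hs : ∀ t ∈ Set.Icc x₀ x, 0 < Real.sin (Real.pi * massLeft v t) := fun t ht => by
    have ht' := h.massLeft_mem_Ioo ha h1 ht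
    exact sin_pi_mul_pos ht'.1 ht'.2
  have hsx := hs x ⟨hx, le_rfl⟩
  -- Right of the median `πF` lies in `[π/2, π]`, where sine decreases, so the weight is largest at
  -- `x`.
  have hmono : ∀ t ∈ Set.Icc x₀ x, (√(Real.sin (Real.pi * massLeft v t)))⁻¹ ≤
      (√(Real.sin (Real.pi * massLeft v x)))⁻¹ := fun t ht => by
    gcongr
    have k1 := h.monotone_massLeft ht.1
    have k2 := h.monotone_massLeft ht.2
    rw [← Real.cos_pi_div_two_sub, ← Real.cos_pi_div_two_sub (Real.pi * massLeft v t),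
      ← Real.cos_neg, ← Real.cos_neg (Real.pi / 2 - Real.pi * massLeft v t)]
    apply Real.cos_le_cos_of_nonneg_of_le_pi <;> nlinarith [Real.pi_pos]
  have hAC := h.hasACDeriv_div_sqrt_sin hx ha h1
  have hint : IntervalIntegrable (gnRemainder v g) volume x₀ x := by
    have hcs : Continuous fun x => ((√(Real.sin (Real.pi * massLeft v x)) : ℝ) : ℂ) :=
      Complex.continuous_ofReal.comp
        (Real.continuous_sin.comp (h.continuous_massLeft.const_mul _)).sqrt
    refine (hAC.integrable.continuousOn_mul hcs.continuousOn).congr fun t ht => ?_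
    rw [Set.uIoc_of_le hx] at ht
    have := (Real.sqrt_pos.2 (hs t (Set.Ioc_subset_Icc_self ht))).ne'
    rw [← mul_assoc, ← Complex.ofReal_mul, mul_inv_cancel₀ this, Complex.ofReal_one, one_mul]
  have hCS := sq_intervalIntegral_norm_le hx hint.norm
    (h.intervalIntegrable_gnRemainder_sq hx ha h1).1
  have hG := h.integral_gnRemainder_le hm hx ha hx₀.le h1
  have hI : ∫ t in x₀..x, ‖gnRemainder v g t‖ ≤ √(gnDeficit v g * (x - x₀)) := by
    apply Real.le_sqrt_of_sq_le
    nlinarith [sub_nonneg.2 hx]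
  have hw := hAC.integral_eq_sub
  have h0 : √(Real.sin (Real.pi * massLeft v x₀)) = 1 := by
    rw [hx₀, mul_one_div, Real.sin_pi_div_two, Real.sqrt_one]
  rw [h0, inv_one, Complex.ofReal_one, one_mul] at hw
  set r := √(Real.sin (Real.pi * massLeft v x)) with hr
  have hr0 : 0 < r := Real.sqrt_pos.2 hsx
  have h2 : ‖((r⁻¹ : ℝ) : ℂ) * v x - v x₀‖ ≤ r⁻¹ * ∫ t in x₀..x, ‖gnRemainder v g t‖ := by
    rw [← hw, ← intervalIntegral.integral_const_mul]
    refine intervalIntegral.norm_integral_le_of_norm_le hx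
      (Eventually.of_forall fun t ht => ?_) (hint.norm.const_mul _)
    rw [norm_mul, Complex.norm_real, Real.norm_of_nonneg (by positivity)]
    exact mul_le_mul_of_nonneg_right (hmono t (Set.Ioc_subset_Icc_self ht)) (norm_nonneg _)
  have h3 : v x - v x₀ * (r : ℂ) = (r : ℂ) * (((r⁻¹ : ℝ) : ℂ) * v x - v x₀) := by
    rw [mul_sub, ← mul_assoc, ← Complex.ofReal_mul, mul_inv_cancel₀ hr0.ne', Complex.ofReal_one,
      one_mul, mul_comm (r : ℂ)]
  rw [h3, norm_mul, Complex.norm_real, Real.norm_of_nonneg hr0.le]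
  calc r * ‖((r⁻¹ : ℝ) : ℂ) * v x - v x₀‖ ≤ r * (r⁻¹ * ∫ t in x₀..x, ‖gnRemainder v g t‖) := by
        gcongr
    _ = ∫ t in x₀..x, ‖gnRemainder v g t‖ := by field_simp
    _ ≤ _ := hI

/-- A function with small Gagliardo-Nirenberg deficit is close to a multiple of
`√(sin(π F))`, where `F` is its cumulative mass. -/
theorem norm_sub_le (hm : ∫ t, ‖v t‖ ^ 2 = 1) {x₀ : ℝ} (hx₀ : massLeft v x₀ = 1 / 2) (x : ℝ) :
    ‖v x - v x₀ * ((√(Real.sin (Real.pi * massLeft v x)) : ℝ) : ℂ)‖ ≤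
      √(gnDeficit v g * |x - x₀|) := by
  rcases le_total x₀ x with h1 | h1
  · rw [abs_of_nonneg (sub_nonneg.2 h1)]
    exact h.norm_sub_le_of_le hm hx₀ h1
  · have h2 := h.reflect.norm_sub_le_of_le (x₀ := -x₀) (x := -x)
      (by rwa [integral_neg_eq_self (fun t => ‖v t‖ ^ 2) volume])
      (by rw [h.massLeft_reflect hm, neg_neg, hx₀]; norm_num) (by linarith)
    rw [h.massLeft_reflect hm, gnDeficit_reflect, mul_sub, mul_one, Real.sin_pi_sub] at h2
    simp only [neg_neg] at h2
    rw [abs_of_nonpos (sub_nonpos.2 h1)]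
    convert h2 using 3
    ring

end H1Rep

/-! ### The optimizers, and convergence to them by Grönwall's inequality -/

/-- The optimizers of the Gagliardo-Nirenberg inequality with unit mass. -/
def gnProfile (c : ℂ) (y x : ℝ) : ℂ := c * (Q0 (‖c‖ ^ 2 * (x - y)) : ℂ)

/-- The cumulative mass of `gnProfile`. -/
def gnProfileMass (κ y x : ℝ) : ℝ := 2 / Real.pi * Real.arctan (Real.exp (Real.pi * (κ * (x - y))))

theorem Q0_sq (x : ℝ) : Q0 x ^ 2 = 1 / Real.cosh (Real.pi * x) := by
  rw [Q0, div_pow, Real.sq_sqrt (Real.cosh_pos _).le, one_pow]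

theorem Q0_neg (x : ℝ) : Q0 (-x) = Q0 x := by
  rw [Q0, Q0, mul_neg, Real.cosh_neg]

theorem Q0_pos (x : ℝ) : 0 < Q0 x := by
  rw [Q0]; have := Real.cosh_pos (Real.pi * x); positivity

theorem continuous_Q0 : Continuous Q0 := by
  unfold Q0
  exact continuous_const.div (Real.continuous_cosh.comp (continuous_const_mul _)).sqrt
    fun x => (Real.sqrt_pos.2 (Real.cosh_pos _)).ne'

theorem continuous_gnProfile (c : ℂ) (y : ℝ) : Continuous (gnProfile c y) :=
  continuous_const.mul (Complex.continuous_ofReal.comp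
    (continuous_Q0.comp (continuous_const.mul (continuous_id.sub continuous_const))))

theorem gnProfile_reflect (c : ℂ) (y x : ℝ) : gnProfile c (-y) (-x) = gnProfile c y x := by
  rw [gnProfile, gnProfile, ← Q0_neg]; congr 3; ring

theorem sin_two_mul_arctan_exp (u : ℝ) :
    Real.sin (2 * Real.arctan (Real.exp u)) = 1 / Real.cosh u := by
  have h : 0 < 1 + Real.exp u ^ 2 := by positivity
  rw [Real.sin_two_mul, Real.sin_arctan, Real.cos_arctan, Real.cosh_eq, Real.exp_neg]
  have h2 : √(1 + Real.exp u ^ 2) ≠ 0 := (Real.sqrt_pos.2 h).ne'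
  have h3 := Real.sq_sqrt h.le
  have h4 := Real.exp_pos u
  have h5 : 2 * (Real.exp u / √(1 + Real.exp u ^ 2)) * (1 / √(1 + Real.exp u ^ 2)) =
      2 * Real.exp u / (√(1 + Real.exp u ^ 2)) ^ 2 := by field_simp
  rw [h5, h3]
  field_simp
  ring

theorem sin_pi_mul_gnProfileMass (κ y x : ℝ) :
    Real.sin (Real.pi * gnProfileMass κ y x) = Q0 (κ * (x - y)) ^ 2 := by
  rw [gnProfileMass, ← mul_assoc, mul_div_cancel₀ _ Real.pi_pos.ne', sin_two_mul_arctan_exp, Q0_sq]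

theorem hasDerivAt_gnProfileMass (κ y x : ℝ) :
    HasDerivAt (gnProfileMass κ y) (κ * Real.sin (Real.pi * gnProfileMass κ y x)) x := by
  rw [sin_pi_mul_gnProfileMass, Q0_sq]
  have h1 := (((((hasDerivAt_id x).sub_const y).const_mul κ).const_mul
    Real.pi).exp.arctan).const_mul (2 / Real.pi)
  refine h1.congr_deriv ?_
  simp only [id]
  have h2 := Real.exp_pos (Real.pi * (κ * (x - y)))
  rw [Real.cosh_eq, Real.exp_neg]
  have := Real.pi_pos
  field_simp
  ring

theorem gnProfileMass_self (κ y : ℝ) : gnProfileMass κ y y = 1 / 2 := by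
  rw [gnProfileMass, sub_self, mul_zero, mul_zero, Real.exp_zero, Real.arctan_one]
  have := Real.pi_pos
  field_simp
  norm_num

/-- `gnProfileMass κ y` is the exact solution of `F' = κ sin(πF)` with median `y`, and this vector
field is `κπ`-Lipschitz. -/
theorem gronwall_sin {F F' : ℝ → ℝ} {κ y t δ ε : ℝ} (hκ : 0 ≤ κ)
    (hF : ∀ x, HasDerivAt F (F' x) x) (h0 : |F y - 1 / 2| ≤ δ)
    (hε : ∀ x ∈ Set.Icc y t, |F' x - κ * Real.sin (Real.pi * F x)| ≤ ε) (ht : y ≤ t) :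
    |F t - gnProfileMass κ y t| ≤ gronwallBound δ (κ * Real.pi) ε (t - y) := by
  have hlip : ∀ _ : ℝ, LipschitzWith (Real.toNNReal (κ * Real.pi))
      (fun z => κ * Real.sin (Real.pi * z)) := fun _ => by
    refine LipschitzWith.of_dist_le_mul fun a b => ?_
    rw [Real.coe_toNNReal _ (by positivity), Real.dist_eq, Real.dist_eq, ← mul_sub, abs_mul,
      abs_of_nonneg hκ, mul_assoc]
    refine mul_le_mul_of_nonneg_left ?_ hκ
    have h1 := Real.abs_sin_sub_sin_le (Real.pi * a) (Real.pi * b)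
    rwa [← mul_sub, abs_mul, abs_of_pos Real.pi_pos] at h1
  have h1 := dist_le_of_approx_trajectories_ODE (v := fun _ z => κ * Real.sin (Real.pi * z))
    (f := F) (f' := F') (g := gnProfileMass κ y) (a := y) (b := t) (εf := ε) (εg := 0) (δ := δ)
    hlip (fun x _ => (hF x).continuousAt.continuousWithinAt) (fun x _ => (hF x).hasDerivWithinAt)
    (fun x hx => by rw [Real.dist_eq]; exact hε x ⟨hx.1, hx.2.le⟩)
    (fun x _ => (hasDerivAt_gnProfileMass κ y x).continuousAt.continuousWithinAt)
    (fun x _ => (hasDerivAt_gnProfileMass κ y x).hasDerivWithinAt)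
    (fun x _ => by rw [dist_self])
    (by rw [gnProfileMass_self, Real.dist_eq]; exact h0) t ⟨ht, le_rfl⟩
  rwa [Real.dist_eq, add_zero, Real.coe_toNNReal _ (by positivity)] at h1

theorem tendsto_gronwallBound {δ ε : ℕ → ℝ} (hδ : Tendsto δ atTop (𝓝 0))
    (hε : Tendsto ε atTop (𝓝 0)) (K x : ℝ) :
    Tendsto (fun n => gronwallBound (δ n) K (ε n) x) atTop (𝓝 0) := by
  by_cases hK : K = 0
  · subst hK
    simp only [gronwallBound_K0]
    simpa using hδ.add (hε.mul_const x)
  · simp only [gronwallBound_of_K_ne_0 hK]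
    simpa using (hδ.mul_const (Real.exp (K * x))).add
      ((hε.div_const K).mul_const (Real.exp (K * x) - 1))

theorem H1Rep.abs_massLeft_sub_le {v g : ℝ → ℂ} (h : H1Rep v g) (hm : ∫ t, ‖v t‖ ^ 2 = 1)
    (x y : ℝ) : |massLeft v x - massLeft v y| ≤ 2 * √(∫ t, ‖g t‖ ^ 2) * |x - y| := by
  rw [h.massLeft_sub, ← Real.norm_eq_abs]
  exact intervalIntegral.norm_integral_le_of_norm_le_const fun t _ => by
    rw [Real.norm_of_nonneg (by positivity)]; exact h.norm_sq_le hm t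

section Sequences

variable {v g : ℕ → ℝ → ℂ} {x : ℕ → ℝ} {y : ℝ} {c : ℂ} {S : ℝ}

/-- The stability estimate makes the cumulative masses approximate solutions of `F' = ‖c‖² sin(πF)`.
Grönwall's inequality identifies their limit, and the same estimate at `t` recovers `v n t`, phase
included. -/
theorem tendsto_gnProfile_of_le (h : ∀ n, H1Rep (v n) (g n)) (hm : ∀ n, ∫ t, ‖v n t‖ ^ 2 = 1)
    (hS : ∀ n, ∫ t, ‖g n t‖ ^ 2 ≤ S) (hG : Tendsto (fun n => gnDeficit (v n) (g n)) atTop (𝓝 0))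
    (hx : ∀ n, massLeft (v n) (x n) = 1 / 2) (hxy : Tendsto x atTop (𝓝 y))
    (hc : Tendsto (fun n => v n (x n)) atTop (𝓝 c)) {t : ℝ} (ht : y ≤ t) :
    Tendsto (fun n => v n t) atTop (𝓝 (gnProfile c y t)) := by
  -- Uniform error on `[y, t]`: the stability estimate with `|z - x n|` bounded by `(t - y) + |y - x
  -- n|`, plus the cost of replacing `v n (x n)` by `c`.
  set η : ℕ → ℝ := fun n =>
    √(gnDeficit (v n) (g n) * ((t - y) + |y - x n|)) + ‖v n (x n) - c‖ with hη
  have hd1 : Tendsto (fun n => |y - x n|) atTop (𝓝 0) := by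
    simpa using ((tendsto_const_nhds (x := y)).sub hxy).abs
  have hη0 : Tendsto η atTop (𝓝 0) := by
    have h1 := (hG.mul (tendsto_const_nhds (x := t - y) |>.add hd1)).sqrt
    have h2 := (hc.sub_const c).norm
    simpa using h1.add h2
  have hsin : ∀ n z, 0 ≤ Real.sin (Real.pi * massLeft (v n) z) ∧
      Real.sin (Real.pi * massLeft (v n) z) ≤ 1 := fun n z =>
    ⟨Real.sin_nonneg_of_nonneg_of_le_pi
      (mul_nonneg Real.pi_pos.le (massLeft_nonneg _ _))
      (mul_le_of_le_one_right Real.pi_pos.le ((h n).massLeft_le_one (hm n) z)), Real.sin_le_one _⟩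
  have hclose : ∀ n, ∀ z ∈ Set.Icc y t,
      ‖v n z - c * ((√(Real.sin (Real.pi * massLeft (v n) z)) : ℝ) : ℂ)‖ ≤ η n := fun n z hz => by
    have h1 := (h n).norm_sub_le (hm n) (hx n) z
    have h2 : √(gnDeficit (v n) (g n) * |z - x n|) ≤
        √(gnDeficit (v n) (g n) * ((t - y) + |y - x n|)) := by
      refine Real.sqrt_le_sqrt (mul_le_mul_of_nonneg_left ?_ ((h n).gnDeficit_nonneg (hm n)))
      have := abs_sub_le z y (x n)
      have h3 : |z - y| ≤ t - y := abs_le.2 ⟨by linarith [hz.1, hz.2], by linarith [hz.2]⟩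
      linarith
    have h4 : ‖(v n (x n) - c) * ((√(Real.sin (Real.pi * massLeft (v n) z)) : ℝ) : ℂ)‖ ≤
        ‖v n (x n) - c‖ := by
      rw [norm_mul, Complex.norm_real, Real.norm_of_nonneg (Real.sqrt_nonneg _)]
      exact mul_le_of_le_one_right (norm_nonneg _) (Real.sqrt_le_one.2 (hsin n z).2)
    calc _ = ‖(v n z - v n (x n) * ((√(Real.sin (Real.pi * massLeft (v n) z)) : ℝ) : ℂ)) +
          (v n (x n) - c) * ((√(Real.sin (Real.pi * massLeft (v n) z)) : ℝ) : ℂ)‖ := by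
            congr 1; ring
      _ ≤ _ := (norm_add_le _ _).trans (by linarith)
  have hode : ∀ n, ∀ z ∈ Set.Icc y t, |‖v n z‖ ^ 2 - ‖c‖ ^ 2 *
      Real.sin (Real.pi * massLeft (v n) z)| ≤ η n * (η n + 2 * ‖c‖) := fun n z hz => by
    have h1 := hclose n z hz
    set r := √(Real.sin (Real.pi * massLeft (v n) z)) with hr
    have hr1 : r ≤ 1 := Real.sqrt_le_one.2 (hsin n z).2
    have hr0 : 0 ≤ r := Real.sqrt_nonneg _
    rw [← Real.sq_sqrt (hsin n z).1, ← hr, ← mul_pow]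
    have h2 := abs_norm_sub_norm_le (v n z) (c * (r : ℂ))
    rw [norm_mul, Complex.norm_real, Real.norm_of_nonneg hr0] at h2
    have h3 := h2.trans h1
    have h4 : ‖c‖ * r ≤ ‖c‖ := mul_le_of_le_one_right (norm_nonneg _) hr1
    have h5 : ‖v n z‖ + ‖c‖ * r ≤ η n + 2 * ‖c‖ := by linarith [(abs_le.1 h3).2]
    have h6 : 0 ≤ ‖v n z‖ + ‖c‖ * r := by positivity
    have h7 : ‖v n z‖ ^ 2 - (‖c‖ * r) ^ 2 = (‖v n z‖ - ‖c‖ * r) * (‖v n z‖ + ‖c‖ * r) := by ring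
    rw [h7, abs_mul, abs_of_nonneg h6]
    exact mul_le_mul h3 h5 h6 ((abs_nonneg _).trans h3)
  have hstart : ∀ n, |massLeft (v n) y - 1 / 2| ≤ 2 * √S * |y - x n| := fun n => by
    rw [← hx n]
    refine ((h n).abs_massLeft_sub_le (hm n) _ _).trans ?_
    gcongr
    exact hS n
  have hgr := fun n => gronwall_sin (sq_nonneg ‖c‖) (h n).hasDerivAt_massLeft (hstart n)
    (hode n) ht
  have hF : Tendsto (fun n => massLeft (v n) t) atTop (𝓝 (gnProfileMass (‖c‖ ^ 2) y t)) := by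
    rw [tendsto_iff_norm_sub_tendsto_zero]
    refine squeeze_zero (fun n => norm_nonneg _) hgr (tendsto_gronwallBound ?_ ?_ _ _)
    · simpa using hd1.const_mul (2 * √S)
    · simpa using hη0.mul (hη0.add_const (2 * ‖c‖))
  have hlim : Tendsto (fun n => c * ((√(Real.sin (Real.pi * massLeft (v n) t)) : ℝ) : ℂ)) atTop
      (𝓝 (gnProfile c y t)) := by
    have h1 := ((Real.continuous_sin.tendsto _).comp (hF.const_mul Real.pi)).sqrt
    rw [sin_pi_mul_gnProfileMass, Real.sqrt_sq (Q0_pos _).le] at h1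
    exact ((Complex.continuous_ofReal.tendsto _).comp h1).const_mul c
  have hdiff : Tendsto (fun n => v n t -
      c * ((√(Real.sin (Real.pi * massLeft (v n) t)) : ℝ) : ℂ)) atTop (𝓝 0) :=
    squeeze_zero_norm (fun n => hclose n t ⟨ht, le_rfl⟩) hη0
  simpa using hdiff.add hlim

/-- Functions with vanishing Gagliardo-Nirenberg deficit converge pointwise to an optimizer, if
their medians and the values there converge. -/
theorem tendsto_gnProfile (h : ∀ n, H1Rep (v n) (g n)) (hm : ∀ n, ∫ t, ‖v n t‖ ^ 2 = 1)
    (hS : ∀ n, ∫ t, ‖g n t‖ ^ 2 ≤ S) (hG : Tendsto (fun n => gnDeficit (v n) (g n)) atTop (𝓝 0))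
    (hx : ∀ n, massLeft (v n) (x n) = 1 / 2) (hxy : Tendsto x atTop (𝓝 y))
    (hc : Tendsto (fun n => v n (x n)) atTop (𝓝 c)) (t : ℝ) :
    Tendsto (fun n => v n t) atTop (𝓝 (gnProfile c y t)) := by
  rcases le_total y t with ht | ht
  · exact tendsto_gnProfile_of_le h hm hS hG hx hxy hc ht
  · have h1 := tendsto_gnProfile_of_le (v := fun n z => v n (-z)) (g := fun n z => -g n (-z))
      (x := fun n => -x n) (y := -y) (c := c) (S := S) (t := -t) (fun n => (h n).reflect)
      (fun n => by rw [integral_neg_eq_self (fun t => ‖v n t‖ ^ 2) volume, hm n])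
      (fun n => by
        simp only [norm_neg]
        rw [integral_neg_eq_self (fun t => ‖g n t‖ ^ 2) volume]; exact hS n)
      (by simpa only [gnDeficit_reflect] using hG)
      (fun n => by rw [(h n).massLeft_reflect (hm n), neg_neg, hx n]; norm_num)
      hxy.neg (by simpa only [neg_neg] using hc) (by linarith)
    simpa only [neg_neg, gnProfile_reflect] using h1

end Sequences

/-! ### Integrals of `Q₀` and its derivative -/

theorem integrable_of_even {f : ℝ → ℝ} (he : ∀ x, f (-x) = f x)
    (hf : IntegrableOn f (Set.Ioi 0)) : Integrable f := by
  have h1 : IntegrableOn f (Set.Iic 0) := by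
    rw [← Measure.map_neg_eq_self (volume : Measure ℝ)]
    let m : MeasurableEmbedding fun x : ℝ => -x := (Homeomorph.neg ℝ).measurableEmbedding
    rw [m.integrableOn_map_iff]
    simp only [Function.comp_def, he, Set.neg_preimage, Set.neg_Iic, neg_zero]
    exact (integrableOn_Ici_iff_integrableOn_Ioi (by simp)).2 hf
  rw [← integrableOn_univ, ← Set.Iic_union_Ioi (a := (0 : ℝ))]
  exact h1.union hf

theorem Q0_sq_le (x : ℝ) : Q0 x ^ 2 ≤ 2 * Real.exp (-Real.pi * x) := by
  rw [Q0_sq, div_le_iff₀ (Real.cosh_pos _), Real.cosh_eq]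
  have h1 : Real.exp (-Real.pi * x) * Real.exp (Real.pi * x) = 1 := by
    rw [← Real.exp_add]; simp
  have h2 := Real.exp_pos (-Real.pi * x)
  have h3 := Real.exp_pos (-(Real.pi * x))
  nlinarith

theorem continuous_abs_rpow {s : ℝ} (hs : 0 ≤ s) : Continuous fun x : ℝ => |x| ^ s :=
  continuous_abs.rpow_const fun _ => Or.inr hs

theorem integrable_abs_rpow_mul_Q0_sq {s : ℝ} (hs : 0 ≤ s) :
    Integrable fun x : ℝ => |x| ^ s * Q0 x ^ 2 := by
  refine integrable_of_even (fun x => by rw [abs_neg, Q0_neg]) ?_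
  have h1 := (integrableOn_rpow_mul_exp_neg_mul_rpow (p := 1) (s := s) (by linarith) one_pos
    Real.pi_pos).const_mul 2
  refine Integrable.mono' h1 ((continuous_abs_rpow hs).mul
    (continuous_Q0.pow 2)).aestronglyMeasurable ?_
  filter_upwards [ae_restrict_mem measurableSet_Ioi] with x hx
  have hx' : 0 < x := hx
  rw [Real.norm_of_nonneg (by positivity), abs_of_pos hx', Real.rpow_one]
  have := Q0_sq_le x
  have h2 : 0 ≤ x ^ s := by positivity
  nlinarith

theorem integrable_Q0_sq : Integrable fun x : ℝ => Q0 x ^ 2 := by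
  simpa using integrable_abs_rpow_mul_Q0_sq le_rfl

theorem Q0_le_one (x : ℝ) : Q0 x ≤ 1 := by
  rw [Q0, div_le_one (Real.sqrt_pos.2 (Real.cosh_pos _))]
  exact Real.one_le_sqrt.2 (Real.one_le_cosh _)

theorem integrable_Q0_pow (k : ℕ) : Integrable fun x : ℝ => Q0 x ^ (k + 2) := by
  refine integrable_Q0_sq.mono' (continuous_Q0.pow _).aestronglyMeasurable
    (Eventually.of_forall fun x => ?_)
  rw [Real.norm_of_nonneg (pow_nonneg (Q0_pos x).le _)]
  exact pow_le_pow_of_le_one (Q0_pos x).le (Q0_le_one x) (by omega)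

theorem sin_gnProfileMass (x : ℝ) : Real.sin (Real.pi * gnProfileMass 1 0 x) = Q0 x ^ 2 := by
  rw [sin_pi_mul_gnProfileMass]; simp

theorem hasDerivAt_gnProfileMass_one (x : ℝ) : HasDerivAt (gnProfileMass 1 0) (Q0 x ^ 2) x := by
  simpa [sin_gnProfileMass] using hasDerivAt_gnProfileMass 1 0 x

theorem tendsto_gnProfileMass_atTop : Tendsto (gnProfileMass 1 0) atTop (𝓝 1) := by
  have h1 : Tendsto (fun x : ℝ => Real.pi * (1 * (x - 0))) atTop atTop := by
    simpa using tendsto_id.const_mul_atTop Real.pi_pos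
  have h2 := ((tendsto_nhds_of_tendsto_nhdsWithin Real.tendsto_arctan_atTop).comp
    (Real.tendsto_exp_atTop.comp h1)).const_mul (2 / Real.pi)
  have h3 : 2 / Real.pi * (Real.pi / 2) = 1 := by have := Real.pi_pos; field_simp
  rwa [h3] at h2

theorem tendsto_gnProfileMass_atBot : Tendsto (gnProfileMass 1 0) atBot (𝓝 0) := by
  have h1 : Tendsto (fun x : ℝ => Real.pi * (1 * (x - 0))) atBot atBot := by
    simpa using tendsto_id.const_mul_atBot Real.pi_pos
  have h2 := ((Real.continuous_arctan.tendsto 0).comp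
    (Real.tendsto_exp_atBot.comp h1)).const_mul (2 / Real.pi)
  rw [Real.arctan_zero, mul_zero] at h2
  exact h2

theorem integral_Q0_sq : ∫ x, Q0 x ^ 2 = 1 := by
  simpa using integral_of_hasDerivAt_of_tendsto hasDerivAt_gnProfileMass_one integrable_Q0_sq
    tendsto_gnProfileMass_atBot tendsto_gnProfileMass_atTop

theorem hasDerivAt_cos_gnProfileMass (x : ℝ) :
    HasDerivAt (fun x => Real.cos (Real.pi * gnProfileMass 1 0 x)) (-(Real.pi * Q0 x ^ 4)) x := by
  have h1 := ((hasDerivAt_gnProfileMass_one x).const_mul Real.pi).cos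
  rw [sin_gnProfileMass] at h1
  exact h1.congr_deriv (by ring)

theorem tendsto_cos_gnProfileMass_atTop :
    Tendsto (fun x => Real.cos (Real.pi * gnProfileMass 1 0 x)) atTop (𝓝 (-1)) := by
  simpa [Function.comp_def] using (Real.continuous_cos.tendsto _).comp (tendsto_gnProfileMass_atTop.const_mul Real.pi)

theorem tendsto_cos_gnProfileMass_atBot :
    Tendsto (fun x => Real.cos (Real.pi * gnProfileMass 1 0 x)) atBot (𝓝 1) := by
  simpa [Function.comp_def] using (Real.continuous_cos.tendsto _).comp (tendsto_gnProfileMass_atBot.const_mul Real.pi)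

theorem tendsto_Q0_sq_atTop : Tendsto (fun x => Q0 x ^ 2) atTop (𝓝 0) := by
  simpa [sin_gnProfileMass, Function.comp_def] using
    (Real.continuous_sin.tendsto _).comp (tendsto_gnProfileMass_atTop.const_mul Real.pi)

theorem tendsto_Q0_sq_atBot : Tendsto (fun x => Q0 x ^ 2) atBot (𝓝 0) := by
  simpa [sin_gnProfileMass, Function.comp_def] using
    (Real.continuous_sin.tendsto _).comp (tendsto_gnProfileMass_atBot.const_mul Real.pi)

/-- With `F` the cumulative mass of `Q₀`, `cos(πF)` falls from `1` to `-1` and has derivative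
`-πQ₀⁴`. -/
theorem integral_Q0_pow_four : ∫ x, Q0 x ^ 4 = 2 / Real.pi := by
  have h1 := integral_of_hasDerivAt_of_tendsto hasDerivAt_cos_gnProfileMass
    ((integrable_Q0_pow 2).const_mul Real.pi).neg
    tendsto_cos_gnProfileMass_atBot tendsto_cos_gnProfileMass_atTop
  rw [integral_neg, integral_const_mul] at h1
  rw [eq_div_iff Real.pi_pos.ne']
  linarith

theorem cos_sq_gnProfileMass (x : ℝ) :
    Real.cos (Real.pi * gnProfileMass 1 0 x) ^ 2 = 1 - Q0 x ^ 4 := by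
  rw [Real.cos_sq', sin_gnProfileMass]; ring

theorem hasDerivAt_Q0_sq (x : ℝ) : HasDerivAt (fun x => Q0 x ^ 2)
    (Real.pi * Real.cos (Real.pi * gnProfileMass 1 0 x) * Q0 x ^ 2) x := by
  have h1 := ((hasDerivAt_gnProfileMass_one x).const_mul Real.pi).sin
  simp only [sin_gnProfileMass] at h1
  exact h1.congr_deriv (by ring)

/-- `Q₀² cos(πF)` vanishes at both ends and its derivative is `πQ₀² - 2πQ₀⁶`, so the known mass
determines the sextic integral. -/
theorem integral_Q0_pow_six : ∫ x, Q0 x ^ 6 = 1 / 2 := by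
  have h1 : ∀ x, HasDerivAt
      (fun x => Q0 x ^ 2 * Real.cos (Real.pi * gnProfileMass 1 0 x))
      (Real.pi * Q0 x ^ 2 - 2 * Real.pi * Q0 x ^ 6) x := fun x => by
    refine ((hasDerivAt_Q0_sq x).mul (hasDerivAt_cos_gnProfileMass x)).congr_deriv ?_
    have := cos_sq_gnProfileMass x
    linear_combination Real.pi * Q0 x ^ 2 * this
  have h2 := integral_of_hasDerivAt_of_tendsto h1
    ((integrable_Q0_sq.const_mul Real.pi).sub ((integrable_Q0_pow 4).const_mul (2 * Real.pi)))
    (tendsto_Q0_sq_atBot.mul tendsto_cos_gnProfileMass_atBot)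
    (tendsto_Q0_sq_atTop.mul tendsto_cos_gnProfileMass_atTop)
  rw [integral_sub (integrable_Q0_sq.const_mul Real.pi)
    ((integrable_Q0_pow 4).const_mul (2 * Real.pi)), integral_const_mul, integral_const_mul,
    integral_Q0_sq] at h2
  have h3 : Real.pi * (1 - 2 * ∫ x, Q0 x ^ 6) = 0 := by linarith
  rcases mul_eq_zero.1 h3 with h | h
  · exact absurd h Real.pi_pos.ne'
  · linarith

/-- The derivative of `Q0`. -/
def derivQ0 (x : ℝ) : ℝ := Real.pi / 2 * Real.cos (Real.pi * gnProfileMass 1 0 x) * Q0 x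

theorem hasDerivAt_Q0 (x : ℝ) : HasDerivAt Q0 (derivQ0 x) x := by
  have h1 := (hasDerivAt_Q0_sq x).sqrt (pow_pos (Q0_pos x) 2).ne'
  have h2 : (fun x => √(Q0 x ^ 2)) = Q0 := funext fun x => Real.sqrt_sq (Q0_pos x).le
  rw [h2, Real.sqrt_sq (Q0_pos x).le] at h1
  refine h1.congr_deriv ?_
  have := (Q0_pos x).ne'
  rw [derivQ0]
  field_simp

theorem hasDerivAt_derivQ0 (x : ℝ) :
    HasDerivAt derivQ0 (Real.pi ^ 2 / 4 * (Q0 x - 3 * Q0 x ^ 5)) x := by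
  refine (((hasDerivAt_cos_gnProfileMass x).const_mul (Real.pi / 2)).mul
    (hasDerivAt_Q0 x)).congr_deriv ?_
  have := cos_sq_gnProfileMass x
  rw [derivQ0]
  linear_combination Real.pi ^ 2 / 4 * Q0 x * this

theorem derivQ0_sq (x : ℝ) : derivQ0 x ^ 2 = Real.pi ^ 2 / 4 * (Q0 x ^ 2 - Q0 x ^ 6) := by
  have := cos_sq_gnProfileMass x
  rw [derivQ0]
  linear_combination Real.pi ^ 2 / 4 * Q0 x ^ 2 * this

theorem continuous_derivQ0 : Continuous derivQ0 :=
  continuous_iff_continuousAt.2 fun x => (hasDerivAt_derivQ0 x).continuousAt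

theorem integrable_derivQ0_sq : Integrable fun x => derivQ0 x ^ 2 := by
  simp only [derivQ0_sq]
  exact (integrable_Q0_sq.sub (integrable_Q0_pow 4)).const_mul _

theorem integral_derivQ0_sq : ∫ x, derivQ0 x ^ 2 = Real.pi ^ 2 / 8 := by
  simp only [derivQ0_sq]
  rw [integral_const_mul, integral_sub integrable_Q0_sq (integrable_Q0_pow 4), integral_Q0_sq,
    integral_Q0_pow_six]
  ring

theorem memLp_ofReal_of_sq {f : ℝ → ℝ} (hc : Continuous f) (hf : Integrable fun x => f x ^ 2) :
    MemLp (fun x => (f x : ℂ)) 2 volume := by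
  have h1 : Continuous fun x => (f x : ℂ) := Complex.continuous_ofReal.comp hc
  rw [memLp_two_iff_integrable_sq_norm h1.aestronglyMeasurable]
  simpa using hf

theorem h1Rep_Q0 : H1Rep (fun x => (Q0 x : ℂ)) (fun x => (derivQ0 x : ℂ)) := by
  refine ⟨memLp_ofReal_of_sq continuous_Q0 integrable_Q0_sq,
    memLp_ofReal_of_sq continuous_derivQ0 integrable_derivQ0_sq, fun x y => ?_⟩
  exact (intervalIntegral.integral_eq_sub_of_hasDerivAt
    (fun t _ => (hasDerivAt_Q0 t).ofReal_comp)
    ((Complex.continuous_ofReal.comp continuous_derivQ0).intervalIntegrable _ _)).symm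

/-! ### Minimizing the limiting energy over the optimizers -/

/-- The moment `∫ |x + z|^s Q₀(x)² dx`. -/
def shiftedMoment (s z : ℝ) : ℝ := ∫ x, |x + z| ^ s * Q0 x ^ 2

theorem integrable_shiftedMoment {s : ℝ} (hs : 0 ≤ s) (z : ℝ) :
    Integrable fun x : ℝ => |x + z| ^ s * Q0 x ^ 2 := by
  refine (((integrable_abs_rpow_mul_Q0_sq hs).const_mul (2 ^ s)).add
    (integrable_Q0_sq.const_mul (2 ^ s * |z| ^ s))).mono' ?_ (Eventually.of_forall fun x => ?_)
  · exact (((continuous_abs_rpow hs).comp (continuous_id.add continuous_const)).mul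
      (continuous_Q0.pow 2)).aestronglyMeasurable
  · have h1 : |x + z| ^ s ≤ 2 ^ s * |x| ^ s + 2 ^ s * |z| ^ s := by
      have h2 : |x + z| ≤ 2 * max |x| |z| := by
        have := abs_add_le x z
        have := le_max_left |x| |z|
        have := le_max_right |x| |z|
        linarith
      calc |x + z| ^ s ≤ (2 * max |x| |z|) ^ s := Real.rpow_le_rpow (abs_nonneg _) h2 hs
        _ = 2 ^ s * max |x| |z| ^ s := Real.mul_rpow two_pos.le (by positivity)
        _ ≤ _ := by
          rcases max_choice |x| |z| with h | h <;> rw [h]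
          · exact le_add_of_nonneg_right (by positivity)
          · exact le_add_of_nonneg_left (by positivity)
    rw [Real.norm_of_nonneg (by positivity), Pi.add_apply]
    calc _ ≤ (2 ^ s * |x| ^ s + 2 ^ s * |z| ^ s) * Q0 x ^ 2 := by gcongr
      _ = _ := by ring

theorem Q0_lt_Q0 {x y : ℝ} (h : |x| < |y|) : Q0 y < Q0 x := by
  have h1 : Real.cosh (Real.pi * x) < Real.cosh (Real.pi * y) := by
    rw [Real.cosh_lt_cosh, abs_mul, abs_mul]
    exact mul_lt_mul_of_pos_left h (abs_pos.2 Real.pi_pos.ne')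
  rw [Q0, Q0]
  exact one_div_lt_one_div_of_lt (Real.sqrt_pos.2 (Real.cosh_pos _))
    (Real.sqrt_lt_sqrt (Real.cosh_pos _).le h1)

/-- A two-point rearrangement: `|·|^s` increases and `Q₀²` decreases with `|x|`, so the product `f`
of their opposite increments is nonnegative, and translation and reflection show that its integral
is twice the difference of the moments. Strictness comes from `f 0 > 0` and continuity. -/
theorem shiftedMoment_zero_lt {s : ℝ} (hs : 0 < s) {z : ℝ} (hz : z ≠ 0) :
    shiftedMoment s 0 < shiftedMoment s z := by
  set f : ℝ → ℝ := fun x => (|x + z| ^ s - |x| ^ s) * (Q0 x ^ 2 - Q0 (x + z) ^ 2) with hf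
  have i1 := integrable_shiftedMoment hs.le z
  have i2 := integrable_abs_rpow_mul_Q0_sq hs.le
  have i3 : Integrable fun x => |x + z| ^ s * Q0 (x + z) ^ 2 := i2.comp_add_right z
  have i4 : Integrable fun x => |x| ^ s * Q0 (x + z) ^ 2 := by
    have := (integrable_shiftedMoment hs.le (-z)).comp_add_right z
    simpa using this
  have e3 : ∫ x, |x + z| ^ s * Q0 (x + z) ^ 2 = shiftedMoment s 0 := by
    rw [integral_add_right_eq_self (fun x => |x| ^ s * Q0 x ^ 2) z, shiftedMoment]; simp
  have e4 : ∫ x, |x| ^ s * Q0 (x + z) ^ 2 = shiftedMoment s z := by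
    have h1 := integral_add_right_eq_self (μ := volume) (fun x => |x + -z| ^ s * Q0 x ^ 2) z
    have h2 := integral_neg_eq_self (fun x => |x + -z| ^ s * Q0 x ^ 2) volume
    simp only [add_neg_cancel_right] at h1
    rw [h1, ← h2, shiftedMoment]
    congr 1
    funext x
    rw [Q0_neg, ← neg_add, abs_neg]
  have hfe : f = fun x => (|x + z| ^ s * Q0 x ^ 2 - |x + z| ^ s * Q0 (x + z) ^ 2) -
      (|x| ^ s * Q0 x ^ 2 - |x| ^ s * Q0 (x + z) ^ 2) := by funext x; simp only [hf]; ring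
  have hfi : Integrable f := by rw [hfe]; exact (i1.sub i3).sub (i2.sub i4)
  have hint : ∫ x, f x = 2 * (shiftedMoment s z - shiftedMoment s 0) := by
    have e2 : ∫ x, |x| ^ s * Q0 x ^ 2 = shiftedMoment s 0 := by simp [shiftedMoment]
    have e1 : ∫ x, |x + z| ^ s * Q0 x ^ 2 = shiftedMoment s z := rfl
    have k1 := integral_sub (i1.sub i3) (i2.sub i4)
    simp only [Pi.sub_apply] at k1
    rw [hfe, k1, integral_sub i1 i3, integral_sub i2 i4, e1, e2, e3, e4]
    ring
  have hpos : ∀ x, |x| ≠ |x + z| → 0 < f x := fun x hx => by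
    rcases lt_or_gt_of_ne hx with h | h
    · refine mul_pos (sub_pos.2 (Real.rpow_lt_rpow (abs_nonneg _) h hs)) (sub_pos.2 ?_)
      exact pow_lt_pow_left₀ (Q0_lt_Q0 h) (Q0_pos _).le two_ne_zero
    · refine mul_pos_of_neg_of_neg (sub_neg.2 (Real.rpow_lt_rpow (abs_nonneg _) h hs))
        (sub_neg.2 ?_)
      exact pow_lt_pow_left₀ (Q0_lt_Q0 h) (Q0_pos _).le two_ne_zero
  have hnn : 0 ≤ f := fun x => by
    by_cases hx : |x| = |x + z|
    · simp [hf, hx]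
    · exact (hpos x hx).le
  have hfc : Continuous f := by
    have k1 := continuous_abs_rpow hs.le
    have k2 : Continuous fun x : ℝ => x + z := continuous_id.add continuous_const
    exact ((k1.comp k2).sub k1).mul ((continuous_Q0.pow 2).sub ((continuous_Q0.comp k2).pow 2))
  have h0 : 0 < ∫ x, f x := by
    rw [integral_pos_iff_support_of_nonneg hnn hfi]
    refine hfc.isOpen_support.measure_pos volume ⟨0, ?_⟩
    exact (hpos 0 (by simpa using (abs_pos.2 hz).ne)).ne'
  rw [hint] at h0
  linarith

theorem Qs_eq (s : ℝ) : Qs s = s * shiftedMoment s 0 := by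
  simp [Qs, shiftedMoment]

theorem shiftedMoment_zero_pos {s : ℝ} (hs : 0 < s) : 0 < shiftedMoment s 0 := by
  rw [shiftedMoment, integral_pos_iff_support_of_nonneg (fun x => by positivity)
    (integrable_shiftedMoment hs.le 0)]
  have hc : Continuous fun x : ℝ => |x + 0| ^ s * Q0 x ^ 2 := by
    simpa only [add_zero] using! (continuous_abs_rpow hs.le).mul (continuous_Q0.pow 2)
  refine hc.isOpen_support.measure_pos volume ⟨1, ?_⟩
  simpa using (Q0_pos 1).ne'

theorem Qs_pos {s : ℝ} (hs : 0 < s) : 0 < Qs s := by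
  rw [Qs_eq]; exact mul_pos hs (shiftedMoment_zero_pos hs)

theorem integral_comp_mul_sub (f : ℝ → ℝ) {κ : ℝ} (hκ : 0 < κ) (y : ℝ) :
    ∫ x, f (κ * (x - y)) = κ⁻¹ * ∫ x, f x := by
  rw [integral_sub_right_eq_self (fun x => f (κ * x)) y, Measure.integral_comp_mul_left,
    abs_of_pos (inv_pos.2 hκ), smul_eq_mul]

theorem norm_gnProfile (c : ℂ) (y x : ℝ) : ‖gnProfile c y x‖ = ‖c‖ * Q0 (‖c‖ ^ 2 * (x - y)) := by
  rw [gnProfile, norm_mul, Complex.norm_real, Real.norm_of_nonneg (Q0_pos _).le]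

theorem integral_norm_gnProfile_pow {c : ℂ} (hc : c ≠ 0) (y : ℝ) (k : ℕ) :
    ∫ x, ‖gnProfile c y x‖ ^ (k + 2) = ‖c‖ ^ k * ∫ x, Q0 x ^ (k + 2) := by
  have hc' : 0 < ‖c‖ := norm_pos_iff.2 hc
  simp only [norm_gnProfile, mul_pow]
  rw [integral_const_mul, integral_comp_mul_sub (fun x => Q0 x ^ (k + 2)) (by positivity) y]
  field_simp
  ring

theorem integrable_norm_gnProfile_pow {c : ℂ} (hc : c ≠ 0) (y : ℝ) (k : ℕ) :
    Integrable fun x => ‖gnProfile c y x‖ ^ (k + 2) := by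
  have hc' : 0 < ‖c‖ := norm_pos_iff.2 hc
  simp only [norm_gnProfile, mul_pow]
  exact (((integrable_Q0_pow k).comp_mul_left' (pow_pos hc' 2).ne').comp_sub_right y).const_mul _

theorem integral_potential_gnProfile {s : ℝ} {c : ℂ} (hc : c ≠ 0) (y : ℝ) :
    ∫ x, |x| ^ s * ‖gnProfile c y x‖ ^ 2 =
      (‖c‖ ^ 2) ^ (-s) * shiftedMoment s (‖c‖ ^ 2 * y) := by
  have hc' : 0 < ‖c‖ := norm_pos_iff.2 hc
  set f : ℝ → ℝ := fun u => ‖c‖ ^ 2 * (‖c‖ ^ 2) ^ (-s) * (|u + ‖c‖ ^ 2 * y| ^ s * Q0 u ^ 2) with hf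
  have h1 : ∀ x : ℝ, |x| ^ s * ‖gnProfile c y x‖ ^ 2 = f (‖c‖ ^ 2 * (x - y)) := fun x => by
    have h2 : ‖c‖ ^ 2 * (x - y) + ‖c‖ ^ 2 * y = ‖c‖ ^ 2 * x := by ring
    simp only [hf, h2, norm_gnProfile]
    rw [abs_mul, abs_of_pos (pow_pos hc' 2), Real.mul_rpow (by positivity) (abs_nonneg _),
      Real.rpow_neg (by positivity), mul_pow]
    have h3 : (0 : ℝ) < (‖c‖ ^ 2) ^ s := by positivity
    field_simp
  simp only [h1]
  rw [integral_comp_mul_sub f (pow_pos hc' 2), hf, integral_const_mul, shiftedMoment]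
  field_simp

theorem integrable_potential_gnProfile {s : ℝ} (hs : 0 ≤ s) {c : ℂ} (hc : c ≠ 0) (y : ℝ) :
    Integrable fun x => |x| ^ s * ‖gnProfile c y x‖ ^ 2 := by
  have hc' : 0 < ‖c‖ := norm_pos_iff.2 hc
  have h1 := (((integrable_shiftedMoment hs (‖c‖ ^ 2 * y)).comp_mul_left'
    (pow_pos hc' 2).ne').comp_sub_right y).const_mul (‖c‖ ^ 2 * (‖c‖ ^ 2) ^ (-s))
  refine h1.congr (Eventually.of_forall fun x => ?_)
  have h2 : ‖c‖ ^ 2 * (x - y) + ‖c‖ ^ 2 * y = ‖c‖ ^ 2 * x := by ring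
  simp only [h2, norm_gnProfile]
  rw [abs_mul, abs_of_pos (pow_pos hc' 2), Real.mul_rpow (by positivity) (abs_nonneg _),
    Real.rpow_neg (by positivity), mul_pow]
  have h3 : (0 : ℝ) < (‖c‖ ^ 2) ^ s := by positivity
  field_simp

/-- The limiting energy of the optimizer `gnProfile c y`, divided by `ℓ^s`. -/
def limitEnergy (s ζ : ℝ) (c : ℂ) (y : ℝ) : ℝ :=
  ζ * Qs s / 6 * (∫ x, ‖gnProfile c y x‖ ^ 6) + (∫ x, |x| ^ s * ‖gnProfile c y x‖ ^ 2) +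
    (6 - ζ) / 6 * Real.pi * Qs s / 2 * ∫ x, ‖gnProfile c y x‖ ^ 4

/-- The convex function `κ ^ (-s)` lies above its tangent at `1`, by `e^t ≥ 1 + t` and `log κ ≤ κ -
1`; the latter supplies the strictness. -/
theorem rpow_neg_ge {s κ : ℝ} (hs : 0 < s) (hκ : 0 < κ) :
    1 - s * (κ - 1) ≤ κ ^ (-s) ∧ (κ ≠ 1 → 1 - s * (κ - 1) < κ ^ (-s)) := by
  rw [Real.rpow_def_of_pos hκ]
  have h1 := Real.add_one_le_exp (Real.log κ * -s)
  constructor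
  · have h2 := Real.log_le_sub_one_of_pos hκ
    nlinarith
  · intro h
    have h2 := Real.log_lt_sub_one_of_pos hκ h
    nlinarith

/-- With `κ = ‖c‖²`, the excess over the minimum is a sum of three nonnegative terms: a multiple of
`(κ - 1)²` from the sextic part, the tangent-line gap of `κ ^ (-s)`, and the moment gap due to the
shift. The last two give uniqueness even when `ζ = 0`. -/
theorem limitEnergy_ge {s ζ : ℝ} (hs : 0 < s) (hζ : 0 ≤ ζ) {c : ℂ} (hc : c ≠ 0) (y : ℝ) :
    ((s + 1) / s - ζ / 12) * Qs s ≤ limitEnergy s ζ c y ∧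
    (limitEnergy s ζ c y ≤ ((s + 1) / s - ζ / 12) * Qs s → ‖c‖ = 1 ∧ y = 0) := by
  have hc' : 0 < ‖c‖ ^ 2 := pow_pos (norm_pos_iff.2 hc) 2
  set κ := ‖c‖ ^ 2 with hκ
  have hP := shiftedMoment_zero_pos hs
  set P := shiftedMoment s 0 with hPdef
  have hle : P ≤ shiftedMoment s (κ * y) ∧ (y ≠ 0 → P < shiftedMoment s (κ * y)) := by
    have h1 : y ≠ 0 → P < shiftedMoment s (κ * y) := fun hy =>
      shiftedMoment_zero_lt hs (mul_ne_zero hc'.ne' hy)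
    refine ⟨?_, h1⟩
    by_cases hy : y = 0
    · rw [hy, mul_zero]
    · exact (h1 hy).le
  have hE : limitEnergy s ζ c y = s * P * (ζ * κ ^ 2 / 12 + (6 - ζ) / 6 * κ) +
      κ ^ (-s) * shiftedMoment s (κ * y) := by
    rw [limitEnergy, integral_norm_gnProfile_pow hc y 4, integral_norm_gnProfile_pow hc y 2,
      integral_potential_gnProfile hc, integral_Q0_pow_four, integral_Q0_pow_six, Qs_eq]
    have h4 : ‖c‖ ^ 4 = κ ^ 2 := by rw [hκ]; ring
    rw [h4, ← hκ]
    have := Real.pi_pos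
    field_simp
    ring
  have hD : limitEnergy s ζ c y - ((s + 1) / s - ζ / 12) * Qs s =
      s * P * ζ / 12 * (κ - 1) ^ 2 + P * (κ ^ (-s) - (1 - s * (κ - 1))) +
      κ ^ (-s) * (shiftedMoment s (κ * y) - P) := by
    rw [hE, Qs_eq]
    field_simp
    ring
  obtain ⟨b1, b2⟩ := rpow_neg_ge hs hc'
  have hr : 0 < κ ^ (-s) := Real.rpow_pos_of_pos hc' _
  have t1 : 0 ≤ s * P * ζ / 12 * (κ - 1) ^ 2 := by positivity
  have t2 : 0 ≤ P * (κ ^ (-s) - (1 - s * (κ - 1))) := mul_nonneg hP.le (sub_nonneg.2 b1)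
  have t3 : 0 ≤ κ ^ (-s) * (shiftedMoment s (κ * y) - P) :=
    mul_nonneg hr.le (sub_nonneg.2 hle.1)
  refine ⟨by linarith, fun h => ⟨?_, ?_⟩⟩
  · by_contra hne
    have hκ1 : κ ≠ 1 := fun h1 => hne (by
      rw [hκ] at h1
      exact (pow_eq_one_iff_of_nonneg (norm_nonneg c) two_ne_zero).1 h1)
    have := mul_pos hP (sub_pos.2 (b2 hκ1))
    linarith
  · by_contra hne
    have := mul_pos hr (sub_pos.2 (hle.2 hne))
    linarith

/-! ### Collapsing sequences: a priori bounds and compactness -/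

/-- The energy of `√ℓ u(ℓ ·)`, divided by `ℓ^s`, in rescaled parameters. -/
def scaledEnergy (s μ β α : ℝ) (v g : ℝ → ℂ) : ℝ :=
  μ * gnDeficit v g + β / 6 * (∫ x, ‖v x‖ ^ 6) + (∫ x, |x| ^ s * ‖v x‖ ^ 2) +
    α / 2 * ∫ x, ‖v x‖ ^ 4

/-- Normalized sequences with asymptotically bounded rescaled energy, in the collapse regime. -/
structure CollapsingSeq (s ζ e : ℝ) (μ β α : ℕ → ℝ) (v g : ℕ → ℝ → ℂ) : Prop where
  rep : ∀ n, H1Rep (v n) (g n)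
  mass : ∀ n, ∫ x, ‖v n x‖ ^ 2 = 1
  pot : ∀ n, Integrable fun x => |x| ^ s * ‖v n x‖ ^ 2
  tendsto_μ : Tendsto μ atTop atTop
  nonneg_β : ∀ n, 0 ≤ β n
  tendsto_β : Tendsto β atTop (𝓝 (ζ * Qs s))
  tendsto_α : Tendsto α atTop (𝓝 ((6 - ζ) / 6 * Real.pi * Qs s))
  energy : ∃ E : ℕ → ℝ, Tendsto E atTop (𝓝 e) ∧
    ∀ n, scaledEnergy s (μ n) (β n) (α n) (v n) (g n) ≤ E n

theorem CollapsingSeq.comp {s ζ e : ℝ} {μ β α : ℕ → ℝ} {v g : ℕ → ℝ → ℂ}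
    (H : CollapsingSeq s ζ e μ β α v g) {φ : ℕ → ℕ} (hφ : Tendsto φ atTop atTop) :
    CollapsingSeq s ζ e (μ ∘ φ) (β ∘ φ) (α ∘ φ) (v ∘ φ) (g ∘ φ) := by
  obtain ⟨E, h1, h2⟩ := H.energy
  exact ⟨fun n => H.rep _, fun n => H.mass _, fun n => H.pot _, H.tendsto_μ.comp hφ,
    fun n => H.nonneg_β _, H.tendsto_β.comp hφ, H.tendsto_α.comp hφ,
    E ∘ φ, h1.comp hφ, fun n => h2 _⟩

namespace H1Rep

variable {v g : ℝ → ℂ} (h : H1Rep v g)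
include h

theorem sq_integral_pow_four_le (hm : ∫ t, ‖v t‖ ^ 2 = 1) :
    (∫ t, ‖v t‖ ^ 4) ^ 2 ≤ ∫ t, ‖v t‖ ^ 6 := by
  have e1 : (fun t => (‖v t‖ ^ 3) ^ 2) = fun t => ‖v t‖ ^ 6 := by funext t; ring
  have e2 : (fun t => ‖v t‖ * ‖v t‖ ^ 3) = fun t => ‖v t‖ ^ 4 := by funext t; ring
  have h1 := sq_integral_mul_le (μ := volume) (f := fun t => ‖v t‖) (g := fun t => ‖v t‖ ^ 3)
    h.integrable_sq (by rw [e1]; exact h.integrable_pow hm 4)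
    (by rw [e2]; exact h.integrable_pow hm 2)
  rw [hm, one_mul] at h1
  simpa only [e1, e2] using h1

theorem integral_pow_six_le (hm : ∫ t, ‖v t‖ ^ 2 = 1) :
    ∫ t, ‖v t‖ ^ 6 ≤ 2 * √(∫ t, ‖g t‖ ^ 2) * ∫ t, ‖v t‖ ^ 4 := by
  rw [← integral_const_mul]
  refine integral_mono (h.integrable_pow hm 4) ((h.integrable_pow hm 2).const_mul _) fun t => ?_
  calc ‖v t‖ ^ 6 = ‖v t‖ ^ 2 * ‖v t‖ ^ 4 := by ring
    _ ≤ _ := by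
      exact mul_le_mul_of_nonneg_right (h.norm_sq_le hm t) (by positivity)

/-- The half-line from the median away from the origin carries mass `1/2`, all of it at distance at
least `|x₀|` from the origin. -/
theorem abs_median_rpow_le (hm : ∫ t, ‖v t‖ ^ 2 = 1) {s : ℝ} (hs : 0 < s)
    (hV : Integrable fun x => |x| ^ s * ‖v x‖ ^ 2) {x₀ : ℝ} (hx : massLeft v x₀ = 1 / 2) :
    |x₀| ^ s ≤ 2 * ∫ x, |x| ^ s * ‖v x‖ ^ 2 := by
  have key : ∀ A : Set ℝ, MeasurableSet A → (∀ x ∈ A, |x₀| ≤ |x|) →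
      ∫ x in A, ‖v x‖ ^ 2 = 1 / 2 → |x₀| ^ s ≤ 2 * ∫ x, |x| ^ s * ‖v x‖ ^ 2 := by
    intro A hA h1 h2
    have h3 : ∫ x in A, |x₀| ^ s * ‖v x‖ ^ 2 ≤ ∫ x in A, |x| ^ s * ‖v x‖ ^ 2 :=
      setIntegral_mono_on (h.integrable_sq.const_mul _).integrableOn hV.integrableOn hA
        fun x hx => mul_le_mul_of_nonneg_right
          (Real.rpow_le_rpow (abs_nonneg _) (h1 x hx) hs.le) (by positivity)
    have h4 : ∫ x in A, |x| ^ s * ‖v x‖ ^ 2 ≤ ∫ x, |x| ^ s * ‖v x‖ ^ 2 :=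
      setIntegral_le_integral hV (Eventually.of_forall fun x => by positivity)
    rw [integral_const_mul, h2] at h3
    linarith
  rcases le_total x₀ 0 with h0 | h0
  · refine key (Set.Iic x₀) measurableSet_Iic (fun x hx => ?_) hx
    have hx' : x ≤ x₀ := hx
    rw [abs_of_nonpos h0, abs_of_nonpos (hx'.trans h0)]
    linarith
  · refine key (Set.Ioi x₀) measurableSet_Ioi (fun x hx => ?_) ?_
    · have hx' : x₀ < x := hx
      rw [abs_of_nonneg h0, abs_of_nonneg (h0.trans hx'.le)]
      exact hx'.le
    · have h1 := intervalIntegral.integral_Iic_add_Ioi (b := x₀)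
        h.integrable_sq.integrableOn h.integrable_sq.integrableOn
      rw [massLeft] at hx
      linarith

theorem one_le_add_interval (hm : ∫ t, ‖v t‖ ^ 2 = 1) {s : ℝ} (hs : 0 < s)
    (hV : Integrable fun x => |x| ^ s * ‖v x‖ ^ 2) {R : ℝ} (hR : 0 < R) :
    1 ≤ (R ^ s)⁻¹ * (∫ x, |x| ^ s * ‖v x‖ ^ 2) + ∫ x in (-R)..R, ‖v x‖ ^ 2 := by
  rw [intervalIntegral.integral_of_le (by linarith), ← integral_indicator measurableSet_Ioc,
    ← integral_const_mul, ← integral_add (hV.const_mul _)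
      (h.integrable_sq.indicator measurableSet_Ioc), ← hm]
  refine integral_mono h.integrable_sq ((hV.const_mul _).add
    (h.integrable_sq.indicator measurableSet_Ioc)) fun x => ?_
  simp only
  have hRs : 0 < R ^ s := Real.rpow_pos_of_pos hR s
  by_cases hx : x ∈ Set.Ioc (-R) R
  · rw [Set.indicator_of_mem hx]
    exact le_add_of_nonneg_left (by positivity)
  · rw [Set.indicator_of_notMem hx, add_zero]
    have h1 : R ≤ |x| := by
      by_contra! hh
      exact hx ⟨(abs_lt.1 hh).1, (abs_lt.1 hh).2.le⟩
    have h2 := Real.rpow_le_rpow hR.le h1 hs.le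
    rw [← mul_assoc, inv_mul_eq_div]
    exact le_mul_of_one_le_left (by positivity) ((one_le_div hRs).2 h2)

end H1Rep

namespace CollapsingSeq

variable {s ζ e : ℝ} {μ β α : ℕ → ℝ} {v g : ℕ → ℝ → ℂ}

theorem potential_nonneg (s : ℝ) (v : ℝ → ℂ) : 0 ≤ ∫ x, |x| ^ s * ‖v x‖ ^ 2 :=
  integral_nonneg fun x => by positivity

/-- Two mechanisms are needed. For `ζ = 0` the quartic coefficient has a positive limit: the energy
bounds `∫|v|⁴`, and then `∫|v|⁶` through the sup bound and the deficit. For `ζ > 0` that coefficient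
may be negative, but `(∫|v|⁴)² ≤ ∫|v|⁶` lets the sextic term absorb it. -/
theorem eventually_le (H : CollapsingSeq s ζ e μ β α v g) (hs : 0 < s) (hζ : 0 ≤ ζ) :
    ∃ K, 0 ≤ K ∧ ∀ᶠ n in atTop, (∫ x, ‖v n x‖ ^ 6) ≤ K ∧
      μ n * gnDeficit (v n) (g n) + (∫ x, |x| ^ s * ‖v n x‖ ^ 2) ≤ K := by
  obtain ⟨E, hE1, hE2⟩ := H.energy
  have hQ := Qs_pos hs
  have hE3 : ∀ᶠ n in atTop, E n ≤ |e| + 1 :=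
    hE1.eventually_le_const (lt_of_le_of_lt (le_abs_self e) (by linarith))
  set M := |e| + 1 with hM
  have hM0 : 0 ≤ M := by positivity
  have hμ1 := H.tendsto_μ.eventually_ge_atTop 1
  rcases hζ.eq_or_lt with h0 | h0
  · set A := (6 - ζ) / 6 * Real.pi * Qs s with hA
    have hA0 : 0 < A := by rw [hA, ← h0]; have := Real.pi_pos; positivity
    have hα := H.tendsto_α.eventually_const_lt (u := A / 2) (by linarith)
    set Y := 4 * M / A with hY
    have hY0 : 0 ≤ Y := by positivity
    -- With `r = ‖g‖₂`, the deficit bound reads `r² ≤ M + (π²/2) Y r`; Young's inequality then gives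
    -- `r² ≤ S`.
    set S := 2 * M + (Real.pi ^ 2 / 2 * Y) ^ 2 with hS
    refine ⟨2 * √S * Y + M, by positivity, ?_⟩
    filter_upwards [hE3, hμ1, hα] with n h1 h2 h3
    have hd := (H.rep n).gnDeficit_nonneg (H.mass n)
    have hV := potential_nonneg s (v n)
    have hX0 : 0 ≤ ∫ x, ‖v n x‖ ^ 6 := integral_nonneg fun x => by positivity
    have hY1 : 0 ≤ ∫ x, ‖v n x‖ ^ 4 := integral_nonneg fun x => by positivity
    have hβX : 0 ≤ β n / 6 * ∫ x, ‖v n x‖ ^ 6 := by have := H.nonneg_β n; positivity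
    have hen := hE2 n
    rw [scaledEnergy] at hen
    have hμd : gnDeficit (v n) (g n) ≤ μ n * gnDeficit (v n) (g n) := le_mul_of_one_le_left hd h2
    have hαY : A / 4 * ∫ x, ‖v n x‖ ^ 4 ≤ α n / 2 * ∫ x, ‖v n x‖ ^ 4 := by
      exact mul_le_mul_of_nonneg_right (by linarith) hY1
    have hY2 : ∫ x, ‖v n x‖ ^ 4 ≤ Y := by
      rw [hY, le_div_iff₀ hA0]; linarith
    have hαY0 : 0 ≤ A / 4 * ∫ x, ‖v n x‖ ^ 4 := by positivity
    have hX := (H.rep n).integral_pow_six_le (H.mass n)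
    have hD : gnDeficit (v n) (g n) = (∫ t, ‖g n t‖ ^ 2) - Real.pi ^ 2 / 4 * ∫ t, ‖v n t‖ ^ 6 :=
      rfl
    set r := √(∫ t, ‖g n t‖ ^ 2) with hr
    have hr0 : 0 ≤ r := Real.sqrt_nonneg _
    have hr2 : r ^ 2 = ∫ t, ‖g n t‖ ^ 2 := Real.sq_sqrt (integral_nonneg fun x => by positivity)
    have hX2 : ∫ x, ‖v n x‖ ^ 6 ≤ 2 * r * Y := hX.trans (by gcongr)
    have hr3 : r ^ 2 ≤ M + Real.pi ^ 2 / 4 * (2 * r * Y) := by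
      have : Real.pi ^ 2 / 4 * (∫ x, ‖v n x‖ ^ 6) ≤ Real.pi ^ 2 / 4 * (2 * r * Y) := by gcongr
      linarith
    have hr4 : r ^ 2 ≤ S := by
      have := sq_nonneg (r - Real.pi ^ 2 / 2 * Y)
      rw [hS]
      nlinarith
    have hr5 : r ≤ √S := Real.le_sqrt_of_sq_le hr4
    refine ⟨?_, ?_⟩
    · calc _ ≤ 2 * r * Y := hX2
        _ ≤ 2 * √S * Y := by gcongr
        _ ≤ _ := by linarith
    · have : 0 ≤ 2 * √S * Y := by positivity
      linarith
  · set B := ζ * Qs s / 2 with hB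
    have hB0 : 0 < B := by positivity
    have hβ := H.tendsto_β.eventually_const_lt (u := B) (by rw [hB]; linarith [mul_pos h0 hQ])
    set A := |(6 - ζ) / 6 * Real.pi * Qs s| + 1 with hA
    have hA0 : 0 < A := by positivity
    have hα := H.tendsto_α.abs.eventually_le_const (u := A) (by rw [hA]; linarith)
    -- Young's inequality `(A/2) t ≤ (B/12) t² + 3A²/(4B)` spends half of the sextic coefficient
    -- `B/6` on the quartic term; solving for the sextic integral gives `K`.
    set K := 12 / B * (M + 3 * A ^ 2 / (4 * B)) with hK
    have hK0 : 0 ≤ K := by positivity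
    refine ⟨K + (M + B / 12 * K + 3 * A ^ 2 / (4 * B)), by positivity, ?_⟩
    filter_upwards [hE3, hμ1, hα, hβ] with n h1 h2 h3 h4
    have hd := (H.rep n).gnDeficit_nonneg (H.mass n)
    have hV := potential_nonneg s (v n)
    have hX0 : 0 ≤ ∫ x, ‖v n x‖ ^ 6 := integral_nonneg fun x => by positivity
    have hY1 : 0 ≤ ∫ x, ‖v n x‖ ^ 4 := integral_nonneg fun x => by positivity
    have hYX := (H.rep n).sq_integral_pow_four_le (H.mass n)
    have hen := hE2 n
    rw [scaledEnergy] at hen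
    have hμd : 0 ≤ μ n * gnDeficit (v n) (g n) := by positivity
    have hβX : B / 6 * (∫ x, ‖v n x‖ ^ 6) ≤ β n / 6 * ∫ x, ‖v n x‖ ^ 6 := by gcongr
    have hαY : -(A / 2 * ∫ x, ‖v n x‖ ^ 4) ≤ α n / 2 * ∫ x, ‖v n x‖ ^ 4 := by
      have := (abs_le.1 h3).1
      nlinarith
    have hYb : A / 2 * (∫ x, ‖v n x‖ ^ 4) ≤
        B / 12 * (∫ x, ‖v n x‖ ^ 6) + 3 * A ^ 2 / (4 * B) := by
      have k1 : A / 2 * (∫ x, ‖v n x‖ ^ 4) ≤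
          B / 12 * (∫ x, ‖v n x‖ ^ 4) ^ 2 + 3 * A ^ 2 / (4 * B) := by
        have k2 := sq_nonneg (B * (∫ x, ‖v n x‖ ^ 4) - 3 * A)
        have k3 : B / 12 * (∫ x, ‖v n x‖ ^ 4) ^ 2 + 3 * A ^ 2 / (4 * B) -
            A / 2 * (∫ x, ‖v n x‖ ^ 4) = (B * (∫ x, ‖v n x‖ ^ 4) - 3 * A) ^ 2 / (12 * B) := by
          field_simp; ring
        have k4 : 0 ≤ (B * (∫ x, ‖v n x‖ ^ 4) - 3 * A) ^ 2 / (12 * B) := by positivity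
        linarith
      have : B / 12 * (∫ x, ‖v n x‖ ^ 4) ^ 2 ≤ B / 12 * ∫ x, ‖v n x‖ ^ 6 := by gcongr
      linarith
    have hXK : ∫ x, ‖v n x‖ ^ 6 ≤ K := by
      rw [hK, div_mul_eq_mul_div, le_div_iff₀ hB0]
      linarith
    have hBX : B / 12 * (∫ x, ‖v n x‖ ^ 6) ≤ B / 12 * K := by gcongr
    have hBX0 : 0 ≤ B / 6 * (∫ x, ‖v n x‖ ^ 6) := by positivity
    have : 0 ≤ B / 12 * K := by positivity
    have : 0 ≤ 3 * A ^ 2 / (4 * B) := by positivity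
    exact ⟨by linarith, by linarith⟩

theorem tendsto_gnDeficit (H : CollapsingSeq s ζ e μ β α v g) (hs : 0 < s) (hζ : 0 ≤ ζ) :
    Tendsto (fun n => gnDeficit (v n) (g n)) atTop (𝓝 0) := by
  obtain ⟨K, hK0, hK⟩ := H.eventually_le hs hζ
  refine tendsto_of_tendsto_of_tendsto_of_le_of_le' tendsto_const_nhds
    (H.tendsto_μ.const_div_atTop K)
    (Eventually.of_forall fun n => (H.rep n).gnDeficit_nonneg (H.mass n)) ?_
  filter_upwards [hK, H.tendsto_μ.eventually_gt_atTop 0] with n h1 h2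
  rw [le_div_iff₀ h2]
  have := potential_nonneg s (v n)
  linarith [h1.2]

theorem exists_bounds (H : CollapsingSeq s ζ e μ β α v g) (hs : 0 < s) (hζ : 0 ≤ ζ) :
    ∃ S K N, ∀ n, N ≤ n → (∫ x, ‖g n x‖ ^ 2) ≤ S ∧ (∫ x, |x| ^ s * ‖v n x‖ ^ 2) ≤ K := by
  obtain ⟨K, hK0, hK⟩ := H.eventually_le hs hζ
  have hd := (H.tendsto_gnDeficit hs hζ).eventually_le_const one_pos
  obtain ⟨N, hN⟩ := eventually_atTop.1 ((hK.and hd).and (H.tendsto_μ.eventually_ge_atTop 0))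
  refine ⟨1 + Real.pi ^ 2 / 4 * K, K, N, fun n hn => ?_⟩
  obtain ⟨⟨⟨h1, h2⟩, h3⟩, h4⟩ := hN n hn
  have hd := (H.rep n).gnDeficit_nonneg (H.mass n)
  constructor
  · have : Real.pi ^ 2 / 4 * (∫ x, ‖v n x‖ ^ 6) ≤ Real.pi ^ 2 / 4 * K := by gcongr
    rw [gnDeficit] at h3
    linarith
  · have : 0 ≤ μ n * gnDeficit (v n) (g n) := mul_nonneg h4 hd
    linarith

/-- Compactness: a subsequence converges pointwise to an optimizer. -/
theorem exists_subseq (H : CollapsingSeq s ζ e μ β α v g) (hs : 0 < s) (hζ : 0 ≤ ζ) :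
    ∃ (φ : ℕ → ℕ) (c : ℂ) (y S : ℝ), Tendsto φ atTop atTop ∧ c ≠ 0 ∧
      (∀ n, ∫ x, ‖g (φ n) x‖ ^ 2 ≤ S) ∧
      ∀ t, Tendsto (fun n => v (φ n) t) atTop (𝓝 (gnProfile c y t)) := by
  obtain ⟨S, K, N, hSK⟩ := H.exists_bounds hs hζ
  choose x hx using fun n => (H.rep n).exists_massLeft_eq (H.mass n) (m := 1 / 2) (by norm_num)
    (by norm_num)
  -- Compactness is needed only for the pair formed by the median and the value there. The shift by
  -- `N` makes the eventual bounds hold at every index.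
  set z : ℕ → ℝ × ℂ := fun n => (x (n + N), v (n + N) (x (n + N))) with hz
  have hbound : ∀ n, z n ∈ Metric.closedBall (0 : ℝ) ((2 * K) ^ (1 / s)) ×ˢ
      Metric.closedBall (0 : ℂ) (√(2 * √S)) := fun n => by
    obtain ⟨h1, h2⟩ := hSK (n + N) (Nat.le_add_left _ _)
    constructor
    · rw [mem_closedBall_zero_iff, Real.norm_eq_abs]
      have h3 := ((H.rep _).abs_median_rpow_le (H.mass _) hs (H.pot _) (hx (n + N))).trans
        (mul_le_mul_of_nonneg_left h2 two_pos.le)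
      have h4 := Real.rpow_le_rpow (by positivity) h3 (one_div_pos.2 hs).le
      rwa [← Real.rpow_mul (abs_nonneg _), mul_one_div_cancel hs.ne', Real.rpow_one] at h4
    · rw [mem_closedBall_zero_iff]
      refine Real.le_sqrt_of_sq_le (((H.rep _).norm_sq_le (H.mass _) _).trans ?_)
      gcongr
  obtain ⟨⟨y, c⟩, -, φ, hφ, hlim⟩ :=
    ((isCompact_closedBall _ _).prod (isCompact_closedBall _ _)).tendsto_subseq hbound
  have hψ : Tendsto (fun n => φ n + N) atTop atTop :=
    tendsto_atTop_mono (fun n => Nat.le_add_right (φ n) N) hφ.tendsto_atTop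
  have hpt := tendsto_gnProfile (v := fun n => v (φ n + N)) (g := fun n => g (φ n + N))
    (x := fun n => x (φ n + N)) (y := y) (c := c) (S := S) (fun n => H.rep _) (fun n => H.mass _)
    (fun n => (hSK _ (Nat.le_add_left _ _)).1) ((H.tendsto_gnDeficit hs hζ).comp hψ)
    (fun n => hx _) ((continuous_fst.tendsto _).comp hlim) ((continuous_snd.tendsto _).comp hlim)
  refine ⟨fun n => φ n + N, c, y, S, hψ, fun hc => ?_,
    fun n => (hSK _ (Nat.le_add_left _ _)).1, hpt⟩
  have hK0 : 0 ≤ K := (potential_nonneg s (v N)).trans (hSK N le_rfl).2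
  -- With `R ^ s = 4K + 1` at most a quarter of the mass lies outside `[-R, R]`. If `c = 0`, the
  -- mass inside would tend to zero by dominated convergence, contradicting unit mass.
  set R := (4 * K + 1) ^ (1 / s) with hR
  have hR0 : 0 < R := Real.rpow_pos_of_pos (by linarith) _
  have hRs : R ^ s = 4 * K + 1 := by
    rw [hR, ← Real.rpow_mul (by linarith), one_div_mul_cancel hs.ne', Real.rpow_one]
  have hint : Tendsto (fun n => ∫ t in (-R)..R, ‖v (φ n + N) t‖ ^ 2) atTop
      (𝓝 (∫ t in (-R)..R, (0 : ℝ))) := by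
    refine intervalIntegral.tendsto_integral_filter_of_dominated_convergence
      (fun _ => 2 * √S) (Eventually.of_forall fun n => ?_) (Eventually.of_forall fun n => ?_)
      (by simp) (Eventually.of_forall fun t _ => ?_)
    · exact ((H.rep _).continuous.norm.pow 2).aestronglyMeasurable
    · refine Eventually.of_forall fun t _ => ?_
      rw [Real.norm_of_nonneg (by positivity)]
      refine ((H.rep _).norm_sq_le (H.mass _) _).trans ?_
      gcongr
      exact (hSK _ (Nat.le_add_left _ _)).1
    · have h1 := (hpt t).norm.pow 2
      rw [hc, norm_gnProfile, norm_zero, zero_mul, zero_pow two_ne_zero] at h1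
      exact h1
  rw [intervalIntegral.integral_zero] at hint
  obtain ⟨n, hn⟩ := (hint.eventually_lt_const (show (0 : ℝ) < 1 / 2 by norm_num)).exists
  have h1 := (H.rep (φ n + N)).one_le_add_interval (H.mass _) hs (H.pot _) hR0
  have h2 : (R ^ s)⁻¹ * (∫ x, |x| ^ s * ‖v (φ n + N) x‖ ^ 2) ≤ 1 / 4 := by
    rw [inv_mul_eq_div, hRs, div_le_iff₀ (by linarith)]
    have := (hSK (φ n + N) (Nat.le_add_left _ _)).2
    linarith
  linarith

end CollapsingSeq

/-! ### From pointwise convergence to convergence of the integrals -/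

theorem integrable_Q0 : Integrable Q0 := by
  refine integrable_of_even Q0_neg ?_
  refine Integrable.mono' ((integrableOn_exp_mul_Ioi (a := -(Real.pi / 2))
    (by linarith [Real.pi_pos]) 0).const_mul 2)
    continuous_Q0.aestronglyMeasurable (Eventually.of_forall fun x => ?_)
  rw [Real.norm_of_nonneg (Q0_pos x).le]
  apply le_of_sq_le_sq _ (by positivity)
  refine (Q0_sq_le x).trans ?_
  rw [mul_pow, ← Real.exp_nat_mul]
  have : ((2 : ℕ) : ℝ) * (-(Real.pi / 2) * x) = -Real.pi * x := by push_cast; ring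
  rw [this]
  have := Real.exp_pos (-Real.pi * x)
  linarith

theorem integrable_norm_gnProfile {c : ℂ} (hc : c ≠ 0) (y : ℝ) :
    Integrable fun x => ‖gnProfile c y x‖ := by
  have hc' : 0 < ‖c‖ := norm_pos_iff.2 hc
  simp only [norm_gnProfile]
  exact ((integrable_Q0.comp_mul_left' (pow_pos hc' 2).ne').comp_sub_right y).const_mul _

theorem integral_norm_gnProfile_sq {c : ℂ} (hc : c ≠ 0) (y : ℝ) :
    ∫ x, ‖gnProfile c y x‖ ^ 2 = 1 := by
  rw [integral_norm_gnProfile_pow hc y 0, pow_zero, one_mul, integral_Q0_sq]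

theorem memLp_gnProfile {c : ℂ} (hc : c ≠ 0) (y : ℝ) : MemLp (gnProfile c y) 2 volume :=
  (memLp_two_iff_integrable_sq_norm (continuous_gnProfile c y).aestronglyMeasurable).2
    (integrable_norm_gnProfile_pow hc y 0)

theorem norm_sub_sq_eq (v p : ℝ → ℂ) (x : ℝ) :
    ‖v x - p x‖ ^ 2 = ‖v x‖ ^ 2 + ‖p x‖ ^ 2 - 2 * halfDensityDeriv v p x := by
  rw [norm_sq_eq, norm_sq_eq, norm_sq_eq, halfDensityDeriv, Complex.sub_re, Complex.sub_im]
  ring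

theorem continuous_halfDensityDeriv {v p : ℝ → ℂ} (hv : Continuous v) (hp : Continuous p) :
    Continuous (halfDensityDeriv v p) :=
  ((Complex.continuous_re.comp hv).mul (Complex.continuous_re.comp hp)).add
    ((Complex.continuous_im.comp hv).mul (Complex.continuous_im.comp hp))

section Limits

variable {v g : ℕ → ℝ → ℂ} {c : ℂ} {y S : ℝ}

theorem norm_le_of_deriv_bound (h : ∀ n, H1Rep (v n) (g n)) (hm : ∀ n, ∫ t, ‖v n t‖ ^ 2 = 1)
    (hS : ∀ n, ∫ t, ‖g n t‖ ^ 2 ≤ S) (n : ℕ) (x : ℝ) : ‖v n x‖ ≤ √(2 * √S) := by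
  refine Real.le_sqrt_of_sq_le (((h n).norm_sq_le (hm n) x).trans ?_)
  gcongr
  exact hS n

/-- All masses equal one, so only the cross term must converge; it is dominated by the uniform sup
bound times the integrable function `‖p‖`. -/
theorem tendsto_integral_norm_sub_sq (h : ∀ n, H1Rep (v n) (g n))
    (hm : ∀ n, ∫ t, ‖v n t‖ ^ 2 = 1) (hS : ∀ n, ∫ t, ‖g n t‖ ^ 2 ≤ S) (hc : c ≠ 0)
    (hp : ∀ t, Tendsto (fun n => v n t) atTop (𝓝 (gnProfile c y t))) :
    Tendsto (fun n => ∫ x, ‖v n x - gnProfile c y x‖ ^ 2) atTop (𝓝 0) := by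
  set p := gnProfile c y with hpdef
  have hpc : Continuous p := continuous_gnProfile c y
  have hM := norm_le_of_deriv_bound h hm hS
  have hb : ∀ n x, ‖halfDensityDeriv (v n) p x‖ ≤ √(2 * √S) * ‖p x‖ := fun n x => by
    rw [Real.norm_eq_abs]
    refine (abs_halfDensityDeriv_le _ _ x).trans ?_
    gcongr
    exact hM n x
  have hbi : Integrable fun x => √(2 * √S) * ‖p x‖ := (integrable_norm_gnProfile hc y).const_mul _
  have h1 : Tendsto (fun n => ∫ x, halfDensityDeriv (v n) p x) atTop
      (𝓝 (∫ x, halfDensityDeriv p p x)) := by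
    refine tendsto_integral_of_dominated_convergence _
      (fun n => (continuous_halfDensityDeriv (h n).continuous hpc).aestronglyMeasurable) hbi
      (fun n => Eventually.of_forall (hb n)) (Eventually.of_forall fun x => ?_)
    have k1 := (Complex.continuous_re.tendsto _).comp (hp x)
    have k2 := (Complex.continuous_im.tendsto _).comp (hp x)
    exact (k1.mul_const (p x).re).add (k2.mul_const (p x).im)
  have h2 : ∫ x, halfDensityDeriv p p x = 1 := by
    rw [← integral_norm_gnProfile_sq hc y]
    refine integral_congr_ae (Eventually.of_forall fun x => ?_)
    simp only [halfDensityDeriv, norm_sq_eq, hpdef]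
    ring
  have h3 : ∀ n, ∫ x, ‖v n x - p x‖ ^ 2 = 2 - 2 * ∫ x, halfDensityDeriv (v n) p x := fun n => by
    have i1 := (h n).integrable_sq
    have i2 : Integrable fun x => ‖p x‖ ^ 2 := integrable_norm_gnProfile_pow hc y 0
    have i3 : Integrable (halfDensityDeriv (v n) p) := hbi.mono'
      (continuous_halfDensityDeriv (h n).continuous hpc).aestronglyMeasurable
      (Eventually.of_forall (hb n))
    have i4 : Integrable fun x => ‖v n x‖ ^ 2 + ‖p x‖ ^ 2 := i1.add i2
    simp only [norm_sub_sq_eq]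
    rw [integral_sub i4 (i3.const_mul 2), integral_add i1 i2,
      integral_const_mul, hm n, integral_norm_gnProfile_sq hc y]
    norm_num
  simp only [h3]
  have h4 := (tendsto_const_nhds (x := (2 : ℝ))).sub (h1.const_mul 2)
  rwa [h2, mul_one, sub_self] at h4

/-- The difference of the powers is at most `(k+2) M^k ‖v - p‖ (‖v‖ + ‖p‖)`. One factor is left
unbounded by `M` so that Cauchy-Schwarz and `L²` convergence apply on the whole line. -/
theorem tendsto_integral_norm_pow (h : ∀ n, H1Rep (v n) (g n))
    (hm : ∀ n, ∫ t, ‖v n t‖ ^ 2 = 1) (hS : ∀ n, ∫ t, ‖g n t‖ ^ 2 ≤ S) (hc : c ≠ 0)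
    (hp : ∀ t, Tendsto (fun n => v n t) atTop (𝓝 (gnProfile c y t))) (k : ℕ) :
    Tendsto (fun n => ∫ x, ‖v n x‖ ^ (k + 2)) atTop
      (𝓝 (∫ x, ‖gnProfile c y x‖ ^ (k + 2))) := by
  have hL2 := tendsto_integral_norm_sub_sq h hm hS hc hp
  set p := gnProfile c y with hpdef
  have hpc : Continuous p := continuous_gnProfile c y
  set M := √(2 * √S) with hMdef
  have hM := norm_le_of_deriv_bound h hm hS
  have hMp : ∀ x, ‖p x‖ ≤ M := fun x =>
    le_of_tendsto (hp x).norm (Eventually.of_forall fun n => hM n x)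
  have hpi : Integrable fun x => ‖p x‖ ^ 2 := integrable_norm_gnProfile_pow hc y 0
  rw [tendsto_iff_norm_sub_tendsto_zero]
  refine squeeze_zero (g := fun n => (k + 2) * M ^ k * (√(∫ x, ‖v n x - p x‖ ^ 2) * √4))
    (fun n => norm_nonneg _) (fun n => ?_) ?_
  · have hvL := (h n).memLp
    have hpL := memLp_gnProfile hc y
    have j1 : Integrable fun x => ‖v n x - p x‖ * (‖v n x‖ + ‖p x‖) :=
      (hvL.sub hpL).norm.integrable_mul (hvL.norm.add hpL.norm)
    have j2 : Integrable fun x => ‖v n x - p x‖ ^ 2 := by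
      exact (memLp_two_iff_integrable_sq_norm (hvL.sub hpL).1).1 (hvL.sub hpL)
    have j3 : Integrable fun x => (‖v n x‖ + ‖p x‖) ^ 2 :=
      (hvL.norm.add hpL.norm).integrable_sq
    have hcs := sq_integral_mul_le j2 j3 j1
    have h4 : ∫ x, (‖v n x‖ + ‖p x‖) ^ 2 ≤ 4 := by
      calc ∫ x, (‖v n x‖ + ‖p x‖) ^ 2 ≤ ∫ x, (2 * ‖v n x‖ ^ 2 + 2 * ‖p x‖ ^ 2) :=
            integral_mono j3 (((h n).integrable_sq.const_mul 2).add (hpi.const_mul 2))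
              fun x => by nlinarith [sq_nonneg (‖v n x‖ - ‖p x‖)]
        _ = 4 := by
            rw [integral_add ((h n).integrable_sq.const_mul 2) (hpi.const_mul 2),
              integral_const_mul, integral_const_mul, hm n, integral_norm_gnProfile_sq hc y]
            norm_num
    have h5 : ∫ x, ‖v n x - p x‖ * (‖v n x‖ + ‖p x‖) ≤ √(∫ x, ‖v n x - p x‖ ^ 2) * √4 := by
      rw [← Real.sqrt_mul (integral_nonneg fun x => by positivity)]
      refine Real.le_sqrt_of_sq_le (hcs.trans ?_)
      exact mul_le_mul_of_nonneg_left h4 (integral_nonneg fun x => by positivity)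
    rw [← integral_sub ((h n).integrable_pow (hm n) k) (integrable_norm_gnProfile_pow hc y k)]
    refine (norm_integral_le_integral_norm _).trans ?_
    calc ∫ x, ‖‖v n x‖ ^ (k + 2) - ‖p x‖ ^ (k + 2)‖
        ≤ ∫ x, (k + 2) * M ^ k * (‖v n x - p x‖ * (‖v n x‖ + ‖p x‖)) := by
          refine integral_mono (((h n).integrable_pow (hm n) k).sub
            (integrable_norm_gnProfile_pow hc y k)).norm (j1.const_mul _) fun x => ?_
          have h6 := abs_pow_sub_pow_le ‖v n x‖ ‖p x‖ (k + 2)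
          rw [abs_norm, abs_norm] at h6
          have h7 : max ‖v n x‖ ‖p x‖ ^ (k + 2 - 1) ≤ M ^ k * (‖v n x‖ + ‖p x‖) := by
            rw [show k + 2 - 1 = k + 1 from rfl, pow_succ]
            have := norm_nonneg (v n x)
            have := norm_nonneg (p x)
            have h8 : max ‖v n x‖ ‖p x‖ ≤ M := max_le (hM n x) (hMp x)
            have h9 : max ‖v n x‖ ‖p x‖ ≤ ‖v n x‖ + ‖p x‖ := max_le (by linarith) (by linarith)
            gcongr
          have h10 := abs_norm_sub_norm_le (v n x) (p x)
          rw [Real.norm_eq_abs]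
          calc _ ≤ |‖v n x‖ - ‖p x‖| * ((k + 2 : ℕ) : ℝ) * max ‖v n x‖ ‖p x‖ ^ (k + 2 - 1) := h6
            _ ≤ ‖v n x - p x‖ * ((k + 2 : ℕ) : ℝ) * (M ^ k * (‖v n x‖ + ‖p x‖)) := by gcongr
            _ = _ := by push_cast; ring
      _ = (k + 2) * M ^ k * ∫ x, ‖v n x - p x‖ * (‖v n x‖ + ‖p x‖) := integral_const_mul _ _
      _ ≤ _ := by gcongr
  · simpa using ((hL2.sqrt).mul_const (√4)).const_mul ((k + 2) * M ^ k)

theorem integral_potential_le_of_tendsto {s W : ℝ} {w : ℕ → ℝ} {p : ℝ → ℂ}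
    (hv : ∀ n, Continuous (v n)) (hs : 0 ≤ s)
    (hV : ∀ n, Integrable fun x => |x| ^ s * ‖v n x‖ ^ 2)
    (hP : Integrable fun x => |x| ^ s * ‖p x‖ ^ 2)
    (hp : ∀ t, Tendsto (fun n => v n t) atTop (𝓝 (p t)))
    (hw : Tendsto w atTop (𝓝 W)) (hle : ∀ n, ∫ x, |x| ^ s * ‖v n x‖ ^ 2 ≤ w n) :
    ∫ x, |x| ^ s * ‖p x‖ ^ 2 ≤ W := by
  have hW : 0 ≤ W := ge_of_tendsto hw (Eventually.of_forall fun n =>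
    (integral_nonneg fun x => by positivity).trans (hle n))
  rw [← ENNReal.ofReal_le_ofReal_iff hW,
    ofReal_integral_eq_lintegral_ofReal hP (Eventually.of_forall fun x => by positivity)]
  have h1 : ∀ x, liminf (fun n => ENNReal.ofReal (|x| ^ s * ‖v n x‖ ^ 2)) atTop =
      ENNReal.ofReal (|x| ^ s * ‖p x‖ ^ 2) := fun x =>
    (ENNReal.tendsto_ofReal (((hp x).norm.pow 2).const_mul (|x| ^ s))).liminf_eq
  calc ∫⁻ x, ENNReal.ofReal (|x| ^ s * ‖p x‖ ^ 2)
      = ∫⁻ x, liminf (fun n => ENNReal.ofReal (|x| ^ s * ‖v n x‖ ^ 2)) atTop := by simp only [h1]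
    _ ≤ liminf (fun n => ∫⁻ x, ENNReal.ofReal (|x| ^ s * ‖v n x‖ ^ 2)) atTop :=
        lintegral_liminf_le fun n => (((continuous_abs_rpow hs).mul
          ((hv n).norm.pow 2)).measurable).ennreal_ofReal
    _ ≤ liminf (fun n => ENNReal.ofReal (w n)) atTop := by
        refine liminf_le_liminf (Eventually.of_forall fun n => ?_)
        rw [← ofReal_integral_eq_lintegral_ofReal (hV n)
          (Eventually.of_forall fun x => by positivity)]
        exact ENNReal.ofReal_le_ofReal (hle n)
    _ = ENNReal.ofReal W := (ENNReal.tendsto_ofReal hw).liminf_eq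

end Limits

/-- Integration by parts against the derivative of `Q0`. -/
theorem H1Rep.integral_re_mul_derivQ0 {v g : ℝ → ℂ} (h : H1Rep v g)
    (hm : ∫ t, ‖v t‖ ^ 2 = 1) :
    ∫ x, (g x).re * derivQ0 x = -∫ x, (v x).re * (Real.pi ^ 2 / 4 * (Q0 x - 3 * Q0 x ^ 5)) := by
  set M := √(2 * √(∫ t, ‖g t‖ ^ 2)) with hMdef
  have hM : ∀ x, |(v x).re| ≤ M := fun x =>
    (Complex.abs_re_le_norm _).trans (Real.le_sqrt_of_sq_le (h.norm_sq_le hm x))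
  have hQd : MemLp derivQ0 2 volume :=
    (memLp_two_iff_integrable_sq continuous_derivQ0.aestronglyMeasurable).2 integrable_derivQ0_sq
  have hgr : MemLp (fun x => (g x).re) 2 volume := h.memLp'.re
  have i1 : Integrable fun x => (g x).re * derivQ0 x := hgr.integrable_mul hQd
  have hQc : Continuous fun x => Real.pi ^ 2 / 4 * (Q0 x - 3 * Q0 x ^ 5) :=
    (continuous_Q0.sub ((continuous_Q0.pow 5).const_mul 3)).const_mul _
  have hQi : Integrable fun x => Real.pi ^ 2 / 4 * (Q0 x - 3 * Q0 x ^ 5) :=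
    (integrable_Q0.sub ((integrable_Q0_pow 3).const_mul 3)).const_mul _
  have i2 : Integrable fun x => (v x).re * (Real.pi ^ 2 / 4 * (Q0 x - 3 * Q0 x ^ 5)) := by
    refine (hQi.norm.const_mul M).mono'
      ((Complex.continuous_re.comp h.continuous).mul hQc).aestronglyMeasurable
      (Eventually.of_forall fun x => ?_)
    rw [norm_mul, Real.norm_eq_abs (v x).re]
    gcongr
    exact hM x
  have hprod : ∀ a b, HasACDeriv (fun x => (v x).re * derivQ0 x)
      (fun x => (g x).re * derivQ0 x + (v x).re * (Real.pi ^ 2 / 4 * (Q0 x - 3 * Q0 x ^ 5)))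
      a b := fun a b =>
    ((h.hasACDeriv a b).clm_comp Complex.reCLM).mul
      (HasACDeriv.of_hasDerivAt (fun x _ => hasDerivAt_derivQ0 x) hQc.continuousOn)
  -- The boundary terms vanish since `v` is bounded and `|Q₀'| ≤ (π/2) Q₀`.
  have hzero : ∀ {l : Filter ℝ}, Tendsto (fun x => Q0 x ^ 2) l (𝓝 0) →
      Tendsto (fun x => (v x).re * derivQ0 x) l (𝓝 0) := fun {l} hl => by
    have hl1 := hl.sqrt
    simp only [Real.sqrt_sq (Q0_pos _).le, Real.sqrt_zero] at hl1
    have hl2 := hl1.const_mul (M * (Real.pi / 2))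
    rw [mul_zero] at hl2
    refine squeeze_zero_norm (fun x => ?_) hl2
    rw [derivQ0, norm_mul, norm_mul, norm_mul, Real.norm_eq_abs, Real.norm_of_nonneg (Q0_pos x).le,
      Real.norm_of_nonneg (by have := Real.pi_pos; positivity : (0 : ℝ) ≤ Real.pi / 2), mul_assoc M]
    have h1 : ‖Real.cos (Real.pi * gnProfileMass 1 0 x)‖ ≤ 1 := Real.abs_cos_le_one _
    have h2 := Real.pi_pos
    have h3 := (Q0_pos x).le
    refine mul_le_mul (hM x) ?_ (by positivity) (Real.sqrt_nonneg _)
    exact mul_le_mul_of_nonneg_right (mul_le_of_le_one_right (by positivity) h1) h3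
  have i3 : Integrable fun x => (g x).re * derivQ0 x +
      (v x).re * (Real.pi ^ 2 / 4 * (Q0 x - 3 * Q0 x ^ 5)) := i1.add i2
  have h1 := intervalIntegral_tendsto_integral i3 tendsto_neg_atTop_atBot tendsto_id
  have h2 := ((hzero tendsto_Q0_sq_atTop).sub
      ((hzero tendsto_Q0_sq_atBot).comp tendsto_neg_atTop_atBot)).congr fun R =>
    (hprod (-R) R).integral_eq_sub.symm
  have h3 := tendsto_nhds_unique h1 h2
  rw [integral_add i1 i2, sub_zero] at h3
  exact eq_neg_of_add_eq_zero_left h3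

theorem gnProfile_one (x : ℝ) : gnProfile 1 0 x = (Q0 x : ℂ) := by simp [gnProfile]

/-- Convergence of the derivatives, from pointwise convergence and convergence of their norms. -/
theorem tendsto_integral_deriv_sub_sq {v g : ℕ → ℝ → ℂ} {S : ℝ} (h : ∀ n, H1Rep (v n) (g n))
    (hm : ∀ n, ∫ t, ‖v n t‖ ^ 2 = 1) (hS : ∀ n, ∫ t, ‖g n t‖ ^ 2 ≤ S)
    (hp : ∀ t, Tendsto (fun n => v n t) atTop (𝓝 (Q0 t : ℂ)))
    (hd : Tendsto (fun n => gnDeficit (v n) (g n)) atTop (𝓝 0)) :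
    Tendsto (fun n => ∫ x, ‖g n x - (derivQ0 x : ℂ)‖ ^ 2) atTop (𝓝 0) := by
  have hM := norm_le_of_deriv_bound h hm hS
  have hp' : ∀ t, Tendsto (fun n => v n t) atTop (𝓝 (gnProfile 1 0 t)) := fun t => by
    rw [gnProfile_one]; exact hp t
  have h6 := tendsto_integral_norm_pow h hm hS one_ne_zero hp' 4
  rw [integral_norm_gnProfile_pow one_ne_zero 0 4, norm_one, one_pow, one_mul,
    integral_Q0_pow_six] at h6
  -- The kinetic energy is the deficit plus `(π²/4)∫‖v‖⁶`, so it converges to that of `Q₀`.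
  have hg : Tendsto (fun n => ∫ x, ‖g n x‖ ^ 2) atTop (𝓝 (Real.pi ^ 2 / 8)) := by
    have h1 := hd.add (h6.const_mul (Real.pi ^ 2 / 4))
    have h2 : 0 + Real.pi ^ 2 / 4 * (1 / 2) = Real.pi ^ 2 / 8 := by ring
    rw [h2] at h1
    refine h1.congr fun n => ?_
    rw [gnDeficit]; ring
  have hmQ : ∫ t, ‖(Q0 t : ℂ)‖ ^ 2 = 1 := by
    simp only [Complex.norm_real, Real.norm_eq_abs, sq_abs]; exact integral_Q0_sq
  have hQi : Integrable fun x => Real.pi ^ 2 / 4 * (Q0 x - 3 * Q0 x ^ 5) :=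
    (integrable_Q0.sub ((integrable_Q0_pow 3).const_mul 3)).const_mul _
  have hQc : Continuous fun x => Real.pi ^ 2 / 4 * (Q0 x - 3 * Q0 x ^ 5) :=
    (continuous_Q0.sub ((continuous_Q0.pow 5).const_mul 3)).const_mul _
  -- Moving the derivative onto `Q₀'` leaves the pairing of `v n` with `Q₀''`, to which dominated
  -- convergence applies; the same identity for `Q₀` itself identifies the limit.
  have hcross : Tendsto (fun n => ∫ x, (g n x).re * derivQ0 x) atTop (𝓝 (Real.pi ^ 2 / 8)) := by
    have h1 : ∫ x, ((derivQ0 x : ℂ)).re * derivQ0 x = Real.pi ^ 2 / 8 := by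
      rw [← integral_derivQ0_sq]
      refine integral_congr_ae (Eventually.of_forall fun x => ?_)
      simp only [Complex.ofReal_re]; ring
    rw [← h1, h1Rep_Q0.integral_re_mul_derivQ0 hmQ]
    simp only [fun n => (h n).integral_re_mul_derivQ0 (hm n)]
    refine Tendsto.neg (tendsto_integral_of_dominated_convergence
      (fun x => √(2 * √S) * ‖Real.pi ^ 2 / 4 * (Q0 x - 3 * Q0 x ^ 5)‖)
      (fun n => ((Complex.continuous_re.comp (h n).continuous).mul hQc).aestronglyMeasurable)
      (hQi.norm.const_mul _) (fun n => Eventually.of_forall fun x => ?_)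
      (Eventually.of_forall fun x => ?_))
    · rw [norm_mul, Real.norm_eq_abs (v n x).re]
      gcongr
      exact (Complex.abs_re_le_norm _).trans (hM n x)
    · exact ((Complex.continuous_re.tendsto _).comp (hp x)).mul_const _
  have heq : ∀ n, ∫ x, ‖g n x - (derivQ0 x : ℂ)‖ ^ 2 =
      (∫ x, ‖g n x‖ ^ 2) + Real.pi ^ 2 / 8 - 2 * ∫ x, (g n x).re * derivQ0 x := fun n => by
    have e1 : ∀ x, ‖g n x - (derivQ0 x : ℂ)‖ ^ 2 =
        ‖g n x‖ ^ 2 + derivQ0 x ^ 2 - 2 * ((g n x).re * derivQ0 x) := fun x => by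
      rw [norm_sq_eq, norm_sq_eq]; simp; ring
    have hQd : MemLp derivQ0 2 volume :=
      (memLp_two_iff_integrable_sq continuous_derivQ0.aestronglyMeasurable).2
        integrable_derivQ0_sq
    have hgr : MemLp (fun x => (g n x).re) 2 volume := (h n).memLp'.re
    have i1 : Integrable fun x => (g n x).re * derivQ0 x := hgr.integrable_mul hQd
    have i2 : Integrable fun x => ‖g n x‖ ^ 2 + derivQ0 x ^ 2 :=
      (h n).integrable_deriv_sq.add integrable_derivQ0_sq
    simp only [e1]
    rw [integral_sub i2 (i1.const_mul 2),
      integral_add (h n).integrable_deriv_sq integrable_derivQ0_sq, integral_const_mul,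
      integral_derivQ0_sq]
  simp only [heq]
  have h1 := (hg.add_const (Real.pi ^ 2 / 8)).sub (hcross.const_mul 2)
  have h2 : Real.pi ^ 2 / 8 + Real.pi ^ 2 / 8 - 2 * (Real.pi ^ 2 / 8) = 0 := by ring
  rwa [h2] at h1

/-! ### Lower bound and convergence of collapsing sequences -/

namespace CollapsingSeq

variable {s ζ e : ℝ} {μ β α : ℕ → ℝ} {v g : ℕ → ℝ → ℂ}

/-- The nonnegative deficit term is dropped, the quartic and sextic terms converge, and the
potential is lower semicontinuous by Fatou. -/
theorem limitEnergy_le {c : ℂ} {y S : ℝ} (H : CollapsingSeq s ζ e μ β α v g) (hs : 0 < s)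
    (hμ : ∀ n, 0 ≤ μ n) (hc : c ≠ 0) (hS : ∀ n, ∫ x, ‖g n x‖ ^ 2 ≤ S)
    (hp : ∀ t, Tendsto (fun n => v n t) atTop (𝓝 (gnProfile c y t))) :
    limitEnergy s ζ c y ≤ e := by
  obtain ⟨E, hE1, hE2⟩ := H.energy
  have h6 := tendsto_integral_norm_pow H.rep H.mass hS hc hp 4
  have h4 := tendsto_integral_norm_pow H.rep H.mass hS hc hp 2
  have hw := (hE1.sub ((H.tendsto_β.div_const 6).mul h6)).sub ((H.tendsto_α.div_const 2).mul h4)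
  have h1 := integral_potential_le_of_tendsto (fun n => (H.rep n).continuous) hs.le H.pot
    (integrable_potential_gnProfile hs.le hc y) hp hw (fun n => by
      have h2 := hE2 n
      rw [scaledEnergy] at h2
      have h3 : 0 ≤ μ n * gnDeficit (v n) (g n) :=
        mul_nonneg (hμ n) ((H.rep n).gnDeficit_nonneg (H.mass n))
      linarith)
  rw [limitEnergy]
  linarith

theorem le_energy (H : CollapsingSeq s ζ e μ β α v g) (hs : 0 < s) (hζ : 0 ≤ ζ)
    (hμ : ∀ n, 0 ≤ μ n) : ((s + 1) / s - ζ / 12) * Qs s ≤ e := by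
  obtain ⟨φ, c, y, S, hφ, hc, hS, hp⟩ := H.exists_subseq hs hζ
  exact (limitEnergy_ge hs hζ hc y).1.trans
    ((H.comp hφ).limitEnergy_le hs (fun n => hμ _) hc hS hp)

/-- Convergence to `Q0` of sequences whose rescaled energy converges to its minimal value. -/
theorem tendsto_Q0 (H : CollapsingSeq s ζ (((s + 1) / s - ζ / 12) * Qs s) μ β α v g)
    (hs : 0 < s) (hζ : 0 ≤ ζ) (hμ : ∀ n, 0 ≤ μ n) (h0 : ∀ n, v n 0 = (‖v n 0‖ : ℂ)) :
    Tendsto (fun n => ∫ x, ‖v n x - (Q0 x : ℂ)‖ ^ 2) atTop (𝓝 0) ∧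
    Tendsto (fun n => ∫ x, ‖g n x - (derivQ0 x : ℂ)‖ ^ 2) atTop (𝓝 0) := by
  -- The limit is the same for every subsequence, so convergence of the full sequence follows from
  -- this extraction.
  have key : ∀ ns : ℕ → ℕ, Tendsto ns atTop atTop → ∃ ms : ℕ → ℕ,
      Tendsto (fun n => ∫ x, ‖v (ns (ms n)) x - (Q0 x : ℂ)‖ ^ 2) atTop (𝓝 0) ∧
      Tendsto (fun n => ∫ x, ‖g (ns (ms n)) x - (derivQ0 x : ℂ)‖ ^ 2) atTop (𝓝 0) := by
    intro ns hns
    obtain ⟨φ, c, y, S, hφ, hc, hS, hp⟩ := (H.comp hns).exists_subseq hs hζ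
    have H' := (H.comp hns).comp hφ
    have hle := H'.limitEnergy_le hs (fun n => hμ _) hc hS hp
    obtain ⟨hc1, hy⟩ := (limitEnergy_ge hs hζ hc y).2 hle
    -- As `y = 0` and `Q₀(0) = 1`, `c` is the limit of the nonnegative numbers `v n 0`, which
    -- removes the phase ambiguity left by `‖c‖ = 1`.
    have hc2 : c = 1 := by
      have h1 := hp 0
      have h2 : gnProfile c y 0 = c := by
        rw [hy, gnProfile, sub_zero, mul_zero, Q0]; simp
      rw [h2] at h1
      have h3 : Tendsto (fun n => v (ns (φ n)) 0) atTop (𝓝 ((‖c‖ : ℝ) : ℂ)) := by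
        have h4 := (Complex.continuous_ofReal.tendsto _).comp h1.norm
        refine h4.congr fun n => (h0 _).symm
      have h5 := tendsto_nhds_unique h1 h3
      rw [h5, hc1, Complex.ofReal_one]
    rw [hc2, hy] at hp
    refine ⟨φ, ?_, ?_⟩
    · have h1 := tendsto_integral_norm_sub_sq H'.rep H'.mass hS one_ne_zero hp
      simp only [gnProfile_one] at h1
      exact h1
    · simp only [gnProfile_one] at hp
      exact tendsto_integral_deriv_sub_sq H'.rep H'.mass hS hp
        (((H.tendsto_gnDeficit hs hζ).comp hns).comp hφ)
  constructor
  · refine tendsto_of_subseq_tendsto fun ns hns => ?_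
    obtain ⟨ms, h1, -⟩ := key ns hns
    exact ⟨ms, h1⟩
  · refine tendsto_of_subseq_tendsto fun ns hns => ?_
    obtain ⟨ms, -, h1⟩ := key ns hns
    exact ⟨ms, h1⟩

end CollapsingSeq

/-! ### Energy, rescaling and the `H¹` norm -/

theorem eLpNorm_two_sq {f : ℝ → ℂ} (hf : MemLp f 2 volume) :
    eLpNorm f 2 volume ^ 2 = ENNReal.ofReal (∫ x, ‖f x‖ ^ 2) := by
  rw [hf.eLpNorm_eq_integral_rpow_norm two_ne_zero ENNReal.ofNat_ne_top,
    ← ENNReal.ofReal_pow (by positivity)]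
  congr 1
  simp only [ENNReal.toReal_ofNat, Real.rpow_two]
  rw [← Real.rpow_natCast, ← Real.rpow_mul (integral_nonneg fun x => by positivity)]
  norm_num

theorem eLpNorm_eq_one_iff {f : ℝ → ℂ} (hf : MemLp f 2 volume) :
    eLpNorm f 2 volume = 1 ↔ ∫ x, ‖f x‖ ^ 2 = 1 := by
  rw [← ENNReal.ofReal_eq_one, ← eLpNorm_two_sq hf]
  constructor
  · intro h; rw [h, one_pow]
  · intro h
    exact (ENNReal.pow_right_strictMono two_ne_zero).injective (by simpa using h)

/-- The energy of a function of finite potential energy, as a real number. -/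
def realEnergy (s a b : ℝ) (v g : ℝ → ℂ) : ℝ :=
  (∫ x, ‖g x‖ ^ 2) + a / 2 * (∫ x, ‖v x‖ ^ 4) - b / 6 * (∫ x, ‖v x‖ ^ 6) +
    ∫ x, |x| ^ s * ‖v x‖ ^ 2

section Energy

variable {s a b : ℝ} {u v g : ℝ → ℂ}

theorem H1Rep.nlsEnergy_eq (h : H1Rep v g) (hu : u =ᵐ[volume] v) : nlsEnergy s a b u =
    (((∫ x, ‖g x‖ ^ 2) + a / 2 * (∫ x, ‖v x‖ ^ 4) - b / 6 * (∫ x, ‖v x‖ ^ 6) : ℝ) : EReal) +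
    ((∫⁻ x, ENNReal.ofReal (|x| ^ s * ‖v x‖ ^ 2) : ℝ≥0∞) : EReal) := by
  have hg := (h.memH1_of_ae_eq hu).2
  have e1 : ∫ x, ‖weakDeriv u x‖ ^ 2 = ∫ x, ‖g x‖ ^ 2 :=
    integral_congr_ae (hg.mono fun x hx => congrArg (‖·‖ ^ 2) hx)
  have e2 : ∫ x, ‖u x‖ ^ 4 = ∫ x, ‖v x‖ ^ 4 :=
    integral_congr_ae (hu.mono fun x hx => congrArg (‖·‖ ^ 4) hx)
  have e3 : ∫ x, ‖u x‖ ^ 6 = ∫ x, ‖v x‖ ^ 6 :=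
    integral_congr_ae (hu.mono fun x hx => congrArg (‖·‖ ^ 6) hx)
  have e4 : ∫⁻ x, ENNReal.ofReal (|x| ^ s * ‖u x‖ ^ 2) =
      ∫⁻ x, ENNReal.ofReal (|x| ^ s * ‖v x‖ ^ 2) :=
    lintegral_congr_ae (hu.mono fun x hx => by simp only [hx])
  rw [nlsEnergy, e1, e2, e3, e4]

theorem H1Rep.nlsEnergy_eq_realEnergy (h : H1Rep v g) (hu : u =ᵐ[volume] v)
    (hV : Integrable fun x => |x| ^ s * ‖v x‖ ^ 2) :
    nlsEnergy s a b u = (realEnergy s a b v g : EReal) := by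
  rw [h.nlsEnergy_eq hu, ← ofReal_integral_eq_lintegral_ofReal hV
    (Eventually.of_forall fun x => by positivity), EReal.coe_ennreal_ofReal,
    max_eq_left (integral_nonneg fun x => by positivity), ← EReal.coe_add, realEnergy]

theorem H1Rep.integrable_potential (h : H1Rep v g) (hs : 0 ≤ s) (hu : u =ᵐ[volume] v) {r : ℝ}
    (hr : nlsEnergy s a b u ≤ (r : EReal)) : Integrable fun x => |x| ^ s * ‖v x‖ ^ 2 := by
  rw [h.nlsEnergy_eq hu] at hr
  have hc : Continuous fun x : ℝ => |x| ^ s * ‖v x‖ ^ 2 :=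
    (continuous_abs_rpow hs).mul (h.continuous.norm.pow 2)
  refine ⟨hc.aestronglyMeasurable, ?_⟩
  rw [hasFiniteIntegral_iff_ofReal (Eventually.of_forall fun x => by positivity)]
  rw [lt_top_iff_ne_top]
  intro htop
  rw [htop, EReal.coe_ennreal_top, EReal.coe_add_top] at hr
  exact EReal.coe_ne_top r (top_le_iff.1 hr)

end Energy

/-- The derivative of the rescaling of a function. -/
def rescaleDeriv (ℓ : ℝ) (g : ℝ → ℂ) : ℝ → ℂ := fun x => ((ℓ * √ℓ : ℝ) : ℂ) * g (ℓ * x)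

theorem integral_comp_mul (f : ℝ → ℝ) {ℓ : ℝ} (hℓ : 0 < ℓ) :
    ∫ x, f (ℓ * x) = ℓ⁻¹ * ∫ x, f x := by
  rw [Measure.integral_comp_mul_left, abs_of_pos (inv_pos.2 hℓ), smul_eq_mul]

theorem norm_rescale (ℓ : ℝ) (v : ℝ → ℂ) (x : ℝ) : ‖rescale ℓ v x‖ = √ℓ * ‖v (ℓ * x)‖ := by
  rw [rescale, norm_mul, Complex.norm_real, Real.norm_of_nonneg (Real.sqrt_nonneg _)]

theorem rescale_ae_eq {u v : ℝ → ℂ} (hu : u =ᵐ[volume] v) {ℓ : ℝ} (hℓ : 0 < ℓ) :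
    rescale ℓ u =ᵐ[volume] rescale ℓ v := by
  have hq : Measure.QuasiMeasurePreserving (fun x : ℝ => ℓ * x) volume volume := by
    refine ⟨measurable_const_mul ℓ, ?_⟩
    rw [Real.map_volume_mul_left hℓ.ne']
    exact Measure.smul_absolutelyContinuous
  filter_upwards [hq.ae hu] with x hx
  rw [rescale, rescale, hx]

theorem memLp_comp_mul {f : ℝ → ℂ} (hf : MemLp f 2 volume) {ℓ : ℝ} (hℓ : 0 < ℓ) (c : ℂ) :
    MemLp (fun x => c * f (ℓ * x)) 2 volume := by
  have hq : Measure.QuasiMeasurePreserving (fun x : ℝ => ℓ * x) volume volume := by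
    refine ⟨measurable_const_mul ℓ, ?_⟩
    rw [Real.map_volume_mul_left hℓ.ne']
    exact Measure.smul_absolutelyContinuous
  have h1 : AEStronglyMeasurable (fun x => f (ℓ * x)) volume :=
    hf.1.comp_quasiMeasurePreserving hq
  have h2 : MemLp (fun x => f (ℓ * x)) 2 volume := by
    rw [memLp_two_iff_integrable_sq_norm h1]
    exact (((memLp_two_iff_integrable_sq_norm hf.1).1 hf).comp_mul_left' hℓ.ne')
  exact h2.const_mul c

namespace H1Rep

variable {v g w q : ℝ → ℂ}

theorem rescale (h : H1Rep v g) {ℓ : ℝ} (hℓ : 0 < ℓ) :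
    H1Rep (rescale ℓ v) (rescaleDeriv ℓ g) := by
  refine ⟨memLp_comp_mul h.memLp hℓ _, memLp_comp_mul h.memLp' hℓ _, fun x y => ?_⟩
  simp only [NLSCollapse.rescale, rescaleDeriv]
  rw [intervalIntegral.integral_const_mul, intervalIntegral.integral_comp_mul_left _ hℓ.ne',
    ← h.sub_eq, ← mul_sub, Complex.real_smul, ← mul_assoc, ← Complex.ofReal_mul]
  congr 2
  field_simp

theorem const_mul (h : H1Rep v g) (c : ℂ) : H1Rep (fun x => c * v x) (fun x => c * g x) :=
  ⟨h.memLp.const_mul c, h.memLp'.const_mul c, fun x y => by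
    rw [intervalIntegral.integral_const_mul, ← h.sub_eq, mul_sub]⟩

theorem sub (h : H1Rep v g) (h' : H1Rep w q) :
    H1Rep (fun x => v x - w x) (fun x => g x - q x) := by
  refine ⟨h.memLp.sub h'.memLp, h.memLp'.sub h'.memLp', fun x y => ?_⟩
  rw [intervalIntegral.integral_sub (h.hasACDeriv x y).integrable (h'.hasACDeriv x y).integrable,
    ← h.sub_eq, ← h'.sub_eq]
  ring

theorem h1Norm_eq {f : ℝ → ℂ} (h : H1Rep v g) (hf : f =ᵐ[volume] v) :
    h1Norm f = (ENNReal.ofReal ((∫ x, ‖v x‖ ^ 2) + ∫ x, ‖g x‖ ^ 2)) ^ (1 / 2 : ℝ) := by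
  obtain ⟨h1, h2⟩ := h.memH1_of_ae_eq hf
  rw [h1Norm, if_pos h1, eLpNorm_congr_ae hf, eLpNorm_congr_ae h2, eLpNorm_two_sq h.memLp,
    eLpNorm_two_sq h.memLp', ENNReal.ofReal_add (integral_nonneg fun x => by positivity)
    (integral_nonneg fun x => by positivity)]

end H1Rep

theorem tendsto_h1Norm {f : ℕ → ℝ → ℂ} {v g : ℕ → ℝ → ℂ} (h : ∀ n, H1Rep (v n) (g n))
    (hf : ∀ n, f n =ᵐ[volume] v n) (h1 : Tendsto (fun n => ∫ x, ‖v n x‖ ^ 2) atTop (𝓝 0))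
    (h2 : Tendsto (fun n => ∫ x, ‖g n x‖ ^ 2) atTop (𝓝 0)) :
    Tendsto (fun n => h1Norm (f n)) atTop (𝓝 0) := by
  simp only [fun n => (h n).h1Norm_eq (hf n)]
  have h3 := (ENNReal.tendsto_ofReal (h1.add h2)).ennrpow_const (1 / 2 : ℝ)
  rwa [add_zero, ENNReal.ofReal_zero, ENNReal.zero_rpow_of_pos (by norm_num)] at h3

theorem integral_norm_rescale_pow (v : ℝ → ℂ) {ℓ : ℝ} (hℓ : 0 < ℓ) (k : ℕ) :
    ∫ x, ‖rescale ℓ v x‖ ^ k = √ℓ ^ k * ℓ⁻¹ * ∫ x, ‖v x‖ ^ k := by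
  simp only [norm_rescale, mul_pow]
  rw [integral_const_mul, integral_comp_mul (fun x => ‖v x‖ ^ k) hℓ, mul_assoc]

theorem integral_norm_rescaleDeriv_sq (g : ℝ → ℂ) {ℓ : ℝ} (hℓ : 0 < ℓ) :
    ∫ x, ‖rescaleDeriv ℓ g x‖ ^ 2 = ℓ ^ 2 * ∫ x, ‖g x‖ ^ 2 := by
  simp only [rescaleDeriv, norm_mul, mul_pow, Complex.norm_real, Real.norm_eq_abs, sq_abs,
    Real.sq_sqrt hℓ.le]
  rw [integral_const_mul, integral_comp_mul (fun x => ‖g x‖ ^ 2) hℓ]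
  field_simp

theorem potential_rescale (s : ℝ) (v : ℝ → ℂ) {ℓ : ℝ} (hℓ : 0 < ℓ) (x : ℝ) :
    |x| ^ s * ‖rescale ℓ v x‖ ^ 2 = ℓ * ℓ ^ (-s) * (|ℓ * x| ^ s * ‖v (ℓ * x)‖ ^ 2) := by
  have h1 : 0 < ℓ ^ s := Real.rpow_pos_of_pos hℓ s
  rw [norm_rescale, mul_pow, Real.sq_sqrt hℓ.le, abs_mul, abs_of_pos hℓ,
    Real.mul_rpow hℓ.le (abs_nonneg _), Real.rpow_neg hℓ.le]
  field_simp

theorem integral_potential_rescale (s : ℝ) (v : ℝ → ℂ) {ℓ : ℝ} (hℓ : 0 < ℓ) :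
    ∫ x, |x| ^ s * ‖rescale ℓ v x‖ ^ 2 = ℓ ^ (-s) * ∫ x, |x| ^ s * ‖v x‖ ^ 2 := by
  simp only [potential_rescale s v hℓ]
  rw [integral_const_mul, integral_comp_mul (fun x => |x| ^ s * ‖v x‖ ^ 2) hℓ]
  field_simp

theorem integrable_potential_rescale {s : ℝ} {v : ℝ → ℂ} {ℓ : ℝ} (hℓ : 0 < ℓ)
    (hV : Integrable fun x => |x| ^ s * ‖v x‖ ^ 2) :
    Integrable fun x => |x| ^ s * ‖rescale ℓ v x‖ ^ 2 := by
  simp only [potential_rescale s v hℓ]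
  exact (hV.comp_mul_left' hℓ.ne').const_mul _

/-- Kinetic and sextic integrals both scale like `ℓ²`, the quartic like `ℓ` and the potential like
`ℓ^{-s}`. Splitting `b = 𝔟 - (𝔟 - b)` with `𝔟/6 = π²/4` isolates the deficit. -/
theorem realEnergy_eq_scaledEnergy (s a b : ℝ) (v g : ℝ → ℂ) {ℓ : ℝ} (hℓ : 0 < ℓ) :
    realEnergy s a b v g = ℓ ^ s * scaledEnergy s (ℓ ^ (-(s + 2))) ((bCrit - b) * ℓ ^ (-(s + 2)))
      (a * ℓ ^ (-(s + 1))) (rescale ℓ v) (rescaleDeriv ℓ g) := by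
  have hsq : √ℓ ^ 2 = ℓ := Real.sq_sqrt hℓ.le
  have h4 : √ℓ ^ 4 = ℓ ^ 2 := by rw [show √ℓ ^ 4 = (√ℓ ^ 2) ^ 2 by ring, hsq]
  have h6 : √ℓ ^ 6 = ℓ ^ 3 := by rw [show √ℓ ^ 6 = (√ℓ ^ 2) ^ 3 by ring, hsq]
  have h1 : 0 < ℓ ^ s := Real.rpow_pos_of_pos hℓ s
  have e1 : ℓ ^ (-(s + 2)) = (ℓ ^ s * ℓ ^ 2)⁻¹ := by
    rw [Real.rpow_neg hℓ.le, Real.rpow_add hℓ, Real.rpow_two]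
  have e2 : ℓ ^ (-(s + 1)) = (ℓ ^ s * ℓ)⁻¹ := by
    rw [Real.rpow_neg hℓ.le, Real.rpow_add hℓ, Real.rpow_one]
  rw [realEnergy, scaledEnergy, gnDeficit, integral_norm_rescaleDeriv_sq g hℓ,
    integral_norm_rescale_pow v hℓ, integral_norm_rescale_pow v hℓ,
    integral_potential_rescale s v hℓ, h4, h6, e1, e2, bCrit, Real.rpow_neg hℓ.le]
  field_simp
  ring

theorem rescale_rescale_inv (v : ℝ → ℂ) {ℓ : ℝ} (hℓ : 0 < ℓ) : rescale ℓ (rescale ℓ⁻¹ v) = v := by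
  funext x
  have h0 : √ℓ ≠ 0 := (Real.sqrt_pos.2 hℓ).ne'
  rw [rescale, rescale, ← mul_assoc, ← Complex.ofReal_mul, Real.sqrt_inv, mul_inv_cancel₀ h0,
    Complex.ofReal_one, one_mul, inv_mul_cancel_left₀ hℓ.ne']

theorem rescaleDeriv_rescaleDeriv_inv (g : ℝ → ℂ) {ℓ : ℝ} (hℓ : 0 < ℓ) :
    rescaleDeriv ℓ (rescaleDeriv ℓ⁻¹ g) = g := by
  funext x
  have h0 : √ℓ ≠ 0 := (Real.sqrt_pos.2 hℓ).ne'
  have h1 : ℓ * √ℓ * (ℓ⁻¹ * √ℓ⁻¹) = 1 := by rw [Real.sqrt_inv]; field_simp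
  rw [rescaleDeriv, rescaleDeriv, ← mul_assoc, ← Complex.ofReal_mul, h1,
    Complex.ofReal_one, one_mul, inv_mul_cancel_left₀ hℓ.ne']

theorem scaledEnergy_Q0 (s μ β α : ℝ) :
    scaledEnergy s μ β α (fun x => (Q0 x : ℂ)) (fun x => (derivQ0 x : ℂ)) =
      β / 12 + shiftedMoment s 0 + α / Real.pi := by
  have e0 : ∀ x, ‖(Q0 x : ℂ)‖ = Q0 x := fun x => by
    rw [Complex.norm_real, Real.norm_of_nonneg (Q0_pos x).le]
  rw [scaledEnergy, gnDeficit]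
  simp only [e0, Complex.norm_real (derivQ0 _), Real.norm_eq_abs, sq_abs]
  rw [integral_derivQ0_sq, integral_Q0_pow_six, integral_Q0_pow_four, shiftedMoment]
  simp only [add_zero]
  have := Real.pi_pos
  field_simp
  ring

/-- The upper bound on the ground state energy given by the rescaled profile `Q0`. -/
theorem nlsGroundEnergy_le {s : ℝ} (hs : 0 ≤ s) (a b : ℝ) {ℓ : ℝ} (hℓ : 0 < ℓ) :
    nlsGroundEnergy s a b ≤ ((ℓ ^ s * ((bCrit - b) * ℓ ^ (-(s + 2)) / 12 + shiftedMoment s 0 +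
      a * ℓ ^ (-(s + 1)) / Real.pi) : ℝ) : EReal) := by
  set v := rescale ℓ⁻¹ (fun x => (Q0 x : ℂ)) with hv
  set g := rescaleDeriv ℓ⁻¹ (fun x => (derivQ0 x : ℂ)) with hg
  have hℓ' : 0 < ℓ⁻¹ := inv_pos.2 hℓ
  have h : H1Rep v g := h1Rep_Q0.rescale hℓ'
  have hm : ∫ x, ‖v x‖ ^ 2 = 1 := by
    rw [hv, integral_norm_rescale_pow _ hℓ' 2, Real.sq_sqrt hℓ'.le, mul_inv_cancel₀ hℓ'.ne',
      one_mul, ← integral_Q0_sq]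
    simp
  have hV : Integrable fun x => |x| ^ s * ‖v x‖ ^ 2 := by
    refine integrable_potential_rescale hℓ' ?_
    simpa using integrable_abs_rpow_mul_Q0_sq hs
  have hmem : v ∈ nlsDomain := ⟨(h.memH1_of_ae_eq ae_eq_rfl).1, (eLpNorm_eq_one_iff h.memLp).2 hm⟩
  refine (sInf_le (Set.mem_image_of_mem _ hmem)).trans (le_of_eq ?_)
  rw [h.nlsEnergy_eq_realEnergy ae_eq_rfl hV, realEnergy_eq_scaledEnergy s a b v g hℓ, hv, hg,
    rescale_rescale_inv _ hℓ, rescaleDeriv_rescaleDeriv_inv _ hℓ, scaledEnergy_Q0]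

/-! ### Asymptotics of the rescaled parameters -/

theorem ratio_of_pos (s c : ℝ) {t : ℝ} (ht : 0 < t) :
    ratio s c t = ((c * t ^ (-((s + 1) / (s + 2))) : ℝ) : EReal) := by
  rw [ratio, ENNReal.ofReal_rpow_of_pos ht, EReal.coe_ennreal_ofReal,
    max_eq_left (Real.rpow_nonneg ht.le _), EReal.coe_mul]

theorem ratio_zero {s c : ℝ} (hs : 0 < s) (hc : 0 < c) : ratio s c 0 = ⊤ := by
  have h : -((s + 1) / (s + 2)) < 0 := neg_neg_of_pos (by positivity)
  rw [ratio, ENNReal.ofReal_zero, ENNReal.zero_rpow_of_neg h, EReal.coe_ennreal_top,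
    EReal.coe_mul_top_of_pos hc]

/-- The rescaled parameters converge, and the collapse length is positive and tends to zero. -/
structure CollapseRegime (s ζ : ℝ) (a b ℓ : ℕ → ℝ) : Prop where
  pos : ∀ᶠ n in atTop, 0 < ℓ n
  tendsto_zero : Tendsto ℓ atTop (𝓝 0)
  tendsto_α : Tendsto (fun n => a n * ℓ n ^ (-(s + 1))) atTop
    (𝓝 ((6 - ζ) / 6 * Real.pi * Qs s))
  tendsto_β : Tendsto (fun n => (bCrit - b n) * ℓ n ^ (-(s + 2))) atTop (𝓝 (ζ * Qs s))

theorem rpow_one_div_rpow_neg {d q r : ℝ} (hd : 0 < d) :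
    (d ^ (1 / q)) ^ (-r) = d ^ (-(r / q)) := by
  rw [← Real.rpow_mul hd.le]; congr 1; ring

/-- Here `α` is eventually equal to its limit `A` by the choice of `ℓ`, so only the limit of `β` is
left to assume. `A` is negative when `ζ > 6`, which is why positivity is asked of `a n / A`. -/
theorem collapseRegime_of_length_a {s ζ A : ℝ} {a b ℓ : ℕ → ℝ} (hs : 0 < s)
    (hA : A = (6 - ζ) / 6 * Real.pi * Qs s) (hA0 : A ≠ 0) (ha : Tendsto a atTop (𝓝 0))
    (hpos : ∀ᶠ n in atTop, 0 < a n / A)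
    (hβ : Tendsto (fun n => (bCrit - b n) * (a n / A) ^ (-((s + 2) / (s + 1)))) atTop
      (𝓝 (ζ * Qs s))) (hℓ : ∀ n, ℓ n = (a n / A) ^ (1 / (s + 1))) :
    CollapseRegime s ζ a b ℓ := by
  have hs1 : s + 1 ≠ 0 := by positivity
  refine ⟨?_, ?_, ?_, ?_⟩
  · filter_upwards [hpos] with n hn
    rw [hℓ]; exact Real.rpow_pos_of_pos hn _
  · have h1 := (ha.div_const A).rpow_const (p := 1 / (s + 1)) (Or.inr (by positivity))
    rw [zero_div, Real.zero_rpow (by positivity)] at h1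
    exact h1.congr fun n => (hℓ n).symm
  · rw [← hA]
    refine tendsto_const_nhds.congr' ?_
    filter_upwards [hpos] with n hn
    rw [hℓ, rpow_one_div_rpow_neg hn, div_self hs1, Real.rpow_neg_one, inv_div]
    have : a n ≠ 0 := fun h => by rw [h, zero_div] at hn; exact lt_irrefl _ hn
    field_simp
  · refine hβ.congr' ?_
    filter_upwards [hpos] with n hn
    rw [hℓ, rpow_one_div_rpow_neg hn]

theorem collapseRegime {s ζ : ℝ} (hs : 0 < s) (hζ : 0 ≤ ζ) {a b ℓ : ℕ → ℝ}
    (hb : ∀ n, b n ∈ Set.Ioc 0 bCrit) (ha_lim : Tendsto a atTop (𝓝 0))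
    (hb_lim : Tendsto b atTop (𝓝 bCrit)) (hab : ∀ n, 0 < max 0 (a n) + (bCrit - b n))
    (h_ratio : Tendsto (fun n => ratio s (a n) (bCrit - b n)) atTop
      (𝓝 (ratio s (Real.pi * ((6 - ζ) / 6) * Qs s ^ (1 / (s + 2))) ζ)))
    (hℓ : IsCollapseLength s ζ a b ℓ) : CollapseRegime s ζ a b ℓ := by
  have hQ := Qs_pos hs
  have hπ := Real.pi_pos
  set p := (s + 1) / (s + 2) with hp
  have hp0 : 0 < p := by positivity
  have hpinv : (s + 2) / (s + 1) = p⁻¹ := by rw [hp, inv_div]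
  have ht0 : ∀ n, 0 ≤ bCrit - b n := fun n => sub_nonneg.2 (hb n).2
  have ht_lim : Tendsto (fun n => bCrit - b n) atTop (𝓝 0) := by
    simpa using (tendsto_const_nhds (x := bCrit)).sub hb_lim
  have hapos : ∀ n, bCrit - b n = 0 → 0 < a n := fun n hn => by
    have := hab n
    rw [hn, add_zero] at this
    exact (lt_max_iff.1 this).resolve_left (lt_irrefl _)
  set A := (6 - ζ) / 6 * Real.pi * Qs s with hA
  have hform : ζ ≠ 6 → ∀ n, 6 * a n / ((6 - ζ) * Real.pi * Qs s) = a n / A := fun h n => by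
    have : 6 - ζ ≠ 0 := sub_ne_zero.2 h.symm
    rw [hA]; field_simp
  rcases hζ.eq_or_lt with h0 | h0
  · have hA0 : 0 < A := by rw [hA, ← h0]; positivity
    rcases hℓ with ⟨h6, hℓ⟩ | ⟨hne, -⟩
    swap
    · exact absurd h0.symm hne
    have htop : ratio s (Real.pi * ((6 - ζ) / 6) * Qs s ^ (1 / (s + 2))) ζ = ⊤ := by
      rw [← h0]
      exact ratio_zero hs (by positivity)
    rw [htop] at h_ratio
    -- Indices with `b n = 𝔟` are allowed when `ζ = 0`; there the nondegeneracy condition gives `a n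
    -- > 0` and the inequality is immediate.
    have hMt : ∀ M : ℝ, 0 < M → ∀ᶠ n in atTop, 0 < a n ∧ M * (bCrit - b n) ^ p < a n := by
      intro M hM
      filter_upwards [h_ratio.eventually_const_lt (EReal.coe_lt_top M)] with n hn
      rcases (ht0 n).eq_or_lt with h | h
      · have := hapos n h.symm
        rw [← h, Real.zero_rpow hp0.ne', mul_zero]
        exact ⟨this, this⟩
      · rw [ratio_of_pos s _ h, EReal.coe_lt_coe_iff, ← hp, Real.rpow_neg h.le,
          ← div_eq_mul_inv, lt_div_iff₀ (Real.rpow_pos_of_pos h p)] at hn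
        exact ⟨lt_trans (mul_pos hM (Real.rpow_pos_of_pos h p)) hn, hn⟩
    have hpos : ∀ᶠ n in atTop, 0 < a n / A := by
      filter_upwards [hMt 1 one_pos] with n hn
      exact div_pos hn.1 hA0
    refine collapseRegime_of_length_a hs hA hA0.ne' ha_lim hpos ?_
      fun n => by rw [hℓ, hform h6]
    rw [← h0, zero_mul, Metric.tendsto_nhds]
    intro ε hε
    have hεp : 0 < ε ^ p := Real.rpow_pos_of_pos hε p
    filter_upwards [hMt (A / ε ^ p) (div_pos hA0 hεp), hpos] with n hn hn'
    have hd : 0 < (a n / A) ^ (-((s + 2) / (s + 1))) := Real.rpow_pos_of_pos hn' _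
    rw [Real.dist_eq, sub_zero, abs_of_nonneg (mul_nonneg (ht0 n) hd.le), hpinv,
      Real.rpow_neg hn'.le, ← div_eq_mul_inv, div_lt_iff₀ (Real.rpow_pos_of_pos hn' _)]
    have h1 : (bCrit - b n) ^ p < ε ^ p * (a n / A) := by
      have := hn.2
      rw [div_mul_eq_mul_div, div_lt_iff₀ hεp] at this
      rw [← mul_div_assoc, lt_div_iff₀ hA0]
      linarith
    have h2 := Real.rpow_lt_rpow (Real.rpow_nonneg (ht0 n) p) h1 (inv_pos.2 hp0)
    rwa [Real.rpow_rpow_inv (ht0 n) hp0.ne', Real.mul_rpow hεp.le hn'.le,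
      Real.rpow_rpow_inv hε.le hp0.ne'] at h2
  · set R := Real.pi * ((6 - ζ) / 6) * Qs s ^ (1 / (s + 2)) * ζ ^ (-p) with hR
    rw [ratio_of_pos s _ h0] at h_ratio
    -- The ratio is `⊤` whenever `b n = 𝔟`, which a finite limit excludes eventually.
    have htpos : ∀ᶠ n in atTop, 0 < bCrit - b n := by
      filter_upwards [h_ratio.eventually_lt_const (EReal.coe_lt_top _)] with n hn
      refine (ht0 n).lt_of_ne fun h => ?_
      rw [← h, ratio_zero hs (hapos n h.symm)] at hn
      exact lt_irrefl _ hn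
    have hr : Tendsto (fun n => a n * (bCrit - b n) ^ (-p)) atTop (𝓝 R) := by
      rw [← EReal.tendsto_coe]
      refine h_ratio.congr' ?_
      filter_upwards [htpos] with n hn
      exact ratio_of_pos s _ hn
    have hζQ : 0 < ζ * Qs s := mul_pos h0 hQ
    -- Since `1/(s+2) = 1 - p`, the limit of the ratio is `A (ζ𝒬_s)^{-p}`. This is what makes the
    -- two formulas for the length asymptotically equivalent.
    have hRA : R = A * (ζ * Qs s) ^ (-p) := by
      have h1 : Qs s ^ (1 / (s + 2)) = Qs s * Qs s ^ (-p) := by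
        rw [← Real.rpow_one_add' hQ.le]
        · congr 1; rw [hp]; field_simp; ring
        · rw [hp]
          have : 1 + -((s + 1) / (s + 2)) = 1 / (s + 2) := by field_simp; ring
          rw [this]; positivity
      rw [hR, hA, h1, Real.mul_rpow h0.le hQ.le]
      ring
    rcases hℓ with ⟨h6, hℓ⟩ | ⟨hne, hℓ⟩
    · have hA0 : A ≠ 0 := by
        rw [hA]
        have : 6 - ζ ≠ 0 := sub_ne_zero.2 h6.symm
        positivity
      have hrA : Tendsto (fun n => a n * (bCrit - b n) ^ (-p) / A) atTop
          (𝓝 ((ζ * Qs s) ^ (-p))) := by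
        have h1 := hr.div_const A
        rwa [hRA, mul_div_cancel_left₀ _ hA0] at h1
      have hlim0 : 0 < (ζ * Qs s) ^ (-p) := Real.rpow_pos_of_pos hζQ _
      have hrpos := hrA.eventually_const_lt hlim0
      have hd : ∀ n, 0 < bCrit - b n → a n / A =
          (a n * (bCrit - b n) ^ (-p) / A) * (bCrit - b n) ^ p := fun n hn => by
        rw [Real.rpow_neg hn.le]
        have := (Real.rpow_pos_of_pos hn p).ne'
        field_simp
      refine collapseRegime_of_length_a hs hA hA0 ha_lim ?_ ?_ fun n => by rw [hℓ, hform h6]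
      · filter_upwards [hrpos, htpos] with n h1 h2
        rw [hd n h2]
        exact mul_pos h1 (Real.rpow_pos_of_pos h2 p)
      · have h1 := hrA.rpow_const (p := -p⁻¹) (Or.inl hlim0.ne')
        rw [← Real.rpow_mul hζQ.le, neg_mul_neg, mul_inv_cancel₀ hp0.ne', Real.rpow_one] at h1
        refine h1.congr' ?_
        filter_upwards [hrpos, htpos] with n h2 h3
        have h4 : ((bCrit - b n) ^ p) ^ (-p⁻¹) = (bCrit - b n)⁻¹ := by
          rw [← Real.rpow_mul h3.le, mul_neg, mul_inv_cancel₀ hp0.ne', Real.rpow_neg_one]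
        rw [hd n h3, hpinv, Real.mul_rpow h2.le (Real.rpow_nonneg h3.le p), h4]
        field_simp
    · have hs2 : s + 2 ≠ 0 := by positivity
      have hdpos : ∀ᶠ n in atTop, 0 < (bCrit - b n) / (ζ * Qs s) := by
        filter_upwards [htpos] with n hn
        exact div_pos hn hζQ
      refine ⟨?_, ?_, ?_, ?_⟩
      · filter_upwards [hdpos] with n hn
        rw [hℓ]; exact Real.rpow_pos_of_pos hn _
      · have h1 := (ht_lim.div_const (ζ * Qs s)).rpow_const (p := 1 / (s + 2))
          (Or.inr (by positivity))
        rw [zero_div, Real.zero_rpow (by positivity)] at h1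
        exact h1.congr fun n => (hℓ n).symm
      · have h1 := hr.mul_const ((ζ * Qs s) ^ p)
        rw [hRA, mul_assoc, ← Real.rpow_add hζQ, neg_add_cancel, Real.rpow_zero, mul_one] at h1
        refine h1.congr' ?_
        filter_upwards [hdpos, htpos] with n hn hn'
        rw [hℓ, rpow_one_div_rpow_neg hn, ← hp, Real.div_rpow hn'.le hζQ.le, Real.rpow_neg hζQ.le,
          div_inv_eq_mul, mul_assoc]
      · refine tendsto_const_nhds.congr' ?_
        filter_upwards [hdpos, htpos] with n hn hn'
        rw [hℓ, rpow_one_div_rpow_neg hn, div_self hs2, Real.rpow_neg_one, inv_div]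
        field_simp

/-! ### Asymptotics of the ground state energy and convergence of approximate ground states -/

theorem scaledEnergy_const_mul (s μ β α : ℝ) (v g : ℝ → ℂ) {c : ℂ} (hc : ‖c‖ = 1) :
    scaledEnergy s μ β α (fun x => c * v x) (fun x => c * g x) = scaledEnergy s μ β α v g := by
  simp only [scaledEnergy, gnDeficit, norm_mul, hc, one_mul]

theorem integral_norm_rescale_sq {w : ℝ → ℂ} (hm : ∫ x, ‖w x‖ ^ 2 = 1) {ℓ : ℝ} (hℓ : 0 < ℓ) :
    ∫ x, ‖rescale ℓ w x‖ ^ 2 = 1 := by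
  rw [integral_norm_rescale_pow w hℓ 2, hm, Real.sq_sqrt hℓ.le, mul_inv_cancel₀ hℓ.ne', one_mul]

theorem H1Rep.scaledEnergy_rescale_le {s a b r ℓ : ℝ} {u w g : ℝ → ℂ} (h : H1Rep w g) (hs : 0 ≤ s)
    (hu : u =ᵐ[volume] w) (hℓ : 0 < ℓ) (hr : nlsEnergy s a b u ≤ ((r * ℓ ^ s : ℝ) : EReal)) :
    scaledEnergy s (ℓ ^ (-(s + 2))) ((bCrit - b) * ℓ ^ (-(s + 2))) (a * ℓ ^ (-(s + 1)))
      (NLSCollapse.rescale ℓ w) (rescaleDeriv ℓ g) ≤ r := by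
  rw [h.nlsEnergy_eq_realEnergy hu (h.integrable_potential hs hu hr), EReal.coe_le_coe_iff,
    realEnergy_eq_scaledEnergy s a b w g hℓ, mul_comm r] at hr
  exact le_of_mul_le_mul_left hr (Real.rpow_pos_of_pos hℓ s)

namespace CollapseRegime

variable {s ζ : ℝ} {a b ℓ : ℕ → ℝ} (R : CollapseRegime s ζ a b ℓ)
include R

/-- The rescaling of a sequence of states of low energy, up to phases, is a collapsing sequence. -/
theorem collapsingSeq (hs : 0 < s) (hb : ∀ n, b n ≤ bCrit) {φ : ℕ → ℕ}
    (hφ : Tendsto φ atTop atTop) (hℓ : ∀ k, 0 < ℓ (φ k)) {e : ℝ} {E : ℕ → ℝ}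
    (hE : Tendsto E atTop (𝓝 e)) {u w g : ℕ → ℝ → ℂ} (hu : ∀ k, u k ∈ nlsDomain)
    (hw : ∀ k, u k =ᵐ[volume] w k) (h : ∀ k, H1Rep (w k) (g k))
    (hle : ∀ k, nlsEnergy s (a (φ k)) (b (φ k)) (u k) ≤ ((E k * ℓ (φ k) ^ s : ℝ) : EReal))
    {c : ℕ → ℂ} (hc : ∀ k, ‖c k‖ = 1) :
    CollapsingSeq s ζ e (fun k => ℓ (φ k) ^ (-(s + 2)))
      (fun k => (bCrit - b (φ k)) * ℓ (φ k) ^ (-(s + 2))) (fun k => a (φ k) * ℓ (φ k) ^ (-(s + 1)))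
      (fun k x => c k * rescale (ℓ (φ k)) (w k) x)
      (fun k x => c k * rescaleDeriv (ℓ (φ k)) (g k) x) where
  rep k := ((h k).rescale (hℓ k)).const_mul (c k)
  mass k := by
    simp only [norm_mul, hc, one_mul]
    refine integral_norm_rescale_sq ?_ (hℓ k)
    rw [← eLpNorm_eq_one_iff (h k).memLp, ← eLpNorm_congr_ae (hw k)]
    exact (hu k).2
  pot k := by
    simp only [norm_mul, hc, one_mul]
    exact integrable_potential_rescale (hℓ k) ((h k).integrable_potential hs.le (hw k) (hle k))
  tendsto_μ := by
    have h1 : Tendsto (fun k => ℓ (φ k)) atTop (𝓝[>] 0) :=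
      tendsto_nhdsWithin_iff.2 ⟨R.tendsto_zero.comp hφ, Eventually.of_forall hℓ⟩
    exact (tendsto_rpow_neg_nhdsGT_zero (by linarith)).comp h1
  nonneg_β k := mul_nonneg (sub_nonneg.2 (hb _)) (Real.rpow_nonneg (hℓ k).le _)
  tendsto_β := R.tendsto_β.comp hφ
  tendsto_α := R.tendsto_α.comp hφ
  energy := ⟨E, hE, fun k => by
    rw [scaledEnergy_const_mul _ _ _ _ _ _ (hc k)]
    exact (h k).scaledEnergy_rescale_le hs.le (hw k) (hℓ k) (hle k)⟩

/-- Otherwise states of energy below `e ℓ^s` exist along a subsequence; rescaled, they form a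
collapsing sequence violating `le_energy`. -/
theorem eventually_le_nlsGroundEnergy (hs : 0 < s) (hζ : 0 ≤ ζ) (hb : ∀ n, b n ≤ bCrit) {e : ℝ}
    (he : e < ((s + 1) / s - ζ / 12) * Qs s) :
    ∀ᶠ n in atTop, ((e * ℓ n ^ s : ℝ) : EReal) ≤ nlsGroundEnergy s (a n) (b n) := by
  by_contra hcon
  rw [not_eventually] at hcon
  obtain ⟨φ, hφ, hφ'⟩ := extraction_of_frequently_atTop (hcon.and_eventually R.pos)
  have hex : ∀ k, ∃ u ∈ nlsDomain, nlsEnergy s (a (φ k)) (b (φ k)) u <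
      ((e * ℓ (φ k) ^ s : ℝ) : EReal) := fun k => by
    obtain ⟨_, ⟨u, hu, rfl⟩, hlt⟩ := sInf_lt_iff.1 (not_le.1 (hφ' k).1)
    exact ⟨u, hu, hlt⟩
  choose u hu hlt using hex
  choose w hw h using fun k => (hu k).1.exists_h1Rep
  have H := R.collapsingSeq hs hb hφ.tendsto_atTop (fun k => (hφ' k).2)
    (tendsto_const_nhds (x := e)) hu hw h (fun k => (hlt k).le) (c := fun _ => 1)
    fun _ => norm_one
  exact absurd (H.le_energy hs hζ fun k => Real.rpow_nonneg (hφ' k).2.le _) (not_le.2 he)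

theorem tendsto_trialEnergy (hs : 0 < s) :
    Tendsto (fun n => (bCrit - b n) * ℓ n ^ (-(s + 2)) / 12 + shiftedMoment s 0 +
      a n * ℓ n ^ (-(s + 1)) / Real.pi) atTop (𝓝 (((s + 1) / s - ζ / 12) * Qs s)) := by
  have h1 := ((R.tendsto_β.div_const 12).add_const (shiftedMoment s 0)).add
    (R.tendsto_α.div_const Real.pi)
  convert h1 using 2
  have hπ := Real.pi_pos
  rw [Qs_eq]
  field_simp
  ring

theorem exists_nlsGroundEnergy_eq (hs : 0 < s) (hζ : 0 ≤ ζ) (hb : ∀ n, b n ≤ bCrit) :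
    ∃ ε : ℕ → ℝ, Tendsto ε atTop (𝓝 0) ∧ ∀ᶠ n in atTop, nlsGroundEnergy s (a n) (b n) =
      ((((s + 1) / s - ζ / 12 + ε n) * Qs s * ℓ n ^ s : ℝ) : EReal) := by
  have hQ := Qs_pos hs
  set e := ((s + 1) / s - ζ / 12) * Qs s with he
  have hreal : ∀ᶠ n in atTop, 0 < ℓ n ^ s ∧
      (((nlsGroundEnergy s (a n) (b n)).toReal : ℝ) : EReal) = nlsGroundEnergy s (a n) (b n) := by
    filter_upwards [R.pos, R.eventually_le_nlsGroundEnergy hs hζ hb (sub_one_lt e)] with n hn h1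
    have h2 := nlsGroundEnergy_le hs.le (a n) (b n) hn
    exact ⟨Real.rpow_pos_of_pos hn s, EReal.coe_toReal (h2.trans_lt (EReal.coe_lt_top _)).ne
      ((EReal.bot_lt_coe _).trans_le h1).ne'⟩
  have hlim : Tendsto (fun n => (nlsGroundEnergy s (a n) (b n)).toReal / ℓ n ^ s) atTop (𝓝 e) := by
    refine tendsto_order.2 ⟨fun x hx => ?_, fun x hx => ?_⟩
    · obtain ⟨y, hxy, hy⟩ := exists_between hx
      filter_upwards [hreal, R.eventually_le_nlsGroundEnergy hs hζ hb hy] with n ⟨hn, h1⟩ h2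
      rw [← h1, EReal.coe_le_coe_iff] at h2
      exact hxy.trans_le ((le_div_iff₀ hn).2 h2)
    · filter_upwards [hreal, R.pos, (R.tendsto_trialEnergy hs).eventually_lt_const hx]
        with n ⟨hn, h1⟩ hpos h2
      have h3 := nlsGroundEnergy_le hs.le (a n) (b n) hpos
      rw [← h1, EReal.coe_le_coe_iff, mul_comm] at h3
      exact ((div_le_iff₀ hn).2 h3).trans_lt h2
  refine ⟨fun n => (nlsGroundEnergy s (a n) (b n)).toReal / ℓ n ^ s / Qs s -
    ((s + 1) / s - ζ / 12), ?_, ?_⟩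
  · have h1 := (hlim.div_const (Qs s)).sub_const ((s + 1) / s - ζ / 12)
    rwa [he, mul_div_cancel_right₀ _ hQ.ne', sub_self] at h1
  · filter_upwards [hreal] with n ⟨hn, h1⟩
    rw [← h1, EReal.coe_eq_coe_iff, EReal.toReal_coe]
    field_simp
    ring

/-- The trial state bounds the rescaled energies by a sequence converging to the minimal value, the
error `δ n / ℓ n ^ s` being negligible; `tendsto_Q0` applies. The phase is fixed on the continuous
representative `w`, whose value at the origin is meaningful. -/
theorem tendsto_h1Norm (hs : 0 < s) (hζ : 0 ≤ ζ) (hb : ∀ n, b n ≤ bCrit) {u w g : ℕ → ℝ → ℂ}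
    (hu : IsApproxGroundStates s a b (fun n => ℓ n ^ s) u) (hw : ∀ n, u n =ᵐ[volume] w n)
    (h : ∀ n, H1Rep (w n) (g n)) {c : ℕ → ℂ} (hc : ∀ n, ‖c n‖ = 1)
    (h0 : ∀ n, c n * w n 0 = (‖w n 0‖ : ℂ)) :
    Tendsto (fun n => h1Norm fun x => c n * rescale (ℓ n) (u n) x - (Q0 x : ℂ)) atTop (𝓝 0) := by
  obtain ⟨hmem, δ, hδ, hE⟩ := hu
  set T := fun n => (bCrit - b n) * ℓ n ^ (-(s + 2)) / 12 + shiftedMoment s 0 +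
      a n * ℓ n ^ (-(s + 1)) / Real.pi with hT
  have hTδ : Tendsto (fun n => T n + δ n / ℓ n ^ s) atTop
      (𝓝 (((s + 1) / s - ζ / 12) * Qs s)) := by
    simpa only [add_zero] using (R.tendsto_trialEnergy hs).add hδ.tendsto_div_nhds_zero
  have hev : ∀ᶠ n in atTop, 0 < ℓ n ∧ nlsEnergy s (a n) (b n) (u n) ≤
      (((T n + δ n / ℓ n ^ s) * ℓ n ^ s : ℝ) : EReal) := by
    filter_upwards [R.pos, hE] with n hn h1
    refine ⟨hn, h1.trans ((add_le_add_left (nlsGroundEnergy_le hs.le (a n) (b n) hn) _).trans_eq ?_)⟩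
    rw [← EReal.coe_add, add_mul, div_mul_cancel₀ _ (Real.rpow_pos_of_pos hn s).ne', mul_comm]
  -- Positivity of `ℓ n` and the energy bound hold only eventually, so the first `N` terms are
  -- discarded.
  obtain ⟨N, hN⟩ := eventually_atTop.1 hev
  have hN' : ∀ k, _ := fun k => hN (k + N) (Nat.le_add_left N k)
  have hφ : Tendsto (fun k : ℕ => k + N) atTop atTop := tendsto_add_atTop_nat N
  have H := R.collapsingSeq hs hb hφ (fun k => (hN' k).1) (hTδ.comp hφ)
    (fun k => hmem (k + N)) (fun k => hw (k + N)) (fun k => h (k + N)) (fun k => (hN' k).2)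
    (c := fun k => c (k + N)) fun k => hc _
  obtain ⟨h1, h2⟩ := H.tendsto_Q0 hs hζ (fun k => Real.rpow_nonneg (hN' k).1.le _) fun k => by
    rw [norm_mul, hc, one_mul, norm_rescale, rescale, mul_zero, mul_left_comm, h0,
      Complex.ofReal_mul]
  rw [← tendsto_add_atTop_iff_nat N]
  refine NLSCollapse.tendsto_h1Norm (fun k => (H.rep k).sub h1Rep_Q0) (fun k => ?_) h1 h2
  filter_upwards [rescale_ae_eq (hw (k + N)) (hN' k).1] with x hx
  rw [hx]

end CollapseRegime

theorem exp_neg_arg_mul (z : ℂ) :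
    Complex.exp (Complex.I * ((-z.arg : ℝ) : ℂ)) * z = (‖z‖ : ℂ) := by
  have h1 : Complex.exp (Complex.I * ((-z.arg : ℝ) : ℂ)) * Complex.exp (z.arg * Complex.I) = 1 := by
    rw [← Complex.exp_add, Complex.ofReal_neg, mul_neg, mul_comm, neg_add_cancel, Complex.exp_zero]
  have h2 := Complex.norm_mul_exp_arg_mul_I z
  linear_combination (‖z‖ : ℂ) * h1 - Complex.exp (Complex.I * ((-z.arg : ℝ) : ℂ)) * h2

end

end NLSCollapse

theorem theorem2 (s ζ : ℝ) (hs : 0 < s) (hζ : 0 ≤ ζ) (a b ℓ : ℕ → ℝ)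
    (hb : ∀ n, b n ∈ Set.Ioc 0 NLSCollapse.bCrit)
    (ha_lim : Tendsto a atTop (𝓝 0))
    (hb_lim : Tendsto b atTop (𝓝 NLSCollapse.bCrit))
    (hab : ∀ n, 0 < max 0 (a n) + (NLSCollapse.bCrit - b n))
    (h_ratio : Tendsto (fun n => NLSCollapse.ratio s (a n) (NLSCollapse.bCrit - b n)) atTop
      (𝓝 (NLSCollapse.ratio s
        (Real.pi * ((6 - ζ) / 6) * NLSCollapse.Qs s ^ (1 / (s + 2))) ζ)))
    (hℓ : NLSCollapse.IsCollapseLength s ζ a b ℓ) :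
    (∀ u : ℕ → ℝ → ℂ, NLSCollapse.IsApproxGroundStates s a b (fun n => ℓ n ^ s) u →
      (∃ θ : ℕ → ℝ, Tendsto (fun n => NLSCollapse.h1Norm (fun x =>
          Complex.exp (Complex.I * (θ n : ℂ)) * NLSCollapse.rescale (ℓ n) (u n) x
            - (NLSCollapse.Q0 x : ℂ))) atTop (𝓝 0)) ∧
      ((∀ n, ∀ᵐ x, u n x = (‖u n x‖ : ℂ)) →
        Tendsto (fun n => NLSCollapse.h1Norm (fun x =>
          NLSCollapse.rescale (ℓ n) (u n) x - (NLSCollapse.Q0 x : ℂ))) atTop (𝓝 0))) ∧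
    (∃ ε : ℕ → ℝ, Tendsto ε atTop (𝓝 0) ∧ ∀ᶠ n in atTop,
      NLSCollapse.nlsGroundEnergy s (a n) (b n) =
        ((((s + 1) / s - ζ / 12 + ε n) * NLSCollapse.Qs s * ℓ n ^ s : ℝ) : EReal)) := by
  have R := NLSCollapse.collapseRegime hs hζ hb ha_lim hb_lim hab h_ratio hℓ
  have hb' : ∀ n, b n ≤ NLSCollapse.bCrit := fun n => (hb n).2
  refine ⟨fun u hu => ?_, R.exists_nlsGroundEnergy_eq hs hζ hb'⟩
  choose w hw h using fun n => (hu.1 n).1.exists_h1Rep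
  refine ⟨⟨fun n => -(w n 0).arg, ?_⟩, fun hpos => ?_⟩
  · refine R.tendsto_h1Norm hs hζ hb' hu hw h (fun n => ?_) fun n =>
      NLSCollapse.exp_neg_arg_mul (w n 0)
    rw [mul_comm, Complex.norm_exp_ofReal_mul_I]
  -- By continuity, nonnegativity almost everywhere becomes nonnegativity everywhere for `w n`, so
  -- the trivial phase already satisfies the normalization at the origin.
  · have h1 : ∀ n, w n = fun x => (‖w n x‖ : ℂ) := fun n => by
      have hc := (h n).continuous
      refine Continuous.ae_eq_iff_eq volume hc (Complex.continuous_ofReal.comp hc.norm) |>.1 ?_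
      filter_upwards [hw n, hpos n] with x hx hx'
      rw [Function.comp_apply, ← hx]
      exact hx'
    simpa using R.tendsto_h1Norm hs hζ hb' hu hw h (c := fun _ => 1) (fun _ => norm_one)
      fun n => (one_mul _).trans (congrFun (h1 n) 0)
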